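/- An increasing ordered tree on $n+1$ nodes is a rooted tree with nodes labeled $0,1,\dots,n$ whose labels increase along every path from the root $0$, together with a total order of the children of each node. It is $r$-flourishing if the root has at least $r$ children and none of the first $r$ children of the root is a leaf. (1) For every $n\ge 0$, the number of $2$-flourishing increasing ordered trees on $n+1$ nodes is \[ \sum_{\pi=\pi_1\mid\cdots\mid\pi_k} f(\pi)\,(2|\pi_1|-3)!!\cdots(2|\pi_k|-3)!!,\qquad f(\pi)=s(s-1)\,(k-2)!, \] where the sum runs over all set partitions $\pi$ of $[n]=\{1,\dots,n\}$, $k$ is the number of blocks of $\pi$, $s$ is the number of its nonsingleton blocks, $(-1)!!=1$, and $f(\pi)=0$ whenever $s\le 1$ (in particular when $k\le 1$). (2) Let $\Sigma$ be a totally ordered set with $|\Sigma|=2$. Put $[[n]]=\{1,\bar 1,\dots,n,\bar n\}$, with the involution exchanging $i$ and $\bar i$. A $\Sigma$-labeled partition $x$ of $[[n]]$ is a partition of $[[n]]$ into nonempty blocks, closed under $R\mapsto\bar R$, in which the blocks with $R=\bar R$ (the signed blocks) carry pairwise distinct signs in $\Sigma$; the other blocks are called unsigned. Write $x_\sigma$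 for the block of sign $\sigma$ (with $x_\sigma=\emptyset$ if there is none) and $\Sigma(x)=\{\sigma : x_\sigma\ne\emptyset\}$. Set $x\preceq y$ if $x_\sigma\subseteq y_\sigma$ for all $\sigma\in\Sigma$ and every unsigned block of $x$ is contained in a block of $y$. Let $\Pi_{n,\Sigma}$ be the poset of all $\Sigma$-labeled partitions of $[[n]]$ with a new top element $\hat 1$ added; let $\hat 0$ be the partition into singletons. The toric type $D_n$ poset is the subposet of $\Pi_{n,\Sigma}$ consisting of $\hat 1$ and of all $x$ with $|x_\sigma|\neq 2$ for every $\sigma\in\Sigma$. The representative of a block $R$ is the least $i\in[n]$ with $i\in R$ or $\bar i\in R$, and $R$ is normalized if it contains its representative. An edge $x\prec\!\cdot\,y$ of the Hasse diagram is labeled as follows, labels being ordered lexicographically: - $(0,\max(i,j))$ if $R\cup R'\in y$ for some distinct normalized unsigned blocks $R,R'$ of $x$ with representatives $i,j$; - $(2,\min(i,j))$ if $R\cup\overline{R'}\in y$ for some distinct normalized unsigned blocks $R,R'$ of $x$ with representatives $i,j$; - if $x_\sigma\subsetneq y_\sigma$: $(1,|\{\tau\in\Sigma(x):\tau\le\sigma\}|)$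 when $\sigma\in\Sigma(x)$, and $(1,|\{\tau\in\Sigma:\tau\le\sigma\}\cup\Sigma(x)|)$ when $\sigma\notin\Sigma(x)$; - $(1,2)$ if $y=\hat 1$. A maximal chain from $\hat 0$ to $\hat 1$ is decreasing if its sequence of labels, read from $\hat 0$ to $\hat 1$, is weakly decreasing. Then for every $n\ge 2$ the number of decreasing maximal chains from $\hat 0$ to $\hat 1$ in the toric type $D_n$ poset is \[ (2n-5)!!\,(n-2)(n-3)+(2n-3)!!=(2n-5)!!\,(n^2-3n+3). \] -/

import Mathlib

open scoped Nat

/-! ### Labeled partitions -/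

/-- The set `[[n]] = {1, 1̄, …, n, n̄}`: the pair `(i, false)` stands for the (zero-based) `i`-th
element of `[n]`, and `(i, true)` stands for its barred copy. -/
abbrev BarredSet (n : ℕ) : Type := Fin n × Bool

/-- `R̄ = {ā | a ∈ R}`, for the involution of `[[n]]` that exchanges `i` and `ī`. -/
def barSet {n : ℕ} (R : Finset (BarredSet n)) : Finset (BarredSet n) :=
  R.image fun a => (a.1, !a.2)

/-- An `S`-labeled partition `x` of `[[n]]`. The signs form the type `S`; `x.signed σ` is the
block `x_σ` that carries the sign `σ`, and it is `∅` if no block of `x` carries the sign `σ`. -/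
@[ext]
structure LabeledPartition (n : ℕ) (S : Type*) where
  /-- the underlying partition of `[[n]]` (its blocks are nonempty) -/
  partition : Finpartition (Finset.univ : Finset (BarredSet n))
  /-- the block carrying a given sign, or `∅` -/
  signed : S → Finset (BarredSet n)
  signed_mem : ∀ σ, (signed σ).Nonempty → signed σ ∈ partition.parts
  /-- a block carries at most one sign -/
  signed_inj : ∀ σ τ, (signed σ).Nonempty → signed σ = signed τ → σ = τ
  bar_mem : ∀ R ∈ partition.parts, barSet R ∈ partition.parts
  /-- a block is signed exactly if it is invariant under the bar -/
  bar_eq_iff : ∀ R ∈ partition.parts, (barSet R = R ↔ ∃ σ, signed σ = R)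

namespace LabeledPartition

variable {n : ℕ} {S : Type*}

/-- `R` is an unsigned block of `x`. -/
def IsUnsigned (x : LabeledPartition n S) (R : Finset (BarredSet n)) : Prop :=
  R ∈ x.partition.parts ∧ ∀ σ, x.signed σ ≠ R

/-- `x` is a refinement of `y`: `x_σ ⊆ y_σ` for each sign `σ` of `x`, and each unsigned block `R`
of `x` is contained in a block `T` of `y` (and then `R̄ ⊆ T̄`, where `T̄` is a block of `y`). -/
def Refines (x y : LabeledPartition n S) : Prop :=
  (∀ σ, x.signed σ ⊆ y.signed σ) ∧
    ∀ R, x.IsUnsigned R → ∃ T ∈ y.partition.parts, R ⊆ T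

theorem Refines.partition_le {x y : LabeledPartition n S} (h : x.Refines y) :
    x.partition ≤ y.partition := by
  intro R hR
  by_cases hs : ∃ σ, x.signed σ = R
  · obtain ⟨σ, rfl⟩ := hs
    have hne := x.partition.nonempty_of_mem_parts hR
    exact ⟨y.signed σ, y.signed_mem σ (hne.mono (h.1 σ)), h.1 σ⟩
  · push Not at hs
    exact h.2 R ⟨hR, hs⟩

/-- Labeled partitions are ordered by refinement. -/
instance : PartialOrder (LabeledPartition n S) where
  le := Refines
  le_refl x := ⟨fun _ => subset_rfl, fun R hR => ⟨R, hR.1, subset_rfl⟩⟩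
  le_trans x y z hxy hyz := by
    refine ⟨fun σ => (hxy.1 σ).trans (hyz.1 σ), fun R hR => ?_⟩
    obtain ⟨T, hT, hRT⟩ := hxy.2 R hR
    obtain ⟨U, hU, hTU⟩ := hyz.partition_le hT
    exact ⟨U, hU, hRT.trans hTU⟩
  le_antisymm x y hxy hyx := by
    refine LabeledPartition.ext (le_antisymm hxy.partition_le hyx.partition_le) ?_
    funext σ
    exact (hxy.1 σ).antisymm (hyx.1 σ)

/-- The finest partition `0̂ = 1 | 1̄ | ⋯ | n | n̄`. -/
def finest (n : ℕ) (S : Type*) : LabeledPartition n S where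
  partition := ⊥
  signed := fun _ => ∅
  signed_mem := fun _ h => absurd h Finset.not_nonempty_empty
  signed_inj := fun _ _ h => absurd h Finset.not_nonempty_empty
  bar_mem := by
    intro R hR
    obtain ⟨a, -, rfl⟩ := Finpartition.mem_bot_iff.1 hR
    exact Finpartition.mem_bot_iff.2 ⟨(a.1, !a.2), Finset.mem_univ _, by simp [barSet]⟩
  bar_eq_iff := by
    intro R hR
    obtain ⟨⟨i, b⟩, -, rfl⟩ := Finpartition.mem_bot_iff.1 hR
    constructor
    · intro h
      simp [barSet] at h
    · rintro ⟨_, h⟩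
      exact absurd h.symm (Finset.singleton_ne_empty _)

open scoped Classical in
/-- `Σ(x)`, the set of signs that are carried by the blocks of `x`. -/
noncomputable def signs [Fintype S] (x : LabeledPartition n S) : Finset S :=
  Finset.univ.filter fun σ => (x.signed σ).Nonempty

end LabeledPartition

/-! ### The edge labeling -/

/-- The representative of a block `R`: the least `i ∈ {1, …, n}` with `i ∈ R` or `ī ∈ R`. -/
noncomputable def blockRep {n : ℕ} (R : Finset (BarredSet n)) : ℕ :=
  sInf {i : ℕ | ∃ a ∈ R, (a.1 : ℕ) + 1 = i}

/-- A block is normalized if its representative belongs to it (without a bar). -/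
def IsNormalized {n : ℕ} (R : Finset (BarredSet n)) : Prop :=
  ∃ i : Fin n, (i, false) ∈ R ∧ (i : ℕ) + 1 = blockRep R

namespace LabeledPartition

variable {n : ℕ} {S : Type*}

/-- The edge from `x` to `y` is coherent: it merges the distinct normalized unsigned blocks `R`
and `R'` of `x`. -/
def CoherentAt (x y : LabeledPartition n S) (R R' : Finset (BarredSet n)) : Prop :=
  x.IsUnsigned R ∧ IsNormalized R ∧ x.IsUnsigned R' ∧ IsNormalized R' ∧ R ≠ R' ∧
    R ∪ R' ∈ y.partition.parts

/-- The edge from `x` to `y` is non-coherent: it merges `R` and `R̄'`, where `R` and `R'` are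
distinct normalized unsigned blocks of `x`. -/
def NonCoherentAt (x y : LabeledPartition n S) (R R' : Finset (BarredSet n)) : Prop :=
  x.IsUnsigned R ∧ IsNormalized R ∧ x.IsUnsigned R' ∧ IsNormalized R' ∧ R ≠ R' ∧
    R ∪ barSet R' ∈ y.partition.parts

open scoped Classical in
/-- The label `λ(x, y)` of the edge from `x` to `y` in the Hasse diagram, as a pair of natural
numbers. An edge is coherent, non-coherent, or of sign `σ` (that is, `x_σ ⊊ y_σ`) for a unique `σ`,
and exactly one of these cases occurs. In the first two cases the pair of merged blocks is unique
up to exchange. The last value is never used on an edge. -/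
noncomputable def pairLabel [Fintype S] [LinearOrder S] (x y : LabeledPartition n S) : ℕ × ℕ :=
  if h : ∃ B : Finset (BarredSet n) × Finset (BarredSet n), x.CoherentAt y B.1 B.2 then
    (0, max (blockRep h.choose.1) (blockRep h.choose.2))
  else if h : ∃ B : Finset (BarredSet n) × Finset (BarredSet n), x.NonCoherentAt y B.1 B.2 then
    (2, min (blockRep h.choose.1) (blockRep h.choose.2))
  else if h : ∃ σ, x.signed σ ⊂ y.signed σ then
    if h.choose ∈ x.signs then
      (1, (x.signs.filter fun τ => τ ≤ h.choose).card)
    else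
      (1, ((Finset.univ.filter fun τ => τ ≤ h.choose) ∪ x.signs).card)
  else (0, 0)

end LabeledPartition

/-- The poset `Π_{n,S}`: labeled partitions of `[[n]]` with a new top element `1̂ = ⊤` added. -/
abbrev LabeledPartitionPoset (n : ℕ) (S : Type*) : Type _ := WithTop (LabeledPartition n S)

/-- The edge labeling `λ` of `Π_{n,S}`, with labels ordered lexicographically. The label of an
edge ending in `1̂` is `(1, 2)`. -/
noncomputable def edgeLabel {n : ℕ} {S : Type*} [Fintype S] [LinearOrder S] :
    LabeledPartitionPoset n S → LabeledPartitionPoset n S → ℕ ×ₗ ℕ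
  | (x : LabeledPartition n S), (y : LabeledPartition n S) => toLex (x.pairLabel y)
  | _, ⊤ => toLex (1, 2)
  | ⊤, (_ : LabeledPartition n S) => toLex (0, 0)

/-! ### The poset of type `D` and its decreasing maximal chains -/

/-- The poset of type `D_n` with signs in `S`: the subposet of `Π_{n,S}` consisting of `1̂` and of
all labeled partitions that have no signed block with exactly two elements. -/
abbrev TypeD (n : ℕ) (S : Type*) : Type _ :=
  {x : LabeledPartitionPoset n S //
    ∀ p : LabeledPartition n S, x = (p : LabeledPartitionPoset n S) →
      ∀ σ, (p.signed σ).card ≠ 2}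

namespace TypeD

variable {n : ℕ} {S : Type*}

/-- The element `0̂` of the poset of type `D_n`. -/
def zeroHat (n : ℕ) (S : Type*) : TypeD n S :=
  ⟨(LabeledPartition.finest n S : LabeledPartitionPoset n S), by
    intro p hp σ
    obtain rfl := WithTop.coe_injective hp
    simp [LabeledPartition.finest]⟩

/-- The element `1̂` of the poset of type `D_n`. -/
def oneHat (n : ℕ) (S : Type*) : TypeD n S :=
  ⟨⊤, fun _ hp => absurd hp.symm (WithTop.coe_ne_top)⟩

/-- The list `c` is a maximal chain from `0̂` to `1̂`, listed from bottom to top. -/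
def IsMaximalChain (c : List (TypeD n S)) : Prop :=
  c.IsChain (· ⋖ ·) ∧ c.head? = some (zeroHat n S) ∧ c.getLast? = some (oneHat n S)

/-- The word of labels of the consecutive edges of a chain. -/
noncomputable def labelWord [Fintype S] [LinearOrder S] (c : List (TypeD n S)) : List (ℕ ×ₗ ℕ) :=
  List.zipWith (fun x y => edgeLabel x.1 y.1) c c.tail

/-- The set of maximal chains from `0̂` to `1̂` whose word of labels is weakly decreasing. -/
def decreasingMaximalChains (n : ℕ) (S : Type*) [Fintype S] [LinearOrder S] :
    Set (List (TypeD n S)) :=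
  {c | IsMaximalChain c ∧ (labelWord c).Pairwise (· ≥ ·)}

end TypeD

/-! ### Increasing ordered trees -/

/-- An increasing ordered tree on the `n + 1` nodes `0, 1, …, n`, given by the ordered list of
children of each node. Each node other than the root `0` is the child of exactly one node (its
parent), and the parent has a smaller label; so these data do form a tree with root `0`. -/
@[ext]
structure IncreasingOrderedTree (n : ℕ) where
  children : Fin (n + 1) → List (Fin (n + 1))
  nodup : ∀ i, (children i).Nodup
  lt_of_mem : ∀ i, ∀ j ∈ children i, i < j
  existsUnique_parent : ∀ j, j ≠ 0 → ∃! i, j ∈ children i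

/-- The root has at least `r` children, and none of its first `r` children is a leaf. -/
def IncreasingOrderedTree.IsFlourishing {n : ℕ} (r : ℕ) (T : IncreasingOrderedTree n) : Prop :=
  r ≤ (T.children 0).length ∧ ∀ j ∈ (T.children 0).take r, T.children j ≠ []

/-! ### The sum over set partitions -/

/-- The number of nonsingleton blocks of a partition of `[n]`. -/
def numNonsingleton {n : ℕ} (π : Finpartition (Finset.univ : Finset (Fin n))) : ℕ :=
  (π.parts.filter fun B => B.card ≠ 1).card

/-- The sum of `f(π) (2|π₁| - 3)!! ⋯ (2|π_k| - 3)!!` over all partitions `π = π₁ | ⋯ | π_k` of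
`[n]`, with `(-1)!! = 1` (for a block with one element the truncated difference is `0`, and
`0‼ = 1`). -/
def partitionSum (n : ℕ) (f : Finpartition (Finset.univ : Finset (Fin n)) → ℕ) : ℕ :=
  ∑ π : Finpartition (Finset.univ : Finset (Fin n)), f π * ∏ B ∈ π.parts, (2 * B.card - 3)‼

/-- `f(π) = s (s - 1) (k - 2)!`, where `k` is the number of blocks of `π` and `s` the number of its
nonsingleton blocks. It is `0` if `s ≤ 1`, in particular if `k ≤ 1`. -/
def flourishingWeight {n : ℕ} (π : Finpartition (Finset.univ : Finset (Fin n))) : ℕ :=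
  numNonsingleton π * (numNonsingleton π - 1) * (π.parts.card - 2)!

/-! ### Closed forms -/

/-! No bijection is built. Trees and chains obey one recursion, `flourishingCount_rec`, so both are
counted by the closed form `flourishingCount`; the partition sum is evaluated separately to the same
expression.

Trees. Choose the child lists of the nodes n, n-1, …, 0 in this order, each list from left to right.
While node t is treated, only three data matter: the number k of later nodes still without a parent,
the number u of leaves among these, and whether t already has a child. Either the list of t is
closed, and t joins the parentless nodes (as a leaf if its list is empty), or one of the k nodes is
appended to it. At the root, the first two choices must avoid the u leaves and the others are free.
The closed form is inclusion–exclusion over leaves in the first two places at the root, since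
deleting such a leaf leaves an arbitrary smaller tree. It also counts the trees whose root has a
single child; these are not 2-flourishing, so `plantedCount`, which obeys the same recursion, is
subtracted.

Partitions. Since (2b-3)!! counts the increasing ordered trees on b nodes, the sum reads off the
subtrees at the root. With u singletons among k blocks, f(π) = k! - 2u(k-1)! + u(u-1)(k-2)!, up to a
correction for k = 1. Each term is evaluated by inserting the elements one at a time
(`weightedSum_insert`), and the total is `flourishingCount n n 0 0 - plantedCount n 0`. For n < 2
there are no such trees and the sum vanishes.

Chains. The edge into 1̂ is labeled (1,2), so a decreasing chain has no smaller label. This excludes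
all coherent edges and all sign edges labeled (1,1). What remains is a run of non-coherent edges
labeled (2,i) with i weakly decreasing, then sign edges labeled (1,2), then 1̂. A non-coherent edge
labeled (2,i) merges the block of i with one of larger representative j: this plays the role of
appending the child j to the node i, and lowering the label bound plays the role of closing a list.
In the signed part the label 2 forces the sign: the larger sign first, then the smaller, then always
the larger. By the condition of type D the first two blocks used are not singletons; the rest come
in any order, as for the children of the root. A single remaining block is allowed here, so nothing
is subtracted and the count is `flourishingCount n n 0 0`, computed in `flourishingCount_self`.

Labeled partitions are handled through codes, which send each element to its sign or to the first
element of its block. The order and the moves become explicit operations on functions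
(`le_iff_code`, `exists_move_le`), and the covers are exactly the moves (`ofPartition_covBy_iff`).
-/

/-- The number of increasing ordered trees on `m + k + 1` nodes in which `k` prescribed nodes
with the largest labels are leaves. -/
def treeCount (m k : ℕ) : ℤ := ((2 * m - 1)‼ * (2 * m + 1).ascFactorial k : ℕ)

theorem treeCount_zero_left (k : ℕ) : treeCount 0 k = (k ! : ℤ) := by
  simp [treeCount, Nat.one_ascFactorial]

theorem treeCount_zero_right (m : ℕ) : treeCount m 0 = ((2 * m - 1)‼ : ℤ) := by
  simp [treeCount]

/-- A further leaf goes below one of the first m+1 nodes. With m+k edges present there are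
(m+1)+(m+k) places for it. -/
theorem treeCount_succ_right (m k : ℕ) :
    treeCount m (k + 1) = (2 * m + 1 + k) * treeCount m k := by
  simp only [treeCount, Nat.ascFactorial_succ]
  push_cast
  ring

theorem treeCount_succ_zero (m : ℕ) : treeCount (m + 1) 0 = (2 * m + 1) * treeCount m 0 := by
  rw [treeCount_zero_right, treeCount_zero_right]
  have : 2 * (m + 1) - 1 = 2 * m + 1 := by omega
  rw [this, Nat.doubleFactorial_add_one]
  push_cast
  ring

theorem treeCount_succ_left (m k : ℕ) :
    (2 * m + 2) * treeCount (m + 1) k = (2 * m + 2 + k) * treeCount m (k + 1) := by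
  induction k with
  | zero =>
    rw [treeCount_succ_right, treeCount_succ_zero]
    push_cast
    ring
  | succ k ih =>
    rw [treeCount_succ_right (m + 1), treeCount_succ_right m (k + 1)]
    push_cast
    linear_combination (2 * (m : ℤ) + 3 + k) * ih

/-- Look at the last node not prescribed to be a leaf. Either it is a leaf too, or its last child is
one of the k prescribed leaves, and that child can be deleted. -/
theorem treeCount_rec (m k : ℕ) :
    treeCount (m + 1) k = treeCount m (k + 1) + k * treeCount (m + 1) (k - 1) := by
  cases k with
  | zero =>
    rw [treeCount_succ_right, treeCount_succ_zero]
    push_cast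
    ring
  | succ k =>
    rw [treeCount_succ_right (m + 1), treeCount_succ_right m (k + 1)]
    push_cast
    linear_combination treeCount_succ_left m k

/-- The closed form of the number of increasing ordered trees with the `k` last nodes attached as
leaves, in which none of the first two children of the root belongs to a set of `u + w` leaves,
`u` of them among the `k` last nodes. -/
def flourishingCount (m w k u : ℕ) : ℤ :=
  treeCount m k - 2 * (u * treeCount m (k - 1) + w * treeCount (m - 1) k) +
    (u * (u - 1) * treeCount m (k - 2) + 2 * u * w * treeCount (m - 1) (k - 1) +
      w * (w - 1) * treeCount (m - 2) k)

theorem flourishingCount_zero (k u : ℕ) :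
    flourishingCount 0 0 k u =
      (k ! : ℤ) - 2 * u * ((k - 1)! : ℕ) + u * (u - 1) * ((k - 2)! : ℕ) := by
  simp [flourishingCount, treeCount_zero_left]
  ring

/-- The common recursion. Here d = 1 means that the current node m+1 is still childless, so that
closing its list creates a new leaf. After a child is appended, the node can no longer be a leaf,
and w drops to m. -/
theorem flourishingCount_rec (m d k u : ℕ) (hd : d ≤ 1) (hu : u ≤ k) :
    flourishingCount (m + 1) (m + d) k u =
      flourishingCount m m (k + 1) (u + d) + u * flourishingCount (m + 1) m (k - 1) (u - 1) +
        (k - u : ℕ) * flourishingCount (m + 1) m (k - 1) u := by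
  have h1 := treeCount_rec m k
  -- Each term of the closed form obeys `treeCount_rec`. The factors u, m, u - 1 and m - 1 are kept
  -- because they vanish exactly where a truncated index such as `k - 1` or `m - 1` would make that
  -- recursion false.
  have h2 : (u : ℤ) * treeCount (m + 1) (k - 1) =
      u * (treeCount m k + (k - 1) * treeCount (m + 1) (k - 2)) := by
    rcases k with _ | k
    · simp [Nat.le_zero.1 hu]
    · rw [Nat.add_sub_cancel, treeCount_rec m k]; push_cast; simp
  have h3 : (m : ℤ) * treeCount m k =
      m * (treeCount (m - 1) (k + 1) + k * treeCount m (k - 1)) := by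
    rcases m with _ | m
    · simp
    · rw [treeCount_rec m k]; simp
  have h4 : (u : ℤ) * (u - 1) * treeCount (m + 1) (k - 2) =
      u * (u - 1) * (treeCount m (k - 1) + (k - 2) * treeCount (m + 1) (k - 3)) := by
    rcases k with _ | _ | k
    · simp [Nat.le_zero.1 hu]
    · interval_cases u <;> simp
    · simp only [Nat.reduceSubDiff, treeCount_rec m k, Nat.add_sub_cancel]; push_cast; ring_nf
  have h5 : (u : ℤ) * m * treeCount m (k - 1) =
      u * m * (treeCount (m - 1) k + (k - 1) * treeCount m (k - 2)) := by
    rcases k with _ | k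
    · simp [Nat.le_zero.1 hu]
    rcases m with _ | m
    · simp
    · rw [Nat.add_sub_cancel, treeCount_rec m k]; push_cast; simp
  have h6 : (m : ℤ) * (m - 1) * treeCount (m - 1) k =
      m * (m - 1) * (treeCount (m - 2) (k + 1) + k * treeCount (m - 1) (k - 1)) := by
    rcases m with _ | _ | m
    · simp
    · simp
    · simp only [Nat.reduceSubDiff, Nat.add_sub_cancel, treeCount_rec m k]
  have h7 : (u : ℤ) * ((u - 1 : ℕ) : ℤ) = u * (u - 1) := by
    rcases u with _ | u <;> simp
  have h8 : (u : ℤ) * ((u - 1 : ℕ) : ℤ) * (((u - 1 : ℕ) : ℤ) - 1) = u * (u - 1) * (u - 2) := by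
    rcases u with _ | u
    · simp
    · rw [Nat.add_sub_cancel]; push_cast; ring
  have e1 : k + 1 - 2 = k - 1 := by omega
  have e2 : k - 1 - 1 = k - 2 := by omega
  have e3 : k - 1 - 2 = k - 3 := by omega
  have e4 : m + 1 - 2 = m - 1 := by omega
  -- The quadratic terms in u + d and m + d produce d², which must be replaced by d.
  have hd2 : (d : ℤ) * (d - 1) = 0 := by interval_cases d <;> simp
  simp only [flourishingCount, Nat.add_sub_cancel, e1, e2, e3, e4, Nat.cast_sub hu]
  push_cast
  linear_combination h1 - 2 * h2 - 2 * h3 + h4 + 2 * h5 + h6 -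
    (-2 * treeCount (m + 1) (k - 2) + 2 * m * treeCount m (k - 2)) * h7 -
    treeCount (m + 1) (k - 3) * h8 + (treeCount (m - 1) k - treeCount m (k - 1)) * hd2

/-- The number of increasing ordered trees as in `treeCount` in which the root has one child. -/
def plantedCount : ℕ → ℕ → ℤ
  | 0, k => if k = 1 then 1 else 0
  | m + 1, k => treeCount m k

theorem plantedCount_rec (m k : ℕ) :
    plantedCount (m + 1) k = plantedCount m (k + 1) + k * plantedCount (m + 1) (k - 1) := by
  cases m with
  | zero =>
    cases k with
    | zero => simp [plantedCount, treeCount_zero_left]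
    | succ k => simp [plantedCount, treeCount_zero_left, Nat.factorial_succ]
  | succ m => exact treeCount_rec m k

/-- The value is T(n) - 2n T(n-1) + n(n-1) T(n-2) with T(m) = (2m-1)!!. Two uses of T(m+1) = (2m+1)
T(m) reduce it. -/
theorem flourishingCount_self (n : ℕ) (hn : 2 ≤ n) :
    flourishingCount n n 0 0 =
      (((2 * n - 5)‼ * ((n - 2) * (n - 3)) + (2 * n - 3)‼ : ℕ) : ℤ) := by
  obtain ⟨n, rfl⟩ := Nat.exists_eq_add_of_le' hn
  have h1 := treeCount_succ_zero (n + 1)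
  have h2 := treeCount_succ_zero n
  have e1 : 2 * (n + 2) - 5 = 2 * n - 1 := by omega
  have e2 : 2 * (n + 2) - 3 = 2 * (n + 1) - 1 := by omega
  have e3 : (((n + 2 - 2) * (n + 2 - 3) : ℕ) : ℤ) = n * (n - 1) := by
    rcases n with _ | n <;> simp
  rw [Nat.cast_add, Nat.cast_mul, e1, e2, e3, ← treeCount_zero_right, ← treeCount_zero_right]
  simp only [flourishingCount, Nat.add_sub_cancel, (by omega : n + 2 - 1 = n + 1)]
  push_cast at *
  linear_combination h1 + (2 * n + 3 - 2 * (n + 2) - 1) * h2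

/-! ### Set partitions of a set with one more element -/

namespace Finpartition

variable {α : Type*} [DecidableEq α] {s : Finset α} {a : α}

/-- Add a new element as a singleton block. -/
def addSingleton (P : Finpartition s) (ha : a ∉ s) : Finpartition (insert a s) :=
  ofExistsUnique (insert {a} P.parts)
    (by
      intro p hp
      rcases Finset.mem_insert.1 hp with rfl | hp
      · simp
      · exact (P.subset hp).trans (Finset.subset_insert a s))
    (by
      intro b hb
      rcases Finset.mem_insert.1 hb with rfl | hb
      · refine ⟨{b}, ⟨by simp, by simp⟩, ?_⟩
        rintro t ⟨ht, hbt⟩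
        rcases Finset.mem_insert.1 ht with rfl | ht
        · rfl
        · exact absurd (P.subset ht hbt) ha
      · obtain ⟨t, ⟨ht, hbt⟩, -⟩ := P.existsUnique_mem hb
        refine ⟨t, ⟨Finset.mem_insert_of_mem ht, hbt⟩, ?_⟩
        rintro t' ⟨ht', hbt'⟩
        rcases Finset.mem_insert.1 ht' with rfl | ht'
        · rw [Finset.mem_singleton] at hbt'
          exact absurd (hbt' ▸ hb) ha
        · exact P.eq_of_mem_parts ht' ht hbt' hbt)
    (by
      intro h
      rcases Finset.mem_insert.1 h with h | h
      · exact Finset.singleton_ne_empty a h.symm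
      · exact P.empty_notMem_parts h)

/-- Add a new element to a given block. -/
def addToBlock (P : Finpartition s) (ha : a ∉ s) {B : Finset α} (hB : B ∈ P.parts) :
    Finpartition (insert a s) :=
  ofExistsUnique (insert (insert a B) (P.parts.erase B))
    (by
      intro p hp
      rcases Finset.mem_insert.1 hp with rfl | hp
      · exact Finset.insert_subset_insert a (P.subset hB)
      · exact (P.subset (Finset.mem_of_mem_erase hp)).trans (Finset.subset_insert a s))
    (by
      intro b hb
      by_cases hbB : b ∈ insert a B
      · refine ⟨insert a B, ⟨Finset.mem_insert_self _ _, hbB⟩, ?_⟩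
        rintro t ⟨ht, hbt⟩
        rcases Finset.mem_insert.1 ht with rfl | ht
        · rfl
        · obtain ⟨htB, htP⟩ := Finset.mem_erase.1 ht
          rcases Finset.mem_insert.1 hbB with rfl | hbB
          · exact absurd (P.subset htP hbt) ha
          · exact absurd (P.eq_of_mem_parts htP hB hbt hbB) htB
      · rw [Finset.mem_insert, not_or] at hbB
        have hbs := Finset.mem_of_mem_insert_of_ne hb hbB.1
        obtain ⟨t, ⟨ht, hbt⟩, -⟩ := P.existsUnique_mem hbs
        have htB : t ≠ B := by rintro rfl; exact hbB.2 hbt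
        refine ⟨t, ⟨Finset.mem_insert_of_mem (Finset.mem_erase.2 ⟨htB, ht⟩), hbt⟩, ?_⟩
        rintro t' ⟨ht', hbt'⟩
        rcases Finset.mem_insert.1 ht' with rfl | ht'
        · exact absurd (Finset.mem_insert.1 hbt') (not_or.2 hbB)
        · exact P.eq_of_mem_parts (Finset.mem_of_mem_erase ht') ht hbt' hbt)
    (by
      intro h
      rcases Finset.mem_insert.1 h with h | h
      · exact Finset.insert_ne_empty a B h.symm
      · exact P.empty_notMem_parts (Finset.mem_of_mem_erase h))

/-- Add a new element, as a singleton block or to a given block. -/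
def addElement (ha : a ∉ s) :
    (Σ P : Finpartition s, Option {B // B ∈ P.parts}) → Finpartition (insert a s)
  | ⟨P, none⟩ => P.addSingleton ha
  | ⟨P, some B⟩ => P.addToBlock ha B.2

theorem notMem_of_mem_parts (P : Finpartition s) (ha : a ∉ s) {B : Finset α} (hB : B ∈ P.parts) :
    a ∉ B := fun h => ha (P.subset hB h)

theorem insert_notMem_parts (P : Finpartition s) (ha : a ∉ s) (B : Finset α) :
    insert a B ∉ P.parts :=
  fun h => P.notMem_of_mem_parts ha h (Finset.mem_insert_self a B)

theorem part_addSingleton (P : Finpartition s) (ha : a ∉ s) : (P.addSingleton ha).part a = {a} :=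
  part_eq_of_mem _ (Finset.mem_insert_self _ _) (Finset.mem_singleton_self a)

theorem part_addToBlock (P : Finpartition s) (ha : a ∉ s) {B : Finset α} (hB : B ∈ P.parts) :
    (P.addToBlock ha hB).part a = insert a B :=
  part_eq_of_mem _ (Finset.mem_insert_self _ _) (Finset.mem_insert_self _ _)

/-- The block containing `a` tells how `a` was added, and deleting `a` recovers the old partition.
-/
theorem addElement_injective (ha : a ∉ s) : Function.Injective (addElement (s := s) ha) := by
  have key : ∀ (P Q : Finpartition s) (B : Finset α) (hB : B ∈ P.parts),
      Q.addSingleton ha ≠ P.addToBlock ha hB := by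
    intro P Q B hB h
    have h1 := congrArg (fun R => R.part a) h
    simp only [part_addSingleton, part_addToBlock] at h1
    obtain ⟨b, hb⟩ := P.nonempty_of_mem_parts hB
    have : b ∈ ({a} : Finset α) := h1 ▸ Finset.mem_insert_of_mem hb
    rw [Finset.mem_singleton] at this
    exact P.notMem_of_mem_parts ha hB (this ▸ hb)
  rintro ⟨P, _ | ⟨B, hB⟩⟩ ⟨Q, _ | ⟨C, hC⟩⟩ h
  · have h1 : insert {a} P.parts = insert {a} Q.parts := congrArg parts h
    have e (R : Finpartition s) : (insert {a} R.parts).erase {a} = R.parts :=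
      Finset.erase_insert (R.insert_notMem_parts ha ∅)
    have : P = Q := Finpartition.ext (by rw [← e P, h1, e])
    rw [this]
  · exact absurd h (key _ _ _ hC)
  · exact absurd h.symm (key _ _ _ hB)
  · have h1 := congrArg (fun R => R.part a) h
    simp only [addElement, part_addToBlock] at h1
    have hBC : B = C := by
      rw [← Finset.erase_insert (P.notMem_of_mem_parts ha hB), h1,
        Finset.erase_insert (Q.notMem_of_mem_parts ha hC)]
    subst hBC
    have h2 : insert (insert a B) (P.parts.erase B) = insert (insert a B) (Q.parts.erase B) :=
      congrArg parts h
    have e (R : Finpartition s) (hR : B ∈ R.parts) :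
        insert B ((insert (insert a B) (R.parts.erase B)).erase (insert a B)) = R.parts := by
      rw [Finset.erase_insert fun h => R.insert_notMem_parts ha B (Finset.mem_of_mem_erase h),
        Finset.insert_erase hR]
    have : P = Q := Finpartition.ext (by rw [← e P hB, h2, e Q hC])
    subst this
    rfl

theorem addElement_surjective (ha : a ∉ s) : Function.Surjective (addElement (s := s) ha) := by
  intro R
  have has : a ∈ insert a s := Finset.mem_insert_self a s
  have hap := R.mem_part has
  have hpp := R.part_mem.2 has
  have hsub {t : Finset α} (ht : t ∈ R.parts.erase (R.part a)) : t ⊆ s := by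
    intro b hb
    refine Finset.mem_of_mem_insert_of_ne (R.subset (Finset.mem_of_mem_erase ht) hb) ?_
    rintro rfl
    exact (Finset.mem_erase.1 ht).1 (R.part_eq_of_mem (Finset.mem_of_mem_erase ht) hb).symm
  by_cases h : R.part a = {a}
  · have hQ : ∀ b ∈ s, ∃! t, t ∈ R.parts.erase {a} ∧ b ∈ t := by
      intro b hb
      obtain ⟨t, ⟨ht, hbt⟩, hu⟩ := R.existsUnique_mem (Finset.mem_insert_of_mem hb)
      refine ⟨t, ⟨Finset.mem_erase.2 ⟨?_, ht⟩, hbt⟩,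
        fun t' ht' => hu t' ⟨Finset.mem_of_mem_erase ht'.1, ht'.2⟩⟩
      rintro rfl
      exact ha (Finset.mem_singleton.1 hbt ▸ hb)
    let Q : Finpartition s := ofExistsUnique (R.parts.erase {a})
      (fun t ht => hsub (h ▸ ht)) hQ
      (fun h' => R.empty_notMem_parts (Finset.mem_of_mem_erase h'))
    refine ⟨⟨Q, none⟩, Finpartition.ext ?_⟩
    exact Finset.insert_erase (h ▸ hpp)
  · set B := (R.part a).erase a with hBdef
    have hBa : insert a B = R.part a := Finset.insert_erase hap
    have hB0 : B.Nonempty := by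
      rw [Finset.nonempty_iff_ne_empty]
      intro h0
      exact h (by rw [← hBa, h0]; rfl)
    have hBs : B ⊆ s := by
      intro b hb
      obtain ⟨h1, h2⟩ := Finset.mem_erase.1 hb
      exact Finset.mem_of_mem_insert_of_ne (R.subset hpp h2) h1
    have hQ : ∀ b ∈ s, ∃! t, t ∈ insert B (R.parts.erase (R.part a)) ∧ b ∈ t := by
      intro b hb
      have hba : b ≠ a := by rintro rfl; exact ha hb
      by_cases hbB : b ∈ B
      · refine ⟨B, ⟨Finset.mem_insert_self _ _, hbB⟩, ?_⟩
        rintro t ⟨ht, hbt⟩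
        rcases Finset.mem_insert.1 ht with rfl | ht
        · rfl
        · exact absurd (R.eq_of_mem_parts (Finset.mem_of_mem_erase ht) hpp hbt
            (Finset.mem_of_mem_erase hbB)) (Finset.mem_erase.1 ht).1
      · obtain ⟨t, ⟨ht, hbt⟩, hu⟩ := R.existsUnique_mem (Finset.mem_insert_of_mem hb)
        refine ⟨t, ⟨Finset.mem_insert_of_mem (Finset.mem_erase.2 ⟨?_, ht⟩), hbt⟩, ?_⟩
        · rintro rfl
          exact hbB (Finset.mem_erase.2 ⟨hba, hbt⟩)
        · rintro t' ⟨ht', hbt'⟩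
          rcases Finset.mem_insert.1 ht' with rfl | ht'
          · exact absurd hbt' hbB
          · exact hu t' ⟨Finset.mem_of_mem_erase ht', hbt'⟩
    let Q : Finpartition s := ofExistsUnique (insert B (R.parts.erase (R.part a)))
      (by
        intro t ht
        rcases Finset.mem_insert.1 ht with rfl | ht
        · exact hBs
        · exact hsub ht) hQ
      (by
        intro h'
        rcases Finset.mem_insert.1 h' with h' | h'
        · exact hB0.ne_empty h'.symm
        · exact R.empty_notMem_parts (Finset.mem_of_mem_erase h'))
    have hBQ : B ∈ Q.parts := Finset.mem_insert_self _ _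
    refine ⟨⟨Q, some ⟨B, hBQ⟩⟩, Finpartition.ext ?_⟩
    have hBR : B ∉ R.parts.erase (R.part a) := by
      intro h'
      obtain ⟨b, hb⟩ := hB0
      exact (Finset.mem_erase.1 h').1 (R.eq_of_mem_parts (Finset.mem_of_mem_erase h') hpp hb
        (Finset.mem_of_mem_erase hb))
    change insert (insert a B) ((insert B (R.parts.erase (R.part a))).erase B) = R.parts
    rw [Finset.erase_insert hBR, hBa, Finset.insert_erase hpp]

/-- `F` takes the family of blocks rather than the partition, so that the same function applies to
partitions of different sets. -/
theorem sum_insert_eq {M : Type*} [AddCommMonoid M] (ha : a ∉ s) (F : Finset (Finset α) → M) :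
    ∑ P : Finpartition (insert a s), F P.parts =
      ∑ P : Finpartition s, (F (insert {a} P.parts) +
        ∑ B ∈ P.parts, F (insert (insert a B) (P.parts.erase B))) := by
  rw [← Fintype.sum_bijective (addElement ha) ⟨addElement_injective ha, addElement_surjective ha⟩
    (fun x => F (addElement ha x).parts) _ fun _ => rfl, Fintype.sum_sigma]
  refine Finset.sum_congr rfl fun P _ => ?_
  rw [Fintype.sum_option, ← Finset.sum_coe_sort P.parts]
  rfl

end Finpartition

/-! ### The sum over set partitions, by insertion of the elements -/

namespace Finpartition

variable {α : Type*} [DecidableEq α] {s : Finset α} {a : α}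

/-- The number of one-element sets in a family. -/
def numSingleton (p : Finset (Finset α)) : ℕ := (p.filter fun B => B.card = 1).card

/-- The product of the numbers `(2 * |B| - 3)‼`. -/
def oddProduct (p : Finset (Finset α)) : ℤ := ∏ B ∈ p, ((2 * B.card - 3)‼ : ℤ)

/-- The sum of `g k u * ∏ B, (2 * |B| - 3)‼` over the partitions of `s`, where `k` is the number of
blocks and `u` is the number of singleton blocks. -/
def weightedSum (s : Finset α) (g : ℕ → ℕ → ℤ) : ℤ :=
  ∑ P : Finpartition s, g P.parts.card (numSingleton P.parts) * oddProduct P.parts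

theorem numSingleton_le {α : Type*} (p : Finset (Finset α)) : numSingleton p ≤ p.card :=
  Finset.card_filter_le _ _

theorem numSingleton_insert {p : Finset (Finset α)} {B : Finset α} (h : B ∉ p) :
    numSingleton (insert B p) = numSingleton p + if B.card = 1 then 1 else 0 := by
  unfold numSingleton
  rw [Finset.filter_insert]
  split_ifs with hB
  · rw [Finset.card_insert_of_notMem fun h' => h (Finset.mem_filter.1 h').1]
  · rfl

theorem numSingleton_erase {p : Finset (Finset α)} {B : Finset α} (h : B ∈ p) :
    numSingleton p = numSingleton (p.erase B) + if B.card = 1 then 1 else 0 := by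
  conv_lhs => rw [← Finset.insert_erase h]
  exact numSingleton_insert (Finset.notMem_erase B p)

theorem oddProduct_erase {p : Finset (Finset α)} {B : Finset α} (h : B ∈ p) :
    oddProduct p = ((2 * B.card - 3)‼ : ℤ) * oddProduct (p.erase B) :=
  (Finset.mul_prod_erase p _ h).symm

theorem summand_addSingleton (P : Finpartition s) (ha : a ∉ s) (g : ℕ → ℕ → ℤ) :
    g (insert {a} P.parts).card (numSingleton (insert {a} P.parts)) *
        oddProduct (insert {a} P.parts) =
      g (P.parts.card + 1) (numSingleton P.parts + 1) * oddProduct P.parts := by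
  have h : {a} ∉ P.parts := P.insert_notMem_parts ha ∅
  rw [Finset.card_insert_of_notMem h, numSingleton_insert h, oddProduct, Finset.prod_insert h]
  simp [oddProduct]

theorem summand_addToBlock (P : Finpartition s) (ha : a ∉ s) (g : ℕ → ℕ → ℤ) {B : Finset α}
    (hB : B ∈ P.parts) :
    g (insert (insert a B) (P.parts.erase B)).card
          (numSingleton (insert (insert a B) (P.parts.erase B))) *
        oddProduct (insert (insert a B) (P.parts.erase B)) =
      (if B.card = 1 then g P.parts.card (numSingleton P.parts - 1)
        else (2 * B.card - 1) * g P.parts.card (numSingleton P.parts)) * oddProduct P.parts := by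
  have h : insert a B ∉ P.parts.erase B :=
    fun h => P.insert_notMem_parts ha B (Finset.mem_of_mem_erase h)
  have hc : (insert a B).card = B.card + 1 :=
    Finset.card_insert_of_notMem (P.notMem_of_mem_parts ha hB)
  have hpos : 0 < B.card := (P.nonempty_of_mem_parts hB).card_pos
  rw [Finset.card_insert_of_notMem h, Finset.card_erase_add_one hB, numSingleton_insert h,
    oddProduct, Finset.prod_insert h, hc, numSingleton_erase hB, oddProduct_erase hB, oddProduct]
  split_ifs with h1 h2 h2
  · omega
  · omega
  · simp [h2]
  · have e : 2 * (B.card + 1) - 3 = (2 * B.card - 3) + 2 := by omega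
    rw [e, Nat.doubleFactorial_add_two]
    have e' : ((2 * B.card - 3 + 2 : ℕ) : ℤ) = 2 * B.card - 1 := by omega
    rw [Nat.cast_mul, e', add_zero]
    ring

/-- Adding an element to a block of size b multiplies the product by 2b - 1. The sum of 2b - 1 over
all blocks is 2|s| - k; the u singletons contribute 1 each and are split off, since they change the
number of singletons. -/
theorem weightedSum_insert (ha : a ∉ s) (g : ℕ → ℕ → ℤ) :
    weightedSum (insert a s) g = weightedSum s fun k u =>
      g (k + 1) (u + 1) + u * g k (u - 1) + (2 * s.card - k - u) * g k u := by
  unfold weightedSum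
  rw [sum_insert_eq ha fun p => g p.card (numSingleton p) * oddProduct p]
  refine Finset.sum_congr rfl fun P _ => ?_
  rw [summand_addSingleton P ha, Finset.sum_congr rfl fun B hB => summand_addToBlock P ha g hB,
    ← Finset.sum_mul, ← add_mul]
  beta_reduce
  rw [add_assoc]
  congr 2
  have h1 : ∑ B ∈ P.parts, (2 * (B.card : ℤ) - 1) = 2 * s.card - P.parts.card := by
    rw [Finset.sum_sub_distrib, ← Finset.mul_sum, ← P.sum_card_parts]
    simp
  have h2 := Finset.sum_filter_add_sum_filter_not P.parts (fun B => B.card = 1)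
    fun B => 2 * (B.card : ℤ) - 1
  have h3 : ∑ B ∈ P.parts.filter (fun B => B.card = 1), (2 * (B.card : ℤ) - 1) =
      numSingleton P.parts := by
    rw [Finset.sum_congr rfl fun B hB => by rw [(Finset.mem_filter.1 hB).2]]
    simp [numSingleton]
  rw [Finset.sum_ite, Finset.sum_const, ← Finset.sum_mul, nsmul_eq_mul]
  rw [← numSingleton]
  linear_combination g P.parts.card (numSingleton P.parts) * (h2 - h3 + h1)

theorem weightedSum_congr {g g' : ℕ → ℕ → ℤ}
    (h : ∀ k u, u ≤ k → (s.Nonempty → 1 ≤ k) → g k u = g' k u) :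
    weightedSum s g = weightedSum s g' := by
  refine Finset.sum_congr rfl fun P _ => ?_
  rw [h _ _ (numSingleton_le _) fun hs => (P.parts_nonempty hs.ne_empty).card_pos]

theorem weightedSum_add (g g' : ℕ → ℕ → ℤ) :
    weightedSum s (fun k u => g k u + g' k u) = weightedSum s g + weightedSum s g' := by
  simp [weightedSum, add_mul, Finset.sum_add_distrib]

theorem weightedSum_mul (c : ℤ) (g : ℕ → ℕ → ℤ) :
    weightedSum s (fun k u => c * g k u) = c * weightedSum s g := by
  simp [weightedSum, Finset.mul_sum, mul_assoc]

theorem weightedSum_empty (g : ℕ → ℕ → ℤ) : weightedSum (∅ : Finset α) g = g 0 0 := by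
  unfold weightedSum
  rw [← Finset.bot_eq_empty, Fintype.sum_unique]
  have : (default : Finpartition (⊥ : Finset α)).parts = ∅ := rfl
  simp [this, numSingleton, oddProduct]

/-- With weight k!, an insertion multiplies by (k+1) + u + (2|s|-k-u) = 2|s|+1, whatever k and u
are. -/
theorem weightedSum_factorial (s : Finset α) :
    weightedSum s (fun k _ => (k ! : ℤ)) = treeCount s.card 0 := by
  induction s using Finset.induction_on with
  | empty => simp [weightedSum_empty, treeCount]
  | insert a s ha ih =>
    rw [weightedSum_insert ha, Finset.card_insert_of_notMem ha, treeCount_succ_zero, ← ih,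
      ← weightedSum_mul]
    congr 1
    funext k u
    rw [Nat.factorial_succ]
    push_cast
    ring

/-- Inserting an element turns the weight u(k-1)! into (2|s|-1) u(k-1)! + k!, so the sum for k!
drives the recursion. -/
theorem weightedSum_first_singleton (s : Finset α) :
    weightedSum s (fun k u => (u : ℤ) * ((k - 1)! : ℕ)) =
      s.card * treeCount (s.card - 1) 0 := by
  induction s using Finset.induction_on with
  | empty => simp [weightedSum_empty]
  | insert a s ha ih =>
    rw [weightedSum_insert ha, Finset.card_insert_of_notMem ha]
    have : (s.card : ℤ) * treeCount s.card 0 =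
        (2 * s.card - 1) * (s.card * treeCount (s.card - 1) 0) := by
      rcases s.card with _ | m
      · simp
      · rw [treeCount_succ_zero, Nat.add_sub_cancel]; push_cast; ring
    rw [Nat.add_sub_cancel, Nat.cast_add, Nat.cast_one, add_mul, this, one_mul, ← ih, ← weightedSum_mul,
      ← weightedSum_factorial, ← weightedSum_add]
    refine weightedSum_congr fun k u hu _ => ?_
    rcases u with _ | u
    · simp
    obtain ⟨k, rfl⟩ := Nat.exists_eq_add_of_le' (show 1 ≤ k by omega)
    simp only [Nat.add_sub_cancel, Nat.factorial_succ]
    push_cast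
    ring

/-- Inserting an element turns the weight into 2|s|-3 times itself plus twice the weight u(k-1)! of
the previous sum. -/
theorem weightedSum_first_two_singletons (s : Finset α) :
    weightedSum s (fun k u => (u : ℤ) * (u - 1) * ((k - 2)! : ℕ)) =
      s.card * (s.card - 1) * treeCount (s.card - 2) 0 := by
  induction s using Finset.induction_on with
  | empty => simp [weightedSum_empty]
  | insert a s ha ih =>
    rw [weightedSum_insert ha, Finset.card_insert_of_notMem ha]
    have : (s.card : ℤ) * (s.card - 1) * treeCount (s.card - 1) 0 =
        (2 * s.card - 3) * (s.card * (s.card - 1) * treeCount (s.card - 2) 0) := by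
      rcases s.card with _ | _ | m
      · simp
      · simp
      · simp only [Nat.add_sub_cancel, Nat.reduceSubDiff, treeCount_succ_zero]; push_cast; ring
    have h : ((s.card + 1 : ℕ) : ℤ) * ((s.card + 1 : ℕ) - 1) * treeCount (s.card + 1 - 2) 0 =
        2 * (s.card * treeCount (s.card - 1) 0) +
          (2 * s.card - 3) * (s.card * (s.card - 1) * treeCount (s.card - 2) 0) := by
      rw [(by omega : s.card + 1 - 2 = s.card - 1), ← this]; push_cast; ring
    rw [h, ← ih, ← weightedSum_first_singleton, ← weightedSum_mul, ← weightedSum_mul,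
      ← weightedSum_add]
    refine weightedSum_congr fun k u hu _ => ?_
    rcases u with _ | u
    · simp
    rcases k with _ | _ | k
    · omega
    · obtain rfl : u = 0 := by omega
      simp
    simp only [Nat.add_sub_cancel, Nat.reduceSubDiff, Nat.factorial_succ]
    push_cast
    ring

theorem weightedSum_one_block (s : Finset α) :
    weightedSum s (fun k _ => if k = 1 then 1 else 0) = plantedCount s.card 0 := by
  induction s using Finset.induction_on with
  | empty => simp [weightedSum_empty, plantedCount]
  | insert a s ha ih =>
    rw [weightedSum_insert ha, Finset.card_insert_of_notMem ha, plantedCount]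
    rcases s.eq_empty_or_nonempty with rfl | hs
    · simp [weightedSum_empty, treeCount]
    · obtain ⟨m, hm⟩ := Nat.exists_eq_add_of_le' hs.card_pos
      rw [hm, plantedCount] at ih
      rw [hm, treeCount_succ_zero, ← ih, ← weightedSum_mul]
      refine weightedSum_congr fun k u _ hk => ?_
      have := hk hs
      by_cases h1 : k = 1
      · simp [h1]; ring
      · have : k ≠ 0 := by omega
        simp [h1, this]

theorem card_parts_of_card_eq_one {P : Finpartition s} (h : P.parts.card = 1) (hs : 2 ≤ s.card) :
    numSingleton P.parts = 0 := by
  obtain ⟨B, hB⟩ := Finset.card_eq_one.1 h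
  have := P.sum_card_parts
  rw [hB, Finset.sum_singleton] at this
  rw [hB, numSingleton, Finset.card_eq_zero, Finset.filter_singleton, if_neg (by omega)]

end Finpartition

/-! ### The partition sum in closed form -/

open Finpartition

theorem numNonsingleton_eq {n : ℕ} (π : Finpartition (Finset.univ : Finset (Fin n))) :
    (numNonsingleton π : ℤ) = π.parts.card - numSingleton π.parts := by
  have := Finset.card_filter_add_card_filter_not (s := π.parts) fun B => B.card = 1
  unfold numNonsingleton numSingleton
  simp only [ne_eq]
  omega

theorem cast_mul_pred (m : ℕ) : ((m * (m - 1) : ℕ) : ℤ) = m * (m - 1) := by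
  rcases m with _ | m <;> simp

/-- For k ≥ 2 this expands (k-u)(k-u-1)(k-2)!. A single block has at least two elements as n ≥ 2, so
u = 0; the weight is then 0 while the closed form gives 1, whence the correction. -/
theorem flourishingWeight_eq {n : ℕ} (hn : 2 ≤ n)
    (π : Finpartition (Finset.univ : Finset (Fin n))) :
    (flourishingWeight π : ℤ) = flourishingCount 0 0 π.parts.card (numSingleton π.parts) +
      -1 * if π.parts.card = 1 then 1 else 0 := by
  have hle := numSingleton_le π.parts
  have hu := fun h => card_parts_of_card_eq_one (P := π) h (by simpa using hn)
  have hk : 0 < π.parts.card := by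
    refine (π.parts_nonempty ?_).card_pos
    have : Nonempty (Fin n) := ⟨⟨0, by omega⟩⟩
    exact Finset.univ_nonempty.ne_empty
  rw [flourishingWeight, Nat.cast_mul, cast_mul_pred, numNonsingleton_eq, flourishingCount_zero]
  generalize π.parts.card = k at *
  generalize numSingleton π.parts = u at *
  rcases k with _ | _ | k
  · omega
  · simp [hu rfl]
  · simp only [Nat.add_sub_cancel, Nat.reduceSubDiff, Nat.factorial_succ,
      if_neg (show k + 1 + 1 ≠ 1 by omega)]
    push_cast
    ring

theorem partitionSum_flourishingWeight {n : ℕ} (hn : 2 ≤ n) :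
    (partitionSum n flourishingWeight : ℤ) = flourishingCount n n 0 0 - plantedCount n 0 := by
  have h : (partitionSum n flourishingWeight : ℤ) =
      weightedSum (Finset.univ : Finset (Fin n)) fun k u =>
        ((k ! : ℤ) + (-2) * ((u : ℤ) * ((k - 1)! : ℕ))) +
          ((u : ℤ) * (u - 1) * ((k - 2)! : ℕ) + -1 * if k = 1 then 1 else 0) := by
    unfold partitionSum weightedSum
    rw [Nat.cast_sum]
    refine Finset.sum_congr rfl fun π _ => ?_
    rw [Nat.cast_mul, flourishingWeight_eq hn, flourishingCount_zero, oddProduct, Nat.cast_prod]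
    ring
  rw [h, weightedSum_add, weightedSum_add, weightedSum_add, weightedSum_mul, weightedSum_mul,
    weightedSum_factorial, weightedSum_first_singleton, weightedSum_first_two_singletons,
    weightedSum_one_block, Finset.card_univ, Fintype.card_fin, flourishingCount]
  push_cast
  ring

theorem partitionSum_flourishingWeight_of_lt {n : ℕ} (hn : n < 2) :
    partitionSum n flourishingWeight = 0 := by
  refine Finset.sum_eq_zero fun π _ => ?_
  have : numNonsingleton π = 0 := by
    rw [numNonsingleton, Finset.card_eq_zero, Finset.filter_eq_empty_iff]
    intro B hB
    have h1 := (π.nonempty_of_mem_parts hB).card_pos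
    have h2 := Finset.card_le_univ B
    rw [Fintype.card_fin] at h2
    omega
  simp [flourishingWeight, this]

/-! ### Counting by disjoint unions -/

/-- The set `A` is finite and has `z` elements. -/
def HasCount {α : Type*} (A : Set α) (z : ℤ) : Prop := A.Finite ∧ (A.ncard : ℤ) = z

namespace HasCount

variable {α β ι : Type*}

theorem empty : HasCount (∅ : Set α) 0 := ⟨Set.finite_empty, by simp⟩

theorem singleton (a : α) : HasCount ({a} : Set α) 1 := ⟨Set.finite_singleton a, by simp⟩

theorem union {A B : Set α} {y z : ℤ} (hA : HasCount A y) (hB : HasCount B z)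
    (h : Disjoint A B) : HasCount (A ∪ B) (y + z) :=
  ⟨hA.1.union hB.1, by
    rw [Set.ncard_union_eq h hA.1 hB.1, Nat.cast_add, hA.2, hB.2]⟩

theorem image {A : Set α} {z : ℤ} (hA : HasCount A z) {f : α → β} (hf : Function.Injective f) :
    HasCount (f '' A) z :=
  ⟨hA.1.image f, by rw [Set.ncard_image_of_injective A hf, hA.2]⟩

theorem biUnion (J : Finset ι) {A : ι → Set α} {z : ι → ℤ} (hA : ∀ j ∈ J, HasCount (A j) (z j))
    (h : ∀ i ∈ J, ∀ j ∈ J, i ≠ j → Disjoint (A i) (A j)) :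
    HasCount (⋃ j ∈ J, A j) (∑ j ∈ J, z j) := by
  classical
  induction J using Finset.induction_on with
  | empty => simpa using empty
  | insert i J hi ih =>
    rw [Finset.set_biUnion_insert, Finset.sum_insert hi]
    refine (hA i (Finset.mem_insert_self i J)).union
      (ih (fun j hj => hA j (Finset.mem_insert_of_mem hj)) fun j hj k hk =>
        h j (Finset.mem_insert_of_mem hj) k (Finset.mem_insert_of_mem hk)) ?_
    refine Set.disjoint_iUnion₂_right.2 fun j hj => ?_
    refine h i (Finset.mem_insert_self i J) j (Finset.mem_insert_of_mem hj) ?_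
    rintro rfl
    exact hi hj

/-- A disjoint union of sets whose numbers of elements take two values. -/
theorem biUnion_ite [DecidableEq ι] {J U : Finset ι} (hU : U ⊆ J) {A : ι → Set α} {y z : ℤ}
    (hy : ∀ j ∈ U, HasCount (A j) y) (hz : ∀ j ∈ J, j ∉ U → HasCount (A j) z)
    (h : ∀ i ∈ J, ∀ j ∈ J, i ≠ j → Disjoint (A i) (A j)) :
    HasCount (⋃ j ∈ J, A j) (U.card * y + (J.card - U.card : ℕ) * z) := by
  have := biUnion J (A := A) (z := fun j => if j ∈ U then y else z) (fun j hj => by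
    split_ifs with hjU
    · exact hy j hjU
    · exact hz j hj hjU) h
  rwa [Finset.sum_ite, Finset.filter_mem_eq_inter, Finset.inter_eq_right.2 hU,
    Finset.filter_notMem_eq_sdiff, Finset.sum_const, Finset.sum_const, nsmul_eq_mul, nsmul_eq_mul,
    Finset.card_sdiff_of_subset hU] at this

theorem congr {A B : Set α} {y z : ℤ} (hA : HasCount A y) (h : B = A) (hz : z = y) :
    HasCount B z := by
  subst h hz
  exact hA

theorem encard_eq {A : Set α} {m : ℕ} (h : HasCount A m) : A.encard = (m : ℕ∞) := by
  rw [← h.1.cast_ncard_eq, Nat.cast_inj.1 h.2]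

end HasCount

/-! ### Increasing ordered trees -/

namespace IncreasingOrderedTree

variable {n : ℕ}

/-- The lists `p` of children are those of an increasing forest in which the nodes before `t` have
no children. -/
structure IsPartial (p : Fin (n + 1) → List (Fin (n + 1))) (t : Fin (n + 1)) : Prop where
  nodup : ∀ i, (p i).Nodup
  lt_of_mem : ∀ i, ∀ j ∈ p i, i < j
  eq_of_mem : ∀ i i' j, j ∈ p i → j ∈ p i' → i = i'
  eq_nil : ∀ i < t, p i = []

/-- The nodes after `t` without a parent. -/
def roots (p : Fin (n + 1) → List (Fin (n + 1))) (t : Fin (n + 1)) : Finset (Fin (n + 1)) :=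
  Finset.univ.filter fun j => t < j ∧ ∀ i, j ∉ p i

/-- The isolated nodes after `t`. -/
def leaves (p : Fin (n + 1) → List (Fin (n + 1))) (t : Fin (n + 1)) : Finset (Fin (n + 1)) :=
  (roots p t).filter fun j => p j = []

/-- Append a last child `j` to the node `t`. -/
def addChild (p : Fin (n + 1) → List (Fin (n + 1))) (t j : Fin (n + 1)) :
    Fin (n + 1) → List (Fin (n + 1)) :=
  Function.update p t (p t ++ [j])

/-- The trees in which the nodes after `t` have the given children, and the given children of `t`
are its first children. -/
def completions (p : Fin (n + 1) → List (Fin (n + 1))) (t : Fin (n + 1)) :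
    Set (IncreasingOrderedTree n) :=
  {T | (∀ i, t < i → T.children i = p i) ∧ p t <+: T.children t}

variable {p : Fin (n + 1) → List (Fin (n + 1))} {t j : Fin (n + 1)}

theorem mem_roots : j ∈ roots p t ↔ t < j ∧ ∀ i, j ∉ p i := by simp [roots]

theorem mem_leaves : j ∈ leaves p t ↔ j ∈ roots p t ∧ p j = [] := by simp [leaves]

theorem leaves_subset : leaves p t ⊆ roots p t := Finset.filter_subset _ _

theorem addChild_self : addChild p t j t = p t ++ [j] := by simp [addChild]

theorem addChild_of_ne {i : Fin (n + 1)} (h : i ≠ t) : addChild p t j i = p i := by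
  simp [addChild, h]

theorem mem_addChild {i k : Fin (n + 1)} :
    k ∈ addChild p t j i ↔ k ∈ p i ∨ i = t ∧ k = j := by
  by_cases h : i = t
  · subst h
    simp [addChild_self]
  · simp [addChild_of_ne h, h]

theorem IsPartial.addChild (hp : IsPartial p t) (hj : j ∈ roots p t) :
    IsPartial (addChild p t j) t := by
  obtain ⟨htj, hjp⟩ := mem_roots.1 hj
  refine ⟨fun i => ?_, fun i k hk => ?_, fun i i' k hk hk' => ?_, fun i hi => ?_⟩
  · by_cases h : i = t
    · subst h
      rw [addChild_self, List.nodup_append]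
      refine ⟨hp.nodup i, List.nodup_singleton j, ?_⟩
      rintro a ha b hb rfl
      rw [List.mem_singleton] at hb
      exact hjp i (hb ▸ ha)
    · rw [addChild_of_ne h]
      exact hp.nodup i
  · rcases mem_addChild.1 hk with h | ⟨rfl, rfl⟩
    · exact hp.lt_of_mem i k h
    · exact htj
  · rcases mem_addChild.1 hk with h | ⟨rfl, rfl⟩ <;> rcases mem_addChild.1 hk' with h' | ⟨h1, h2⟩
    · exact hp.eq_of_mem i i' k h h'
    · exact absurd (h2 ▸ h) (hjp i)
    · exact absurd h' (hjp i')
    · exact h1.symm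
  · rw [addChild_of_ne hi.ne]
    exact hp.eq_nil i hi

theorem roots_addChild : roots (addChild p t j) t = (roots p t).erase j := by
  ext k
  simp only [mem_roots, Finset.mem_erase, mem_addChild, not_or, not_and]
  constructor
  · rintro ⟨h1, h2⟩
    exact ⟨(h2 t).2 rfl, h1, fun i => (h2 i).1⟩
  · rintro ⟨h1, h2, h3⟩
    exact ⟨h2, fun i => ⟨h3 i, fun _ => h1⟩⟩

theorem leaves_addChild : leaves (addChild p t j) t = (leaves p t).erase j := by
  ext k
  simp only [mem_leaves, roots_addChild, Finset.mem_erase]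
  constructor
  · rintro ⟨⟨h1, h2⟩, h3⟩
    rw [addChild_of_ne (mem_roots.1 h2).1.ne'] at h3
    exact ⟨h1, h2, h3⟩
  · rintro ⟨h1, h2, h3⟩
    refine ⟨⟨h1, h2⟩, ?_⟩
    rwa [addChild_of_ne (mem_roots.1 h2).1.ne']

theorem completions_addChild_subset : completions (addChild p t j) t ⊆ completions p t := by
  rintro T ⟨h1, h2⟩
  refine ⟨fun i hi => by rw [h1 i hi, addChild_of_ne hi.ne'], ?_⟩
  rw [addChild_self] at h2
  exact (List.prefix_append _ _).trans h2

theorem getElem?_of_mem_completions {T : IncreasingOrderedTree n}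
    (h : T ∈ completions (addChild p t j) t) : (T.children t)[(p t).length]? = some j := by
  obtain ⟨r, hr⟩ := h.2
  rw [← hr, addChild_self]
  simp

theorem disjoint_completions {k : Fin (n + 1)} (hjk : j ≠ k) :
    Disjoint (completions (addChild p t j) t) (completions (addChild p t k) t) := by
  rw [Set.disjoint_left]
  intro T h1 h2
  have := getElem?_of_mem_completions h1
  rw [getElem?_of_mem_completions h2] at this
  exact hjk (Option.some_inj.1 this).symm

/-- A completion either stops the list of `t` here or has a next child there. That child is a
parentless later node: an earlier node still has no given children, a repetition in the list of `t`
is excluded, and parents are unique. -/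
theorem completions_eq (hp : IsPartial p t) :
    completions p t = {T ∈ completions p t | T.children t = p t} ∪
      ⋃ j ∈ roots p t, completions (addChild p t j) t := by
  ext T
  simp only [Set.mem_union, Set.mem_ofPred_eq, Set.mem_iUnion, exists_prop]
  constructor
  · rintro hT
    obtain ⟨r, hr⟩ := hT.2
    rcases r with _ | ⟨j, r⟩
    · exact Or.inl ⟨hT, by simpa using hr.symm⟩
    · have hjt : j ∈ T.children t := by rw [← hr]; simp
      refine Or.inr ⟨j, mem_roots.2 ⟨T.lt_of_mem t j hjt, fun i hi => ?_⟩, ?_, ?_⟩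
      · have hne : j ≠ 0 := (Fin.zero_le t |>.trans_lt (T.lt_of_mem t j hjt)).ne'
        rcases lt_trichotomy i t with h | rfl | h
        · rw [hp.eq_nil i h] at hi
          exact absurd hi List.not_mem_nil
        · have := T.nodup i
          rw [← hr, List.nodup_append] at this
          exact this.2.2 j hi j (by simp) rfl
        · rw [← hT.1 i h] at hi
          exact h.ne' ((T.existsUnique_parent j hne).unique hi hjt)
      · intro i hi
        rw [addChild_of_ne hi.ne', hT.1 i hi]
      · rw [addChild_self, ← hr]
        exact ⟨r, by simp⟩
  · rintro (h | ⟨j, -, h⟩)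
    · exact h.1
    · exact completions_addChild_subset h

theorem disjoint_completions_right :
    Disjoint {T ∈ completions p t | T.children t = p t}
      (⋃ j ∈ roots p t, completions (addChild p t j) t) := by
  rw [Set.disjoint_left]
  rintro T ⟨-, h1⟩ h2
  simp only [Set.mem_iUnion, exists_prop] at h2
  obtain ⟨j, -, h2⟩ := h2
  have := getElem?_of_mem_completions h2
  rw [h1] at this
  simp at this

/-- Closing the list of one node is the same as starting on the preceding node with an empty list.
-/
theorem completions_castSucc (s : Fin n) (hp : p s.castSucc = []) :
    {T ∈ completions p s.succ | T.children s.succ = p s.succ} = completions p s.castSucc := by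
  ext T
  simp only [Set.mem_ofPred_eq, completions, hp, List.nil_prefix, and_true]
  constructor
  · rintro ⟨⟨h1, -⟩, h2⟩ i hi
    rcases (Fin.castSucc_lt_iff_succ_le.1 hi).eq_or_lt with rfl | h
    · exact h2
    · exact h1 i h
  · intro h
    have hs := h s.succ (Fin.castSucc_lt_succ)
    exact ⟨⟨fun i hi => h i (Fin.castSucc_lt_succ.trans hi), by rw [hs]⟩, hs⟩

theorem succ_notMem_roots (s : Fin n) : s.succ ∉ roots p s.succ := by simp [mem_roots]

theorem roots_castSucc (s : Fin n) (hp : IsPartial p s.succ) :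
    roots p s.castSucc = insert s.succ (roots p s.succ) := by
  ext k
  simp only [mem_roots, Finset.mem_insert]
  constructor
  · rintro ⟨h1, h2⟩
    rcases (Fin.castSucc_lt_iff_succ_le.1 h1).eq_or_lt with rfl | h
    · exact Or.inl rfl
    · exact Or.inr ⟨h, h2⟩
  · rintro (rfl | ⟨h1, h2⟩)
    · refine ⟨Fin.castSucc_lt_succ, fun i hi => ?_⟩
      rw [hp.eq_nil i (hp.lt_of_mem i _ hi)] at hi
      exact absurd hi List.not_mem_nil
    · exact ⟨Fin.castSucc_lt_succ.trans h1, h2⟩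

theorem card_roots_castSucc (s : Fin n) (hp : IsPartial p s.succ) :
    (roots p s.castSucc).card = (roots p s.succ).card + 1 := by
  rw [roots_castSucc s hp, Finset.card_insert_of_notMem (succ_notMem_roots s)]

theorem card_leaves_castSucc (s : Fin n) (hp : IsPartial p s.succ) :
    (leaves p s.castSucc).card =
      (leaves p s.succ).card + if p s.succ = [] then 1 else 0 := by
  unfold leaves
  rw [roots_castSucc s hp, Finset.filter_insert]
  split_ifs with h
  · rw [Finset.card_insert_of_notMem fun h' => succ_notMem_roots s (Finset.mem_filter.1 h').1]
  · rfl

/-- At the root every parentless node must still be appended, in any order. -/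
theorem hasCount_completions_zero (hp : IsPartial p 0) :
    HasCount (completions p 0) ((roots p 0).card ! : ℕ) := by
  induction hk : (roots p 0).card generalizing p with
  | zero =>
    have hr : roots p 0 = ∅ := Finset.card_eq_zero.1 hk
    -- Every nonzero node now has a parent, so the data `p` are themselves a tree, the only
    -- completion.
    let T₀ : IncreasingOrderedTree n :=
      { children := p
        nodup := hp.nodup
        lt_of_mem := hp.lt_of_mem
        existsUnique_parent := by
          intro j hj
          have : j ∉ roots p 0 := by simp [hr]
          rw [mem_roots, not_and] at this
          have := this (Fin.pos_iff_ne_zero.2 hj)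
          push Not at this
          obtain ⟨i, hi⟩ := this
          exact ⟨i, hi, fun i' hi' => hp.eq_of_mem i' i j hi' hi⟩ }
    refine (HasCount.singleton T₀).congr ?_ (by simp)
    rw [completions_eq hp, hr]
    ext T
    simp only [Finset.notMem_empty, Set.iUnion_of_empty, Set.iUnion_empty, Set.union_empty,
      Set.mem_ofPred_eq, Set.mem_singleton_iff]
    constructor
    · rintro ⟨hT, h0⟩
      ext1
      funext i
      rcases eq_or_ne i 0 with rfl | h
      · exact h0
      · exact hT.1 i (Fin.pos_iff_ne_zero.2 h)
    · rintro rfl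
      exact ⟨⟨fun i _ => rfl, List.prefix_rfl⟩, rfl⟩
  | succ k ih =>
    have h := HasCount.biUnion (roots p 0) (A := fun j => completions (addChild p 0 j) 0)
      (z := fun _ => (k ! : ℕ))
      (fun j hj => ih (hp.addChild hj) (by rw [roots_addChild, Finset.card_erase_of_mem hj, hk]; rfl))
      (fun i _ j _ hij => disjoint_completions hij)
    refine h.congr ?_ (by rw [Finset.sum_const, hk, Nat.factorial_succ]; simp)
    rw [completions_eq hp, Set.union_eq_right]
    rintro T ⟨hT, h0⟩
    exfalso
    obtain ⟨j, hj⟩ := Finset.card_pos.1 (by omega : 0 < (roots p 0).card)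
    obtain ⟨h1, h2⟩ := mem_roots.1 hj
    obtain ⟨i, hi, -⟩ := T.existsUnique_parent j h1.ne'
    rcases eq_or_ne i 0 with rfl | h
    · exact h2 0 (h0 ▸ hi)
    · exact h2 i (hT.1 i (Fin.pos_iff_ne_zero.2 h) ▸ hi)

/-! ### Recursion for the flourishing completions -/

/-- The flourishing trees among the completions. -/
def flourishingCompletions (p : Fin (n + 1) → List (Fin (n + 1))) (t : Fin (n + 1)) :
    Set (IncreasingOrderedTree n) :=
  {T ∈ completions p t | T.IsFlourishing 2}

theorem flourishingCompletions_eq (hp : IsPartial p t) :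
    flourishingCompletions p t =
      {T ∈ flourishingCompletions p t | T.children t = p t} ∪
        ⋃ j ∈ roots p t, flourishingCompletions (addChild p t j) t := by
  ext T
  have := Set.ext_iff.1 (completions_eq hp) T
  simp only [flourishingCompletions, Set.mem_union, Set.mem_ofPred_eq, Set.mem_iUnion,
    exists_prop] at this ⊢
  constructor
  · rintro ⟨h1, h2⟩
    rcases this.1 h1 with h | ⟨i, hi, h⟩
    · exact Or.inl ⟨⟨h1, h2⟩, h.2⟩
    · exact Or.inr ⟨i, hi, h, h2⟩
  · rintro (h | ⟨i, hi, h, h2⟩)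
    · exact h.1
    · exact ⟨this.2 (Or.inr ⟨i, hi, h⟩), h2⟩

theorem disjoint_flourishingCompletions {k : Fin (n + 1)} (hjk : j ≠ k) :
    Disjoint (flourishingCompletions (addChild p t j) t)
      (flourishingCompletions (addChild p t k) t) :=
  (disjoint_completions hjk).mono (fun _ h => h.1) fun _ h => h.1

theorem flourishingCompletions_eq_of_short (hp : IsPartial p 0) (h : (p 0).length < 2) :
    flourishingCompletions p 0 = ⋃ j ∈ roots p 0, flourishingCompletions (addChild p 0 j) 0 := by
  rw [flourishingCompletions_eq hp, Set.union_eq_right]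
  rintro T ⟨⟨-, hT⟩, h0⟩
  have := hT.1
  rw [h0] at this
  omega

theorem flourishingCompletions_leaf (h : (p 0).length < 2) (hj : j ∈ leaves p 0) :
    flourishingCompletions (addChild p 0 j) 0 = ∅ := by
  rw [Set.eq_empty_iff_forall_notMem]
  rintro T ⟨hT, hF⟩
  obtain ⟨hj, hl⟩ := mem_leaves.1 hj
  have hpos := (mem_roots.1 hj).1
  refine hF.2 j ?_ ?_
  · rw [List.mem_iff_getElem?]
    refine ⟨(p 0).length, ?_⟩
    rw [List.getElem?_take_of_lt h]
    exact getElem?_of_mem_completions hT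
  · rw [hT.1 j hpos, addChild_of_ne hpos.ne', hl]

/-- Choose the first two children of the root among the nonleaves, then order the others freely. The
truncation of k - 1 - u matters only for u = k, where the first factor is 0. -/
theorem hasCount_flourishing_zero (hp : IsPartial p 0) (h0 : p 0 = []) :
    HasCount (flourishingCompletions p 0)
      (((roots p 0).card - (leaves p 0).card : ℕ) *
        (((roots p 0).card - 1 - (leaves p 0).card : ℕ) * (((roots p 0).card - 2)! : ℕ))) := by
  have hlen : (p 0).length < 2 := by simp [h0]
  rw [flourishingCompletions_eq_of_short hp hlen]
  refine (HasCount.biUnion_ite leaves_subset (y := 0)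
    (z := (((roots p 0).card - 1 - (leaves p 0).card : ℕ) * (((roots p 0).card - 2)! : ℕ)))
    (fun j hj => ?_) (fun j hj hjl => ?_)
    fun i _ j _ hij => disjoint_flourishingCompletions hij).congr rfl (by ring)
  · rw [flourishingCompletions_leaf hlen hj]
    exact HasCount.empty
  set q := addChild p 0 j with hq
  have hqp : IsPartial q 0 := hp.addChild hj
  have hq0 : q 0 = [j] := by rw [hq, addChild_self, h0, List.nil_append]
  have hqlen : (q 0).length < 2 := by simp [hq0]
  have hrc : (roots q 0).card = (roots p 0).card - 1 := by
    rw [hq, roots_addChild, Finset.card_erase_of_mem hj]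
  have hlc : (leaves q 0).card = (leaves p 0).card := by
    rw [hq, leaves_addChild, Finset.erase_eq_of_notMem hjl]
  rw [flourishingCompletions_eq_of_short hqp hqlen]
  refine (HasCount.biUnion_ite leaves_subset (y := 0) (z := (((roots p 0).card - 2)! : ℕ))
    (fun k hk => ?_) (fun k hk hkl => ?_)
    fun i _ k _ hik => disjoint_flourishingCompletions hik).congr rfl (by rw [hrc, hlc]; ring)
  · rw [flourishingCompletions_leaf hqlen hk]
    exact HasCount.empty
  refine (hasCount_completions_zero (hqp.addChild hk)).congr ?_ ?_
  · refine Set.Subset.antisymm (fun T hT => hT.1) fun T hT => ⟨hT, ?_⟩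
    obtain ⟨r, hr⟩ := hT.2
    rw [addChild_self, hq0] at hr
    rw [IsFlourishing, ← hr]
    refine ⟨by simp, fun i hi => ?_⟩
    have hnil : ∀ i ∈ roots p 0, i ∉ leaves p 0 → p i ≠ [] := fun i h1 h2 h3 =>
      h2 (mem_leaves.2 ⟨h1, h3⟩)
    have hkp : k ∈ roots p 0 := by
      rw [hq, roots_addChild] at hk
      exact Finset.mem_of_mem_erase hk
    have hkl' : k ∉ leaves p 0 := by
      rw [hq, leaves_addChild, Finset.mem_erase, not_and] at hkl
      refine hkl ?_
      rintro rfl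
      rw [hq, roots_addChild] at hk
      exact Finset.notMem_erase k _ hk
    have hch : ∀ i ∈ roots p 0, T.children i = p i := fun i hi => by
      have := (mem_roots.1 hi).1
      rw [hT.1 i this, addChild_of_ne this.ne', hq, addChild_of_ne this.ne']
    have : i = j ∨ i = k := by simpa using hi
    rcases this with rfl | rfl
    · rw [hch i hj]
      exact hnil i hj hjl
    · rw [hch i hkp]
      exact hnil i hkp hkl'
  · rw [roots_addChild, Finset.card_erase_of_mem hk, hrc]
    rfl

/-- Node 1 can only be a child of the root. If no other node is parentless, node 2 already has a
parent, which must be node 1, so node 1 is not a leaf. -/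
theorem card_roots_zero (hn : 2 ≤ n) (hp : IsPartial p 0) (h0 : p 0 = []) :
    1 ≤ (roots p 0).card ∧ ((roots p 0).card = 1 → (leaves p 0).card = 0) := by
  obtain ⟨n, rfl⟩ := Nat.exists_eq_add_of_le' hn
  have h1 : (1 : Fin (n + 3)) ∈ roots p 0 := by
    refine mem_roots.2 ⟨by simp, fun i hi => ?_⟩
    have := hp.lt_of_mem i 1 hi
    obtain rfl : i = 0 := by
      rw [Fin.lt_def] at this
      exact Fin.ext (Nat.lt_one_iff.1 this)
    simp [h0] at hi
  refine ⟨Finset.card_pos.2 ⟨1, h1⟩, fun hc => ?_⟩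
  obtain ⟨a, ha⟩ := Finset.card_eq_one.1 hc
  have ha1 : 1 = a := Finset.mem_singleton.1 (ha ▸ h1)
  subst ha1
  rw [Finset.card_eq_zero, Finset.eq_empty_iff_forall_notMem]
  intro j hj
  obtain ⟨hj, hl⟩ := mem_leaves.1 hj
  obtain rfl : j = 1 := Finset.mem_singleton.1 (ha ▸ hj)
  have h2 : (2 : Fin (n + 3)) ∈ roots p 0 := by
    refine mem_roots.2 ⟨Nat.zero_lt_two, fun i hi => ?_⟩
    have := hp.lt_of_mem i 2 hi
    have hi2 : i = 0 ∨ i = 1 := by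
      rw [Fin.lt_def] at this
      have h2 : (i : ℕ) < 2 := this
      interval_cases h : (i : ℕ)
      · exact Or.inl (Fin.ext h)
      · exact Or.inr (Fin.ext h)
    rcases hi2 with rfl | rfl
    · simp [h0] at hi
    · simp [hl] at hi
  rw [ha, Finset.mem_singleton, Fin.ext_iff] at h2
  exact absurd (show (2 : ℕ) = 1 from h2) (by decide)

/-- At node `t`, `t` itself and the earlier nodes may still become leaves, except `t` if it has a
child: this is the argument w. -/
theorem hasCount_flourishingCompletions (hn : 2 ≤ n) (t : Fin (n + 1)) :
    ∀ p : Fin (n + 1) → List (Fin (n + 1)), IsPartial p t → (t = 0 → p t = []) →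
      HasCount (flourishingCompletions p t)
        (flourishingCount t (t - if p t = [] then 0 else 1) (roots p t).card (leaves p t).card -
          plantedCount t (roots p t).card) := by
  induction t using Fin.induction with
  | zero =>
    intro p hp h0
    have hu : (leaves p 0).card ≤ (roots p 0).card := Finset.card_le_card leaves_subset
    obtain ⟨h1, h2⟩ := card_roots_zero hn hp (h0 rfl)
    refine (hasCount_flourishing_zero hp (h0 rfl)).congr rfl ?_
    rw [h0 rfl, if_pos rfl]
    generalize (roots p 0).card = k at *
    generalize (leaves p 0).card = u at *
    change flourishingCount 0 0 k u - plantedCount 0 k = _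
    rw [flourishingCount_zero, plantedCount]
    rcases k with _ | _ | k
    · omega
    · simp [h2 rfl]
    · rw [if_neg (by omega)]
      rcases hu.eq_or_lt with rfl | hu'
      · simp only [Nat.sub_self, Nat.add_sub_cancel, Nat.reduceSubDiff, Nat.factorial_succ]
        push_cast
        ring
      · rw [Nat.cast_sub hu, Nat.cast_sub (by omega)]
        simp only [Nat.add_sub_cancel, Nat.reduceSubDiff, Nat.factorial_succ]
        push_cast
        ring
  | succ s ih =>
    intro p hp _
    have hps : p s.castSucc = [] := hp.eq_nil _ Fin.castSucc_lt_succ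
    have hp' : IsPartial p s.castSucc :=
      ⟨hp.nodup, hp.lt_of_mem, hp.eq_of_mem,
        fun i hi => hp.eq_nil i (hi.trans Fin.castSucc_lt_succ)⟩
    -- Appending a child keeps the node fixed but uses up a parentless node, hence a second
    -- induction inside the one on the node.
    induction hk : (roots p s.succ).card using Nat.strong_induction_on generalizing p with
    | _ k ihk =>
    have hfirst : {T ∈ flourishingCompletions p s.succ | T.children s.succ = p s.succ} =
        flourishingCompletions p s.castSucc := by
      ext T
      have := Set.ext_iff.1 (completions_castSucc s hps) T
      simp only [flourishingCompletions, Set.mem_ofPred_eq] at this ⊢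
      rw [← this]
      tauto
    have h1 := ih p hp' fun _ => hps
    rw [if_pos hps, Nat.sub_zero, card_roots_castSucc s hp, card_leaves_castSucc s hp, hk,
      Fin.val_castSucc] at h1
    have hchild : ∀ j ∈ roots p s.succ, ∀ u, (leaves (addChild p s.succ j) s.succ).card = u →
        HasCount (flourishingCompletions (addChild p s.succ j) s.succ)
          (flourishingCount (s + 1) s (k - 1) u - plantedCount (s + 1) (k - 1)) := by
      intro j hj u hu
      have hc : (roots (addChild p s.succ j) s.succ).card = k - 1 := by
        rw [roots_addChild, Finset.card_erase_of_mem hj, hk]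
      have hpos := Finset.card_pos.2 ⟨j, hj⟩
      have hp2 := hp.addChild hj
      have := ihk (k - 1) (by omega) _ hp2 (by simp [Fin.succ_ne_zero])
        (hp2.eq_nil _ Fin.castSucc_lt_succ)
        ⟨hp2.nodup, hp2.lt_of_mem, hp2.eq_of_mem,
          fun i hi => hp2.eq_nil i (hi.trans Fin.castSucc_lt_succ)⟩ hc
      rw [hu, addChild_self, if_neg (by simp), Fin.val_succ, Nat.add_sub_cancel] at this
      exact this
    have h2 := HasCount.biUnion_ite (leaves_subset (p := p) (t := s.succ))
      (A := fun j => flourishingCompletions (addChild p s.succ j) s.succ)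
      (fun j hj => hchild j (leaves_subset hj) _
        (by rw [leaves_addChild, Finset.card_erase_of_mem hj]))
      (fun j hj hjl => hchild j hj _
        (by rw [leaves_addChild, Finset.erase_eq_of_notMem hjl]))
      fun i _ j _ hij => disjoint_flourishingCompletions hij
    rw [flourishingCompletions_eq hp, hfirst]
    refine (h1.union h2 ?_).congr rfl ?_
    · rw [← hfirst]
      have hs1 : {T ∈ flourishingCompletions p s.succ | T.children s.succ = p s.succ} ⊆
          {T ∈ completions p s.succ | T.children s.succ = p s.succ} :=
        fun T hT => ⟨hT.1.1, hT.2⟩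
      exact disjoint_completions_right.mono hs1 (Set.iUnion₂_mono fun j _ T hT => hT.1)
    · have hu : (leaves p s.succ).card ≤ k := hk ▸ Finset.card_le_card leaves_subset
      have hrec := flourishingCount_rec s (if p s.succ = [] then 1 else 0) k
        (leaves p s.succ).card (by split_ifs <;> simp) hu
      have hw : (s.succ : ℕ) - (if p s.succ = [] then 0 else 1) =
          s + if p s.succ = [] then 1 else 0 := by
        rw [Fin.val_succ]
        split_ifs <;> simp
      rw [hw, Fin.val_succ, hrec, plantedCount_rec, hk, Nat.cast_sub hu]
      ring

theorem hasCount_flourishing (hn : 2 ≤ n) :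
    HasCount {T : IncreasingOrderedTree n | T.IsFlourishing 2}
      (flourishingCount n n 0 0 - plantedCount n 0) := by
  have hp : IsPartial (fun _ => [] : Fin (n + 1) → List (Fin (n + 1))) (Fin.last n) :=
    ⟨fun _ => List.nodup_nil, by simp, by simp, fun _ _ => rfl⟩
  have hr : roots (fun _ => [] : Fin (n + 1) → List (Fin (n + 1))) (Fin.last n) = ∅ := by
    ext j
    simp [mem_roots, Fin.le_last]
  have h := hasCount_flourishingCompletions hn _ _ hp fun _ => rfl
  rw [leaves, hr] at h
  refine h.congr ?_ rfl
  ext T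
  simp only [flourishingCompletions, completions, Set.mem_ofPred_eq, List.nil_prefix, and_true]
  refine ⟨fun hT => ⟨fun i hi => absurd hi (Fin.le_last i).not_gt, hT⟩, fun hT => hT.2⟩

theorem not_isFlourishing (hn : n < 2) (T : IncreasingOrderedTree n) : ¬ T.IsFlourishing 2 := by
  rintro ⟨hl, -⟩
  -- The root and its children are distinct nodes, so the root has at most n children.
  have h0 : (0 : Fin (n + 1)) ∉ T.children 0 := fun h => lt_irrefl _ (T.lt_of_mem 0 0 h)
  have := (T.nodup 0).length_le_card
  have hc := (List.nodup_cons.2 ⟨h0, T.nodup 0⟩).length_le_card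
  rw [Fintype.card_fin, List.length_cons] at hc
  omega

theorem encard_flourishing (n : ℕ) :
    {T : IncreasingOrderedTree n | T.IsFlourishing 2}.encard =
      (partitionSum n flourishingWeight : ℕ∞) := by
  rcases lt_or_ge n 2 with hn | hn
  · rw [partitionSum_flourishingWeight_of_lt hn, Nat.cast_zero, Set.encard_eq_zero,
      Set.eq_empty_iff_forall_notMem]
    exact not_isFlourishing hn
  · refine HasCount.encard_eq ?_
    rw [partitionSum_flourishingWeight hn]
    exact hasCount_flourishing hn

end IncreasingOrderedTree

/-! ### Codes of labeled partitions -/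

/-- The involution of `[[n]]` that exchanges `i` and `ī`. -/
def barElt {n : ℕ} (a : BarredSet n) : BarredSet n := (a.1, !a.2)

theorem barElt_barElt {n : ℕ} (a : BarredSet n) : barElt (barElt a) = a := by simp [barElt]

theorem barElt_ne {n : ℕ} (a : BarredSet n) : barElt a ≠ a := by
  simp [barElt, Prod.ext_iff]

theorem eq_or_eq_barElt {n : ℕ} {a b : BarredSet n} (h : a.1 = b.1) : a = b ∨ a = barElt b := by
  obtain ⟨i, s⟩ := a
  obtain ⟨j, t⟩ := b
  obtain rfl : i = j := h
  cases s <;> cases t <;> simp [barElt]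

theorem mem_barSet {n : ℕ} {a : BarredSet n} {R : Finset (BarredSet n)} :
    a ∈ barSet R ↔ barElt a ∈ R := by
  simp only [barSet, Finset.mem_image]
  constructor
  · rintro ⟨b, hb, rfl⟩
    simpa [barElt] using hb
  · intro h
    exact ⟨barElt a, h, barElt_barElt a⟩

theorem Finpartition.mem_parts_iff_exists_part {α : Type*} [Fintype α] [DecidableEq α]
    (P : Finpartition (Finset.univ : Finset α)) {R : Finset α} :
    R ∈ P.parts ↔ ∃ a, P.part a = R := by
  constructor
  · intro h
    obtain ⟨a, ha⟩ := P.nonempty_of_mem_parts h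
    exact ⟨a, P.part_eq_of_mem h ha⟩
  · rintro ⟨a, rfl⟩
    exact P.part_mem.2 (Finset.mem_univ a)

namespace LabeledPartition

variable {n : ℕ} {S : Type*}

theorem mem_part (x : LabeledPartition n S) (a : BarredSet n) : a ∈ x.partition.part a :=
  x.partition.mem_part (Finset.mem_univ a)

theorem part_mem (x : LabeledPartition n S) (a : BarredSet n) :
    x.partition.part a ∈ x.partition.parts :=
  x.partition.part_mem.2 (Finset.mem_univ a)

theorem mem_part_iff (x : LabeledPartition n S) {a b : BarredSet n} :
    a ∈ x.partition.part b ↔ x.partition.part a = x.partition.part b :=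
  x.partition.mem_part_iff_part_eq_part (Finset.mem_univ a) (Finset.mem_univ b)

theorem part_barElt (x : LabeledPartition n S) (a : BarredSet n) :
    x.partition.part (barElt a) = barSet (x.partition.part a) :=
  x.partition.part_eq_of_mem (x.bar_mem _ (x.part_mem a))
    (mem_barSet.2 (by rw [barElt_barElt]; exact x.mem_part a))

theorem part_eq_signed (x : LabeledPartition n S) {a : BarredSet n} {σ : S}
    (h : a ∈ x.signed σ) : x.partition.part a = x.signed σ :=
  x.partition.part_eq_of_mem (x.signed_mem σ ⟨a, h⟩) h

theorem eq_of_mem_signed (x : LabeledPartition n S) {a : BarredSet n} {σ τ : S}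
    (h : a ∈ x.signed σ) (h' : a ∈ x.signed τ) : σ = τ :=
  x.signed_inj σ τ ⟨a, h⟩ ((x.part_eq_signed h).symm.trans (x.part_eq_signed h'))

theorem part_barElt_eq_iff (x : LabeledPartition n S) (a : BarredSet n) :
    x.partition.part (barElt a) = x.partition.part a ↔ ∃ σ, a ∈ x.signed σ := by
  rw [part_barElt, x.bar_eq_iff _ (x.part_mem a)]
  constructor
  · rintro ⟨σ, h⟩
    exact ⟨σ, h ▸ x.mem_part a⟩
  · rintro ⟨σ, h⟩
    exact ⟨σ, (x.part_eq_signed h).symm⟩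

theorem exists_first (x : LabeledPartition n S) (a : BarredSet n) :
    ∃ c ∈ x.partition.part a, ∀ b ∈ x.partition.part a, c.1 ≤ b.1 :=
  Finset.exists_min_image _ _ ⟨a, x.mem_part a⟩

open scoped Classical in
/-- The code of a labeled partition sends an element of a signed block to the sign, and an element
of an unsigned block to the first element of the block. -/
noncomputable def code (x : LabeledPartition n S) (a : BarredSet n) : BarredSet n ⊕ S :=
  if h : ∃ σ, a ∈ x.signed σ then Sum.inr h.choose else Sum.inl (x.exists_first a).choose

theorem code_eq_inr (x : LabeledPartition n S) {a : BarredSet n} {σ : S} :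
    x.code a = Sum.inr σ ↔ a ∈ x.signed σ := by
  unfold code
  split_ifs with h
  · rw [Sum.inr.injEq]
    constructor
    · rintro rfl
      exact h.choose_spec
    · exact x.eq_of_mem_signed h.choose_spec
  · simp only [false_iff]
    exact fun h' => h ⟨σ, h'⟩

theorem code_eq_inl (x : LabeledPartition n S) {a c : BarredSet n} (h : x.code a = Sum.inl c) :
    (∀ σ, a ∉ x.signed σ) ∧ c ∈ x.partition.part a ∧ ∀ b ∈ x.partition.part a, c.1 ≤ b.1 := by
  unfold code at h
  split_ifs at h with h'
  · push Not at h'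
    obtain rfl := Sum.inl.inj h
    exact ⟨h', (x.exists_first a).choose_spec⟩

theorem code_congr (x : LabeledPartition n S) {a b : BarredSet n}
    (h : x.partition.part a = x.partition.part b) : x.code a = x.code b := by
  by_cases hs : ∃ σ, a ∈ x.signed σ
  · obtain ⟨σ, hσ⟩ := hs
    have hb : b ∈ x.signed σ := by
      rw [← x.part_eq_signed hσ, h]
      exact x.mem_part b
    rw [x.code_eq_inr.2 hσ, x.code_eq_inr.2 hb]
  · have hs' : ¬ ∃ σ, b ∈ x.signed σ := by
      rintro ⟨σ, hσ⟩
      refine hs ⟨σ, ?_⟩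
      rw [← x.part_eq_signed hσ, ← h]
      exact x.mem_part a
    unfold code
    rw [dif_neg hs, dif_neg hs']
    simp only [h]

theorem code_eq_code (x : LabeledPartition n S) {a b : BarredSet n} :
    x.code a = x.code b ↔ x.partition.part a = x.partition.part b := by
  refine ⟨fun h => ?_, x.code_congr⟩
  rcases hb : x.code b with c | σ
  · have h1 := x.mem_part_iff.1 (x.code_eq_inl hb).2.1
    have h2 := x.mem_part_iff.1 (x.code_eq_inl (h.trans hb)).2.1
    rw [← h1, ← h2]
  · rw [x.part_eq_signed (x.code_eq_inr.1 hb), x.part_eq_signed (x.code_eq_inr.1 (h.trans hb))]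

/-- The properties that characterize the codes of labeled partitions. -/
structure IsCode (f : BarredSet n → BarredSet n ⊕ S) : Prop where
  bar : ∀ a, f (barElt a) = Sum.map barElt id (f a)
  self : ∀ a c, f a = Sum.inl c → f c = Sum.inl c
  le : ∀ a c, f a = Sum.inl c → c.1 ≤ a.1

theorem isCode_code (x : LabeledPartition n S) : IsCode x.code where
  self a c h := (x.code_congr (x.mem_part_iff.1 (x.code_eq_inl h).2.1)).trans h
  le a c h := (x.code_eq_inl h).2.2 a (x.mem_part a)
  bar a := by
    rcases h : x.code a with c | σ
    · obtain ⟨h1, h2, h3⟩ := x.code_eq_inl h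
      have hne : x.partition.part (barElt a) ≠ x.partition.part a := by
        rw [Ne, part_barElt_eq_iff]
        push Not
        exact h1
      rcases hb : x.code (barElt a) with d | σ
      · obtain ⟨-, h5, h6⟩ := x.code_eq_inl hb
        rw [part_barElt, mem_barSet] at h5
        have hcd : d.1 = c.1 := by
          refine le_antisymm (h6 (barElt c) ?_) (h3 (barElt d) h5)
          rw [part_barElt, mem_barSet, barElt_barElt]
          exact h2
        rcases eq_or_eq_barElt hcd with rfl | rfl
        -- A common first element would lie both in the block of `a` and in its barred copy, making
        -- the block signed.
        · exfalso
          rw [x.mem_part_iff, part_barElt] at h5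
          rw [x.mem_part_iff] at h2
          rw [h2] at h5
          rw [part_barElt] at hne
          exact hne h5
        · rfl
      · exfalso
        have hσ := x.part_eq_signed (x.code_eq_inr.1 hb)
        have := (x.part_barElt_eq_iff (barElt a)).2 ⟨σ, x.code_eq_inr.1 hb⟩
        rw [barElt_barElt] at this
        exact hne this.symm
    · have hσ := x.code_eq_inr.1 h
      refine x.code_eq_inr.2 ?_
      have := (x.part_barElt_eq_iff a).2 ⟨σ, hσ⟩
      rw [id, ← x.part_eq_signed hσ, ← this]
      exact x.mem_part _

theorem eq_of_code_eq {x y : LabeledPartition n S} (h : x.code = y.code) : x = y := by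
  have hs : x.signed = y.signed := by
    funext σ
    ext a
    rw [← code_eq_inr, ← code_eq_inr, h]
  have hp (a) : x.partition.part a = y.partition.part a := by
    ext b
    rw [mem_part_iff, mem_part_iff, ← code_eq_code, ← code_eq_code, h]
  refine LabeledPartition.ext (Finpartition.ext ?_) hs
  ext R
  rw [Finpartition.mem_parts_iff_exists_part, Finpartition.mem_parts_iff_exists_part]
  simp only [hp]

open scoped Classical in
/-- The partition of `[[n]]` into the fibers of a function. -/
noncomputable def fiberPartition (f : BarredSet n → BarredSet n ⊕ S) :
    Finpartition (Finset.univ : Finset (BarredSet n)) :=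
  Finpartition.ofSetoid (Setoid.ker f)

theorem mem_part_fiberPartition {f : BarredSet n → BarredSet n ⊕ S} {a b : BarredSet n} :
    b ∈ (fiberPartition f).part a ↔ f a = f b := by
  classical
  exact Finpartition.mem_part_ofSetoid_iff_rel

theorem part_fiberPartition_eq_iff {f : BarredSet n → BarredSet n ⊕ S} {a b : BarredSet n} :
    (fiberPartition f).part a = (fiberPartition f).part b ↔ f a = f b := by
  rw [← Finpartition.mem_part_iff_part_eq_part _ (Finset.mem_univ _) (Finset.mem_univ _),
    mem_part_fiberPartition, eq_comm]

theorem part_fiberPartition_barElt {f : BarredSet n → BarredSet n ⊕ S} (h : IsCode f)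
    (a : BarredSet n) :
    (fiberPartition f).part (barElt a) = barSet ((fiberPartition f).part a) := by
  have hinv : Function.Injective (Sum.map barElt id : BarredSet n ⊕ S → BarredSet n ⊕ S) :=
    Function.Injective.sumMap (Function.LeftInverse.injective barElt_barElt) Function.injective_id
  ext b
  rw [mem_barSet, mem_part_fiberPartition, mem_part_fiberPartition, h.bar a, ← barElt_barElt b,
    h.bar (barElt b), hinv.eq_iff, barElt_barElt]

open scoped Classical in
/-- The labeled partition with a given code. -/
noncomputable def ofCode (f : BarredSet n → BarredSet n ⊕ S) (h : IsCode f) :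
    LabeledPartition n S where
  partition := fiberPartition f
  signed σ := Finset.univ.filter fun a => f a = Sum.inr σ
  signed_mem := by
    rintro σ ⟨a, ha⟩
    refine (fiberPartition f).mem_parts_iff_exists_part.2 ⟨a, ?_⟩
    ext b
    simp only [Finset.mem_filter, Finset.mem_univ, true_and] at ha ⊢
    rw [mem_part_fiberPartition, ha, eq_comm]
  signed_inj := by
    rintro σ τ ⟨a, ha⟩ h
    have ha' := h ▸ ha
    simp only [Finset.mem_filter, Finset.mem_univ, true_and] at ha ha'
    exact Sum.inr.inj (ha.symm.trans ha')
  bar_mem := by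
    intro R hR
    obtain ⟨a, rfl⟩ := (fiberPartition f).mem_parts_iff_exists_part.1 hR
    exact (fiberPartition f).mem_parts_iff_exists_part.2 ⟨barElt a, part_fiberPartition_barElt h a⟩
  bar_eq_iff := by
    intro R hR
    obtain ⟨a, rfl⟩ := (fiberPartition f).mem_parts_iff_exists_part.1 hR
    rw [← part_fiberPartition_barElt h, part_fiberPartition_eq_iff, h.bar]
    constructor
    · intro ha
      rcases hf : f a with c | σ
      · rw [hf] at ha
        exact absurd (Sum.inl.inj ha) (barElt_ne c)
      · refine ⟨σ, ?_⟩
        ext b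
        simp only [Finset.mem_filter, Finset.mem_univ, true_and]
        rw [mem_part_fiberPartition, hf, eq_comm]
    · rintro ⟨σ, hσ⟩
      have ha : a ∈ (fiberPartition f).part a := mem_part_fiberPartition.2 rfl
      rw [← hσ] at ha
      simp only [Finset.mem_filter, Finset.mem_univ, true_and] at ha
      rw [ha]
      rfl

theorem code_ofCode (f : BarredSet n → BarredSet n ⊕ S) (h : IsCode f) :
    (ofCode f h).code = f := by
  have hinr : ∀ a σ, (ofCode f h).code a = Sum.inr σ ↔ f a = Sum.inr σ := by
    intro a σ
    rw [code_eq_inr]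
    simp [ofCode]
  funext a
  rcases ha : f a with c | σ
  · rcases hc : (ofCode f h).code a with d | σ
    · obtain ⟨-, h2, h3⟩ := code_eq_inl _ hc
      have hd : f d = Sum.inl c := (mem_part_fiberPartition.1 h2).symm.trans ha
      have hcc := h.self a c ha
      have h4 : d.1 ≤ c.1 := h3 c (mem_part_fiberPartition.2 (ha.trans hcc.symm))
      rcases eq_or_eq_barElt (le_antisymm h4 (h.le d c hd)) with rfl | rfl
      · rfl
      · rw [h.bar, hcc] at hd
        exact absurd (Sum.inl.inj hd) (barElt_ne c)
    · rw [hinr, ha] at hc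
      simp at hc
  · exact (hinr a σ).2 ha

/-- Refinement means that the code of `y` factors through that of `x`: signs are kept, and an
element shares the `y`-block of its first element in `x`. -/
theorem le_iff_code {x y : LabeledPartition n S} :
    x ≤ y ↔ ∀ a, y.code a = Sum.elim y.code Sum.inr (x.code a) := by
  constructor
  · intro h a
    rcases ha : x.code a with c | σ
    · obtain ⟨T, hT, hsub⟩ := (show x.Refines y from h).partition_le (x.part_mem a)
      have h1 := y.partition.part_eq_of_mem hT (hsub (x.mem_part a))
      have h2 := y.partition.part_eq_of_mem hT (hsub (x.code_eq_inl ha).2.1)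
      exact y.code_congr (h1.trans h2.symm)
    · exact y.code_eq_inr.2 (h.1 σ (x.code_eq_inr.1 ha))
  · intro h
    refine ⟨fun σ a ha => ?_, ?_⟩
    · rw [← code_eq_inr] at ha ⊢
      rw [h, ha, Sum.elim_inr]
    · rintro R ⟨hR, -⟩
      obtain ⟨a, rfl⟩ := x.partition.mem_parts_iff_exists_part.1 hR
      refine ⟨y.partition.part a, y.part_mem a, fun b hb => ?_⟩
      rw [mem_part_iff, ← code_eq_code] at hb ⊢
      rw [h b, h a, hb]

end LabeledPartition

/-! ### Representatives, singletons and moves in terms of codes -/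

namespace LabeledPartition

variable {n : ℕ} {S : Type*}

namespace IsCode

variable {f : BarredSet n → BarredSet n ⊕ S}

theorem eq_of_fst_eq (hf : IsCode f) {a c : BarredSet n} (h : f a = Sum.inl c) (hac : c.1 = a.1) :
    c = a := by
  rcases eq_or_eq_barElt hac with rfl | rfl
  · rfl
  · have := hf.self _ _ h
    rw [hf.bar, h] at this
    exact absurd (Sum.inl.inj this) (barElt_ne _)

theorem eq_inr_of_fst_eq (hf : IsCode f) {a b : BarredSet n} {σ : S} (h : f a = Sum.inr σ)
    (hab : b.1 = a.1) : f b = Sum.inr σ := by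
  rcases eq_or_eq_barElt hab with rfl | rfl
  · exact h
  · rw [hf.bar, h]
    rfl

theorem eq_inl_mk (hf : IsCode f) {i j : Fin n} {s t : Bool} (h : f (i, s) = Sum.inl (j, t))
    (u : Bool) : f (i, u) = Sum.inl (j, (s ^^ t) ^^ u) := by
  by_cases hu : u = s
  · subst hu
    rw [h]
    cases u <;> cases t <;> rfl
  · have : (i, u) = barElt (i, s) := by
      cases u <;> cases s <;> simp_all [barElt]
    rw [this, hf.bar, h]
    cases u <;> cases s <;> cases t <;> simp_all [barElt]

theorem eq_shift (hf : IsCode f) {i j : Fin n} {s t : Bool} (h : f (i, s) = f (j, t)) :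
    f (j, false) = f (i, s ^^ t) := by
  have h' := congrArg (Sum.map barElt id) h
  rw [← hf.bar, ← hf.bar] at h'
  cases s <;> cases t <;> simp_all [barElt]

end IsCode

open scoped Classical in
/-- The representatives (zero-based) of the unsigned blocks. -/
noncomputable def reps (x : LabeledPartition n S) : Finset (Fin n) :=
  Finset.univ.filter fun i => x.code (i, false) = Sum.inl (i, false)

open scoped Classical in
/-- The representatives of the unsigned blocks with one element. -/
noncomputable def singles (x : LabeledPartition n S) : Finset (Fin n) :=
  x.reps.filter fun i => ∀ a c, x.code a = Sum.inl c → c.1 = i → a.1 = i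

theorem mem_reps {x : LabeledPartition n S} {i : Fin n} :
    i ∈ x.reps ↔ x.code (i, false) = Sum.inl (i, false) := by
  simp [reps]

theorem mem_singles {x : LabeledPartition n S} {i : Fin n} :
    i ∈ x.singles ↔ i ∈ x.reps ∧ ∀ a c, x.code a = Sum.inl c → c.1 = i → a.1 = i := by
  simp [singles]

theorem singles_subset (x : LabeledPartition n S) : x.singles ⊆ x.reps := by
  classical
  exact Finset.filter_subset _ _

theorem code_of_mem_reps {x : LabeledPartition n S} {i : Fin n} (hi : i ∈ x.reps) (s : Bool) :
    x.code (i, s) = Sum.inl (i, s) := by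
  rw [x.isCode_code.eq_inl_mk (mem_reps.1 hi) s]
  simp

theorem fst_mem_reps {x : LabeledPartition n S} {a c : BarredSet n} (h : x.code a = Sum.inl c) :
    c.1 ∈ x.reps := by
  have := x.isCode_code.self _ _ h
  rw [mem_reps, x.isCode_code.eq_inl_mk (s := c.2) (t := c.2) (i := c.1) (j := c.1) this false]
  simp

theorem reps_subset_of_le {x y : LabeledPartition n S} (h : x ≤ y) : y.reps ⊆ x.reps := by
  intro i hi
  rw [mem_reps] at hi ⊢
  have h' := le_iff_code.1 h (i, false)
  rcases hc : x.code (i, false) with c | σ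
  · rw [hc, hi, Sum.elim_inl] at h'
    have h1 := y.isCode_code.le c _ h'.symm
    have h2 := x.isCode_code.le _ _ hc
    rw [x.isCode_code.eq_of_fst_eq hc (le_antisymm h2 h1)]
  · rw [hc, hi, Sum.elim_inr] at h'
    simp at h'

/-! ### The moves -/

/-- The code after the block of `j` has been merged into the block of `i`, with a bar if `b`. -/
def mergeCode (f : BarredSet n → BarredSet n ⊕ S) (i j : Fin n) (b : Bool) (a : BarredSet n) :
    BarredSet n ⊕ S :=
  Sum.elim (fun c => if c.1 = j then Sum.inl (i, b ^^ c.2) else Sum.inl c) Sum.inr (f a)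

/-- The code after the block of `i` has been merged into the block of sign `σ`. -/
def signCode (f : BarredSet n → BarredSet n ⊕ S) (i : Fin n) (σ : S) (a : BarredSet n) :
    BarredSet n ⊕ S :=
  Sum.elim (fun c => if c.1 = i then Sum.inr σ else Sum.inl c) Sum.inr (f a)

theorem mergeCode_of_inr {f : BarredSet n → BarredSet n ⊕ S} {i j : Fin n} {b : Bool}
    {a : BarredSet n} {σ : S} (h : f a = Sum.inr σ) : mergeCode f i j b a = Sum.inr σ := by
  simp [mergeCode, h]

theorem mergeCode_of_inl {f : BarredSet n → BarredSet n ⊕ S} {i j : Fin n} {b : Bool}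
    {a c : BarredSet n} (h : f a = Sum.inl c) :
    mergeCode f i j b a = if c.1 = j then Sum.inl (i, b ^^ c.2) else Sum.inl c := by
  simp [mergeCode, h]

theorem signCode_of_inr {f : BarredSet n → BarredSet n ⊕ S} {i : Fin n} {τ : S}
    {a : BarredSet n} {σ : S} (h : f a = Sum.inr σ) : signCode f i τ a = Sum.inr σ := by
  simp [signCode, h]

theorem signCode_of_inl {f : BarredSet n → BarredSet n ⊕ S} {i : Fin n} {σ : S}
    {a c : BarredSet n} (h : f a = Sum.inl c) :
    signCode f i σ a = if c.1 = i then Sum.inr σ else Sum.inl c := by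
  simp [signCode, h]

theorem isCode_mergeCode (x : LabeledPartition n S) {i j : Fin n} (hi : i ∈ x.reps) (hij : i < j)
    (b : Bool) : IsCode (mergeCode x.code i j b) where
  bar a := by
    rcases h : x.code a with c | σ
    · have h' : x.code (barElt a) = Sum.inl (barElt c) := by rw [x.isCode_code.bar, h]; rfl
      rw [mergeCode_of_inl h, mergeCode_of_inl h']
      by_cases hc : c.1 = j <;> simp [barElt, hc]
    · have h' : x.code (barElt a) = Sum.inr σ := by rw [x.isCode_code.bar, h]; rfl
      rw [mergeCode_of_inr h, mergeCode_of_inr h']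
      rfl
  self a c h := by
    rcases hd : x.code a with d | σ
    · rw [mergeCode_of_inl hd] at h
      split_ifs at h with hdj
      · obtain rfl := Sum.inl.inj h
        rw [mergeCode_of_inl (code_of_mem_reps hi _), if_neg hij.ne]
      · obtain rfl := Sum.inl.inj h
        rw [mergeCode_of_inl (x.isCode_code.self _ _ hd), if_neg hdj]
    · rw [mergeCode_of_inr hd] at h
      simp at h
  le a c h := by
    rcases hd : x.code a with d | σ
    · have hle := x.isCode_code.le _ _ hd
      rw [mergeCode_of_inl hd] at h
      split_ifs at h with hdj
      · obtain rfl := Sum.inl.inj h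
        exact (hij.le.trans hdj.ge).trans hle
      · obtain rfl := Sum.inl.inj h
        exact hle
    · rw [mergeCode_of_inr hd] at h
      simp at h

theorem isCode_signCode (x : LabeledPartition n S) (i : Fin n) (σ : S) :
    IsCode (signCode x.code i σ) where
  bar a := by
    rcases h : x.code a with c | τ
    · have h' : x.code (barElt a) = Sum.inl (barElt c) := by rw [x.isCode_code.bar, h]; rfl
      rw [signCode_of_inl h, signCode_of_inl h']
      by_cases hc : c.1 = i <;> simp [barElt, hc]
    · have h' : x.code (barElt a) = Sum.inr τ := by rw [x.isCode_code.bar, h]; rfl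
      rw [signCode_of_inr h, signCode_of_inr h']
      rfl
  self a c h := by
    rcases hd : x.code a with d | τ
    · rw [signCode_of_inl hd] at h
      split_ifs at h with hdi
      obtain rfl := Sum.inl.inj h
      rw [signCode_of_inl (x.isCode_code.self _ _ hd), if_neg hdi]
    · rw [signCode_of_inr hd] at h
      simp at h
  le a c h := by
    rcases hd : x.code a with d | τ
    · rw [signCode_of_inl hd] at h
      split_ifs at h with hdi
      obtain rfl := Sum.inl.inj h
      exact x.isCode_code.le _ _ hd
    · rw [signCode_of_inr hd] at h
      simp at h

open scoped Classical in
/-- Merge the block of `j` into the block of `i`, with a bar if `b`. -/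
noncomputable def merge (x : LabeledPartition n S) (i j : Fin n) (b : Bool) :
    LabeledPartition n S :=
  if h : IsCode (mergeCode x.code i j b) then ofCode _ h else x

/-- Merge the block of `i` and its barred copy into the block of sign `σ`. -/
noncomputable def signMove (x : LabeledPartition n S) (i : Fin n) (σ : S) :
    LabeledPartition n S :=
  ofCode _ (x.isCode_signCode i σ)

theorem code_merge (x : LabeledPartition n S) {i j : Fin n} (hi : i ∈ x.reps) (hij : i < j)
    (b : Bool) : (x.merge i j b).code = mergeCode x.code i j b := by
  rw [merge, dif_pos (x.isCode_mergeCode hi hij b), code_ofCode]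

theorem code_signMove (x : LabeledPartition n S) (i : Fin n) (σ : S) :
    (x.signMove i σ).code = signCode x.code i σ := by
  rw [signMove, code_ofCode]

section merge

variable {x : LabeledPartition n S} {i j : Fin n} {b : Bool}

theorem code_merge_eq_inr (hi : i ∈ x.reps) (hij : i < j) {a : BarredSet n} {σ : S} :
    (x.merge i j b).code a = Sum.inr σ ↔ x.code a = Sum.inr σ := by
  rw [code_merge x hi hij]
  rcases h : x.code a with c | τ
  · rw [mergeCode_of_inl h]
    split_ifs <;> simp
  · rw [mergeCode_of_inr h]

theorem signed_merge (hi : i ∈ x.reps) (hij : i < j) (σ : S) :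
    (x.merge i j b).signed σ = x.signed σ := by
  ext a
  rw [← code_eq_inr, ← code_eq_inr, code_merge_eq_inr hi hij]

theorem reps_merge (hi : i ∈ x.reps) (hij : i < j) :
    (x.merge i j b).reps = x.reps.erase j := by
  ext k
  rw [Finset.mem_erase, mem_reps, code_merge x hi hij]
  constructor
  · intro h
    rcases hc : x.code (k, false) with c | σ
    · rw [mergeCode_of_inl hc] at h
      split_ifs at h with hcj
      · obtain ⟨rfl, -⟩ := Prod.mk.inj (Sum.inl.inj h)
        rw [code_of_mem_reps hi] at hc
        obtain rfl := Sum.inl.inj hc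
        exact absurd hcj hij.ne
      · obtain rfl := Sum.inl.inj h
        exact ⟨hcj, mem_reps.2 hc⟩
    · rw [mergeCode_of_inr hc] at h
      simp at h
  · rintro ⟨hkj, hk⟩
    rw [mergeCode_of_inl (mem_reps.1 hk), if_neg hkj]

theorem singles_merge (hi : i ∈ x.reps) (hj : j ∈ x.reps) (hij : i < j) :
    (x.merge i j b).singles = (x.singles.erase j).erase i := by
  ext k
  simp only [Finset.mem_erase, mem_singles, reps_merge hi hij, code_merge x hi hij]
  constructor
  · rintro ⟨⟨hkj, hk⟩, h⟩
    have hki : k ≠ i := by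
      rintro rfl
      have := h (j, false) (k, b)
        (by rw [mergeCode_of_inl (mem_reps.1 hj), if_pos rfl, Bool.xor_false]) rfl
      exact hkj this.symm
    refine ⟨hki, hkj, hk, fun a c hc hck => h a c ?_ hck⟩
    rw [mergeCode_of_inl hc, if_neg (hck ▸ hkj)]
  · rintro ⟨hki, hkj, hk, h⟩
    refine ⟨⟨hkj, hk⟩, fun a c hc hck => ?_⟩
    rcases hd : x.code a with d | σ
    · rw [mergeCode_of_inl hd] at hc
      split_ifs at hc
      · obtain rfl := Sum.inl.inj hc
        exact absurd hck.symm hki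
      · obtain rfl := Sum.inl.inj hc
        exact h a _ hd hck
    · rw [mergeCode_of_inr hd] at hc
      simp at hc

theorem le_merge (hi : i ∈ x.reps) (hij : i < j) : x ≤ x.merge i j b := by
  rw [le_iff_code, code_merge x hi hij]
  intro a
  rcases hc : x.code a with c | σ
  · rw [mergeCode_of_inl hc, Sum.elim_inl, mergeCode_of_inl (x.isCode_code.self _ _ hc)]
  · rw [mergeCode_of_inr hc, Sum.elim_inr]

theorem merge_le {y : LabeledPartition n S} (hi : i ∈ x.reps) (hij : i < j) (hxy : x ≤ y)
    (h : y.code (j, false) = y.code (i, b)) : x.merge i j b ≤ y := by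
  rw [le_iff_code, code_merge x hi hij]
  intro a
  rw [le_iff_code.1 hxy a]
  rcases hc : x.code a with c | σ
  · rw [mergeCode_of_inl hc]
    split_ifs with hcj
    · obtain ⟨k, s⟩ := c
      obtain rfl : k = j := hcj
      rw [Sum.elim_inl, Sum.elim_inl]
      cases s
      · simpa using h
      · have := congrArg (Sum.map barElt id) h
        rw [← y.isCode_code.bar, ← y.isCode_code.bar] at this
        simpa [barElt] using this
    · rfl
  · rw [mergeCode_of_inr hc, Sum.elim_inr]

end merge

section signMove

variable {x : LabeledPartition n S} {i : Fin n} {σ : S}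

theorem mem_signed_signMove {a : BarredSet n} {τ : S} :
    a ∈ (x.signMove i σ).signed τ ↔
      a ∈ x.signed τ ∨ τ = σ ∧ ∃ c, x.code a = Sum.inl c ∧ c.1 = i := by
  rw [← code_eq_inr, ← code_eq_inr, code_signMove]
  rcases h : x.code a with c | ρ
  · rw [signCode_of_inl h]
    split_ifs with hc
    · simp [hc, eq_comm]
    · simp [hc]
  · rw [signCode_of_inr h]
    simp

theorem reps_signMove : (x.signMove i σ).reps = x.reps.erase i := by
  ext k
  rw [Finset.mem_erase, mem_reps, code_signMove]
  constructor
  · intro h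
    rcases hc : x.code (k, false) with c | τ
    · rw [signCode_of_inl hc] at h
      split_ifs at h with hci
      obtain rfl := Sum.inl.inj h
      exact ⟨hci, mem_reps.2 hc⟩
    · rw [signCode_of_inr hc] at h
      simp at h
  · rintro ⟨hki, hk⟩
    rw [signCode_of_inl (mem_reps.1 hk), if_neg hki]

theorem singles_signMove : (x.signMove i σ).singles = x.singles.erase i := by
  ext k
  simp only [Finset.mem_erase, mem_singles, reps_signMove, code_signMove]
  constructor
  · rintro ⟨⟨hki, hk⟩, h⟩
    refine ⟨hki, hk, fun a c hc hck => h a c ?_ hck⟩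
    rw [signCode_of_inl hc, if_neg (hck ▸ hki)]
  · rintro ⟨hki, hk, h⟩
    refine ⟨⟨hki, hk⟩, fun a c hc hck => ?_⟩
    rcases hd : x.code a with d | τ
    · rw [signCode_of_inl hd] at hc
      split_ifs at hc
      obtain rfl := Sum.inl.inj hc
      exact h a _ hd hck
    · rw [signCode_of_inr hd] at hc
      simp at hc

theorem le_signMove : x ≤ x.signMove i σ := by
  rw [le_iff_code, code_signMove]
  intro a
  rcases hc : x.code a with c | τ
  · rw [signCode_of_inl hc, Sum.elim_inl, signCode_of_inl (x.isCode_code.self _ _ hc)]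
  · rw [signCode_of_inr hc, Sum.elim_inr]

theorem signMove_le {y : LabeledPartition n S} (hxy : x ≤ y)
    (h : y.code (i, false) = Sum.inr σ) : x.signMove i σ ≤ y := by
  rw [le_iff_code, code_signMove]
  intro a
  rw [le_iff_code.1 hxy a]
  rcases hc : x.code a with c | τ
  · rw [signCode_of_inl hc]
    split_ifs with hci
    · exact y.isCode_code.eq_inr_of_fst_eq h hci
    · rfl
  · rw [signCode_of_inr hc, Sum.elim_inr]

end signMove

/-! ### The condition of type `D` -/

/-- No signed block has exactly two elements. -/
def IsD (x : LabeledPartition n S) : Prop := ∀ σ, (x.signed σ).card ≠ 2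

/-- Signed blocks are closed under the bar, so two elements means exactly one index. -/
theorem isD_iff {x : LabeledPartition n S} :
    x.IsD ↔ ∀ σ, ∀ a ∈ x.signed σ, ∃ b ∈ x.signed σ, b.1 ≠ a.1 := by
  have hbar : ∀ σ, ∀ a ∈ x.signed σ, barElt a ∈ x.signed σ := fun σ a ha =>
    x.code_eq_inr.1 (x.isCode_code.eq_inr_of_fst_eq (x.code_eq_inr.2 ha) rfl)
  constructor
  · intro h σ a ha
    by_contra! hall
    refine h σ (Finset.card_eq_two.2 ⟨a, barElt a, (barElt_ne a).symm, ?_⟩)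
    ext b
    rw [Finset.mem_insert, Finset.mem_singleton]
    constructor
    · exact fun hb => eq_or_eq_barElt (hall b hb)
    · rintro (rfl | rfl)
      · exact ha
      · exact hbar σ a ha
  · intro h σ hc
    obtain ⟨a, ha⟩ := Finset.card_pos.1 (by omega : 0 < (x.signed σ).card)
    obtain ⟨b, hb, hne⟩ := h σ a ha
    have hsub : ({b, a, barElt a} : Finset (BarredSet n)) ⊆ x.signed σ := by
      intro d hd
      simp only [Finset.mem_insert, Finset.mem_singleton] at hd
      rcases hd with rfl | rfl | rfl
      · exact hb
      · exact ha
      · exact hbar σ a ha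
    have := Finset.card_le_card hsub
    rw [Finset.card_insert_of_notMem, Finset.card_pair (barElt_ne a).symm] at this
    · omega
    · simp only [Finset.mem_insert, Finset.mem_singleton, not_or]
      exact ⟨fun h => hne (h ▸ rfl), fun h => hne (h ▸ rfl)⟩

theorem isD_merge {x : LabeledPartition n S} {i j : Fin n} {b : Bool} (hx : x.IsD)
    (hi : i ∈ x.reps) (hij : i < j) : (x.merge i j b).IsD := by
  intro σ
  rw [signed_merge hi hij]
  exact hx σ

/-- The block of `i` can be merged into the block of sign `σ` within the poset of type `D`. -/
def CanSign (x : LabeledPartition n S) (i : Fin n) (σ : S) : Prop :=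
  (x.signed σ).Nonempty ∨ i ∉ x.singles

theorem isD_signMove {x : LabeledPartition n S} {i : Fin n} {σ : S} (hx : x.IsD)
    (hi : i ∈ x.reps) (h : x.CanSign i σ) : (x.signMove i σ).IsD := by
  rw [isD_iff] at hx ⊢
  intro τ a ha
  rw [mem_signed_signMove] at ha
  rcases ha with ha | ⟨rfl, c, hc, rfl⟩
  · obtain ⟨b, hb, hne⟩ := hx τ a ha
    exact ⟨b, mem_signed_signMove.2 (Or.inl hb), hne⟩
  · rcases h with ⟨b, hb⟩ | h
    · by_cases hne : b.1 = a.1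
      · obtain ⟨d, hd, hdne⟩ := hx τ b hb
        exact ⟨d, mem_signed_signMove.2 (Or.inl hd), hne ▸ hdne⟩
      · exact ⟨b, mem_signed_signMove.2 (Or.inl hb), hne⟩
    · rw [mem_singles, not_and] at h
      have := h hi
      push Not at this
      obtain ⟨b, d, hd, hdc, hne⟩ := this
      by_cases hba : b.1 = a.1
      · refine ⟨c, mem_signed_signMove.2 (Or.inr ⟨rfl, c, x.isCode_code.self _ _ hc, rfl⟩), ?_⟩
        rw [← hba]
        exact hne.symm
      · exact ⟨b, mem_signed_signMove.2 (Or.inr ⟨rfl, d, hd, hdc⟩), hba⟩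

theorem mem_sdiff_singles_iff {x : LabeledPartition n S} {ρ : S} (h : x.signed ρ = ∅) (i : Fin n) :
    i ∈ x.reps \ x.singles ↔ i ∈ x.reps ∧ x.CanSign i ρ := by
  simp [CanSign, h]

theorem exists_merge_le_of_code_eq {x y : LabeledPartition n S} (hxy : x ≤ y) {i j : Fin n}
    {s t : Bool} (hi : i ∈ x.reps) (hj : j ∈ x.reps) (hij : i ≠ j)
    (h : y.code (i, s) = y.code (j, t)) :
    ∃ i ∈ x.reps, ∃ j ∈ x.reps, i < j ∧ ∃ b, x.merge i j b ≤ y := by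
  rcases hij.lt_or_gt with hlt | hlt
  · exact ⟨i, hi, j, hj, hlt, _, merge_le hi hlt hxy (y.isCode_code.eq_shift h)⟩
  · exact ⟨j, hj, i, hi, hlt, _, merge_le hj hlt hxy (y.isCode_code.eq_shift h.symm)⟩

/-- Makes the moves generate the order: every strict relation factors through an admissible move,
and hence lowers the number of representatives. -/
theorem exists_move_le {x y : LabeledPartition n S} (hxy : x < y) (hy : y.IsD) :
    (∃ i ∈ x.reps, ∃ j ∈ x.reps, i < j ∧ ∃ b, x.merge i j b ≤ y) ∨
      ∃ i ∈ x.reps, ∃ σ, x.CanSign i σ ∧ x.signMove i σ ≤ y := by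
  have hle := le_iff_code.1 hxy.le
  by_cases hs : ∃ a σ, y.code a = Sum.inr σ ∧ x.code a ≠ Sum.inr σ
  · obtain ⟨a, σ, hya, hxa⟩ := hs
    rcases hc : x.code a with c | τ
    swap
    · have := hle a
      rw [hc, hya, Sum.elim_inr] at this
      exact absurd (hc.trans this.symm) hxa
    have hyc : y.code c = Sum.inr σ := by
      have := hle a
      rw [hc, hya, Sum.elim_inl] at this
      exact this.symm
    have hi := fst_mem_reps hc
    by_cases hcan : x.CanSign c.1 σ
    · exact Or.inr ⟨c.1, hi, σ, hcan,
        signMove_le hxy.le (y.isCode_code.eq_inr_of_fst_eq hyc rfl)⟩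
    -- The sign move fails only for a singleton and an unused sign. As `y` is of type D, its block
    -- of that sign contains a further index, and the two unsigned blocks of `x` can be merged
    -- first.
    · left
      rw [CanSign, not_or, not_not, Finset.not_nonempty_iff_eq_empty, mem_singles] at hcan
      obtain ⟨hempty, -, hsingle⟩ := hcan
      obtain ⟨b, hb, hne⟩ := isD_iff.1 hy σ c (y.code_eq_inr.1 hyc)
      have hyb := y.code_eq_inr.2 hb
      rcases hd : x.code b with d | τ
      swap
      · have := hle b
        rw [hd, hyb, Sum.elim_inr] at this
        obtain rfl := Sum.inr.inj this
        have := x.code_eq_inr.1 hd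
        simp [hempty] at this
      have hyd : y.code d = Sum.inr σ := by
        have := hle b
        rw [hd, hyb, Sum.elim_inl] at this
        exact this.symm
      exact exists_merge_le_of_code_eq (s := c.2) (t := d.2) hxy.le hi (fst_mem_reps hd)
        (fun h => hne (hsingle b d hd h.symm)) (hyc.trans hyd.symm)
  · push Not at hs
    left
    -- No element becomes signed, so some first element changes: the old first element of `a` and
    -- the first element in `x` of its new one represent two blocks merged in `y`.
    obtain ⟨a, ha⟩ : ∃ a, x.code a ≠ y.code a := by
      by_contra! h
      exact hxy.ne (eq_of_code_eq (funext h))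
    have hla := hle a
    rcases hc : x.code a with c | τ
    swap
    · rw [hc, Sum.elim_inr] at hla
      exact absurd (hc.trans hla.symm) ha
    rcases hd : y.code a with d | τ
    swap
    · exact absurd ((hs a τ hd).trans hd.symm) ha
    rw [hc, hd, Sum.elim_inl] at hla
    have hdd := y.isCode_code.self _ _ hd
    have hld := hle d
    rcases he : x.code d with e | τ
    swap
    · rw [he, hdd] at hld
      simp at hld
    rw [he, hdd, Sum.elim_inl] at hld
    refine exists_merge_le_of_code_eq (s := c.2) (t := e.2) hxy.le (fst_mem_reps hc)
      (fst_mem_reps he) (fun hce => ?_) (hla.symm.trans hld)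
    rcases eq_or_eq_barElt hce with rfl | rfl
    · refine ha ?_
      rw [hc, hd, y.isCode_code.eq_of_fst_eq hla.symm
        (le_antisymm (y.isCode_code.le _ _ hla.symm) (x.isCode_code.le _ _ he))]
    · rw [y.isCode_code.bar, ← hld] at hla
      exact barElt_ne d (Sum.inl.inj hla).symm

theorem reps_ssubset {x y : LabeledPartition n S} (hxy : x < y) (hy : y.IsD) :
    y.reps ⊂ x.reps := by
  rcases exists_move_le hxy hy with ⟨i, hi, j, hj, hij, b, h⟩ | ⟨i, hi, σ, -, h⟩
  · refine (reps_subset_of_le h).trans_ssubset ?_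
    rw [reps_merge hi hij]
    exact Finset.erase_ssubset hj
  · refine (reps_subset_of_le h).trans_ssubset ?_
    rw [reps_signMove]
    exact Finset.erase_ssubset hi

theorem lt_merge {x : LabeledPartition n S} {i j : Fin n} {b : Bool} (hi : i ∈ x.reps)
    (hj : j ∈ x.reps) (hij : i < j) : x < x.merge i j b := by
  refine (le_merge hi hij).lt_of_ne fun h => ?_
  have := reps_merge (b := b) hi hij
  rw [← h] at this
  exact Finset.notMem_erase j _ (this ▸ hj)

theorem lt_signMove {x : LabeledPartition n S} {i : Fin n} {σ : S} (hi : i ∈ x.reps) :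
    x < x.signMove i σ := by
  refine le_signMove.lt_of_ne fun h => ?_
  have := reps_signMove (x := x) (i := i) (σ := σ)
  rw [← h] at this
  exact Finset.notMem_erase i _ (this ▸ hi)

/-- Only a singleton with no sign in use is stuck. As n ≥ 2, another index then lies in another
unsigned block, with which it can merge. So 1̂ covers only elements without unsigned blocks. -/
theorem exists_move (hn : 2 ≤ n) {x : LabeledPartition n S} (σ₀ : S) (hx : x.reps.Nonempty) :
    (∃ i ∈ x.reps, ∃ j ∈ x.reps, i < j) ∨ ∃ i ∈ x.reps, ∃ σ, x.CanSign i σ := by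
  obtain ⟨i, hi⟩ := hx
  by_cases hs : ∃ σ, x.CanSign i σ
  · exact Or.inr ⟨i, hi, hs⟩
  · left
    simp only [CanSign, not_exists, not_or, not_not, Finset.not_nonempty_iff_eq_empty] at hs
    have hsi := (mem_singles.1 (hs σ₀).2).2
    have : Nontrivial (Fin n) := Fin.nontrivial_iff_two_le.2 hn
    obtain ⟨k, hk⟩ := exists_ne i
    rcases hc : x.code (k, false) with c | σ
    · have hci : c.1 ≠ i := fun h => hk (hsi _ _ hc h)
      rcases hci.lt_or_gt with h | h
      · exact ⟨_, fst_mem_reps hc, _, hi, h⟩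
      · exact ⟨_, hi, _, fst_mem_reps hc, h⟩
    · have := x.code_eq_inr.1 hc
      simp [(hs σ).1] at this

end LabeledPartition

/-! ### Covers in the poset of type `D` -/

namespace TypeD

open LabeledPartition

variable {n : ℕ} {S : Type*}

open scoped Classical in
/-- A labeled partition as an element of the poset of type `D`, if possible. -/
noncomputable def ofPartition (x : LabeledPartition n S) : TypeD n S :=
  if h : x.IsD then
    ⟨(x : LabeledPartitionPoset n S), fun _ hp => WithTop.coe_injective hp ▸ h⟩
  else oneHat n S

theorem val_ofPartition {x : LabeledPartition n S} (hx : x.IsD) :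
    (ofPartition x).1 = (x : LabeledPartitionPoset n S) := by
  rw [ofPartition, dif_pos hx]

theorem eq_oneHat_or (z : TypeD n S) : z = oneHat n S ∨ ∃ x, IsD x ∧ z = ofPartition x := by
  obtain ⟨z, hz⟩ := z
  cases z using WithTop.recTopCoe with
  | top => exact Or.inl rfl
  | coe x =>
    refine Or.inr ⟨x, hz x rfl, Subtype.ext ?_⟩
    rw [val_ofPartition (hz x rfl)]

theorem ofPartition_lt_iff {x y : LabeledPartition n S} (hx : x.IsD) (hy : y.IsD) :
    ofPartition x < ofPartition y ↔ x < y := by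
  rw [← Subtype.coe_lt_coe, val_ofPartition hx, val_ofPartition hy, WithTop.coe_lt_coe]

theorem ofPartition_inj {x y : LabeledPartition n S} (hx : x.IsD) (hy : y.IsD) :
    ofPartition x = ofPartition y ↔ x = y := by
  rw [Subtype.ext_iff, val_ofPartition hx, val_ofPartition hy, WithTop.coe_inj]

theorem ofPartition_merge_ne {x : LabeledPartition n S} (hx : x.IsD) {t j k : Fin n} {b : Bool} (ht : t ∈ x.reps)
    (hj : j ∈ x.reps) (htj : t < j) (htk : t < k) (hjk : j ≠ k) :
    ofPartition (x.merge t j b) ≠ ofPartition (x.merge t k b) := by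
  rw [Ne, ofPartition_inj (isD_merge hx ht htj) (isD_merge hx ht htk)]
  intro h
  have h1 := reps_merge (b := b) ht htj
  rw [h, reps_merge ht htk] at h1
  exact Finset.notMem_erase j _ (h1 ▸ Finset.mem_erase.2 ⟨hjk, hj⟩)

theorem ofPartition_lt_oneHat {x : LabeledPartition n S} (hx : x.IsD) :
    ofPartition x < oneHat n S := by
  rw [← Subtype.coe_lt_coe, val_ofPartition hx]
  exact WithTop.coe_lt_top x

theorem ofPartition_ne_oneHat {x : LabeledPartition n S} (hx : x.IsD) :
    ofPartition x ≠ oneHat n S := (ofPartition_lt_oneHat hx).ne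

theorem le_oneHat (z : TypeD n S) : z ≤ oneHat n S := by
  rw [← Subtype.coe_le_coe]
  exact le_top

theorem not_oneHat_covBy (y : TypeD n S) : ¬ oneHat n S ⋖ y :=
  fun h => (le_oneHat y).not_gt h.lt

/-- The number of representatives drops at each strict step, so a drop by at most one leaves no room
in between. -/
theorem covBy_of_card {x y : LabeledPartition n S} (hx : x.IsD) (hy : y.IsD) (h : x < y)
    (hc : x.reps.card ≤ y.reps.card + 1) : ofPartition x ⋖ ofPartition y := by
  refine ⟨(ofPartition_lt_iff hx hy).2 h, fun z h1 h2 => ?_⟩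
  rcases eq_oneHat_or z with rfl | ⟨z, hz, rfl⟩
  · exact (le_oneHat _).not_gt h2
  · rw [ofPartition_lt_iff hx hz] at h1
    rw [ofPartition_lt_iff hz hy] at h2
    have h3 := Finset.card_lt_card (reps_ssubset h1 hz)
    have h4 := Finset.card_lt_card (reps_ssubset h2 hy)
    omega

theorem ofPartition_covBy_iff (hn : 2 ≤ n) (σ₀ : S) {x : LabeledPartition n S} (hx : x.IsD)
    {z : TypeD n S} :
    ofPartition x ⋖ z ↔
      (∃ i ∈ x.reps, ∃ j ∈ x.reps, i < j ∧ ∃ b, z = ofPartition (x.merge i j b)) ∨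
      (∃ i ∈ x.reps, ∃ σ, x.CanSign i σ ∧ z = ofPartition (x.signMove i σ)) ∨
      x.reps = ∅ ∧ z = oneHat n S := by
  constructor
  · intro h
    rcases eq_oneHat_or z with rfl | ⟨y, hy, rfl⟩
    · refine Or.inr (Or.inr ⟨?_, rfl⟩)
      by_contra hne
      rcases exists_move hn σ₀ (Finset.nonempty_iff_ne_empty.2 hne) with
        ⟨i, hi, j, hj, hij⟩ | ⟨i, hi, σ, hs⟩
      · have hm := isD_merge (b := false) hx hi hij
        exact h.2 ((ofPartition_lt_iff hx hm).2 (lt_merge hi hj hij)) (ofPartition_lt_oneHat hm)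
      · have hm := isD_signMove hx hi hs
        exact h.2 ((ofPartition_lt_iff hx hm).2 (lt_signMove hi)) (ofPartition_lt_oneHat hm)
    · have hlt := (ofPartition_lt_iff hx hy).1 h.lt
      rcases exists_move_le hlt hy with ⟨i, hi, j, hj, hij, b, hle⟩ | ⟨i, hi, σ, hs, hle⟩
      · have hm := isD_merge (b := b) hx hi hij
        refine Or.inl ⟨i, hi, j, hj, hij, b, ?_⟩
        rcases hle.eq_or_lt with rfl | hlt'
        · rfl
        · exact absurd ((ofPartition_lt_iff hm hy).2 hlt')
            (h.2 ((ofPartition_lt_iff hx hm).2 (lt_merge hi hj hij)))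
      · have hm := isD_signMove hx hi hs
        refine Or.inr (Or.inl ⟨i, hi, σ, hs, ?_⟩)
        rcases hle.eq_or_lt with rfl | hlt'
        · rfl
        · exact absurd ((ofPartition_lt_iff hm hy).2 hlt')
            (h.2 ((ofPartition_lt_iff hx hm).2 (lt_signMove hi)))
  · rintro (⟨i, hi, j, hj, hij, b, rfl⟩ | ⟨i, hi, σ, hs, rfl⟩ | ⟨hr, rfl⟩)
    · refine covBy_of_card hx (isD_merge hx hi hij) (lt_merge hi hj hij) ?_
      rw [reps_merge hi hij, Finset.card_erase_add_one hj]
    · refine covBy_of_card hx (isD_signMove hx hi hs) (lt_signMove hi) ?_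
      rw [reps_signMove, Finset.card_erase_add_one hi]
    · refine ⟨ofPartition_lt_oneHat hx, fun z h1 h2 => ?_⟩
      rcases eq_oneHat_or z with rfl | ⟨y, hy, rfl⟩
      · exact lt_irrefl _ h2
      · have := reps_ssubset ((ofPartition_lt_iff hx hy).1 h1) hy
        rw [hr] at this
        exact Finset.not_ssubset_empty _ this

end TypeD

/-! ### The labels of the moves -/

namespace LabeledPartition

variable {n : ℕ} {S : Type*} {x : LabeledPartition n S}

theorem blockRep_le {R : Finset (BarredSet n)} {a : BarredSet n} (ha : a ∈ R) :
    blockRep R ≤ (a.1 : ℕ) + 1 :=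
  Nat.sInf_le ⟨a, ha, rfl⟩

theorem mem_part_iff_code {a b : BarredSet n} :
    a ∈ x.partition.part b ↔ x.code a = x.code b := by
  rw [mem_part_iff, code_eq_code]

theorem blockRep_part {i : Fin n} (hi : i ∈ x.reps) :
    blockRep (x.partition.part (i, false)) = (i : ℕ) + 1 := by
  refine le_antisymm (blockRep_le (x.mem_part (i, false))) ?_
  refine le_csInf ⟨(i : ℕ) + 1, (i, false), x.mem_part _, rfl⟩ ?_
  rintro m ⟨a, ha, rfl⟩
  have := (x.code_eq_inl (mem_reps.1 hi)).2.2 a ha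
  exact Nat.succ_le_succ this

theorem isUnsigned_part {i : Fin n} (hi : i ∈ x.reps) :
    x.IsUnsigned (x.partition.part (i, false)) := by
  refine ⟨x.part_mem _, fun σ h => ?_⟩
  exact (x.code_eq_inl (mem_reps.1 hi)).1 σ (h ▸ x.mem_part _)

theorem isNormalized_part {i : Fin n} (hi : i ∈ x.reps) :
    IsNormalized (x.partition.part (i, false)) :=
  ⟨i, x.mem_part _, (blockRep_part hi).symm⟩

theorem exists_rep_of_isNormalized {R : Finset (BarredSet n)} (hR : x.IsUnsigned R)
    (hR' : IsNormalized R) : ∃ i ∈ x.reps, R = x.partition.part (i, false) := by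
  obtain ⟨i, hi, hrep⟩ := hR'
  have hpart := x.partition.part_eq_of_mem hR.1 hi
  refine ⟨i, ?_, hpart.symm⟩
  rcases hc : x.code (i, false) with c | σ
  · obtain ⟨-, h1, -⟩ := x.code_eq_inl hc
    rw [hpart] at h1
    have h2 := blockRep_le h1
    have h3 := x.isCode_code.le _ _ hc
    have h4 : c.1 = i := le_antisymm h3 (by rw [Fin.le_def]; omega)
    rw [mem_reps, hc, x.isCode_code.eq_of_fst_eq hc h4]
  · exact absurd ((x.part_eq_signed (x.code_eq_inr.1 hc)).symm.trans hpart) (hR.2 σ)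

theorem barSet_part (a : BarredSet n) :
    barSet (x.partition.part a) = x.partition.part (barElt a) := (x.part_barElt a).symm

theorem code_eq_of_union_mem {y : LabeledPartition n S} {a b : BarredSet n}
    (h : x.partition.part a ∪ x.partition.part b ∈ y.partition.parts) : y.code a = y.code b := by
  rw [code_eq_code, y.partition.part_eq_of_mem h (Finset.mem_union_left _ (x.mem_part a)),
    y.partition.part_eq_of_mem h (Finset.mem_union_right _ (x.mem_part b))]

theorem CoherentAt.exists_reps {y : LabeledPartition n S} {R R' : Finset (BarredSet n)}
    (h : x.CoherentAt y R R') : ∃ p ∈ x.reps, ∃ q ∈ x.reps, p ≠ q ∧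
      y.code (p, false) = y.code (q, false) := by
  obtain ⟨h1, h2, h3, h4, hne, hmem⟩ := h
  obtain ⟨p, hp, rfl⟩ := exists_rep_of_isNormalized h1 h2
  obtain ⟨q, hq, rfl⟩ := exists_rep_of_isNormalized h3 h4
  exact ⟨p, hp, q, hq, fun h => hne (by rw [h]), code_eq_of_union_mem hmem⟩

theorem NonCoherentAt.exists_reps {y : LabeledPartition n S} {R R' : Finset (BarredSet n)}
    (h : x.NonCoherentAt y R R') : ∃ p ∈ x.reps, ∃ q ∈ x.reps, p ≠ q ∧
      y.code (p, false) = y.code (q, true) ∧ blockRep R = p + 1 ∧ blockRep R' = q + 1 := by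
  obtain ⟨h1, h2, h3, h4, hne, hmem⟩ := h
  obtain ⟨p, hp, rfl⟩ := exists_rep_of_isNormalized h1 h2
  obtain ⟨q, hq, rfl⟩ := exists_rep_of_isNormalized h3 h4
  rw [barSet_part] at hmem
  exact ⟨p, hp, q, hq, fun h => hne (by rw [h]), code_eq_of_union_mem hmem, blockRep_part hp,
    blockRep_part hq⟩

theorem union_mem_merge {i j : Fin n} {b : Bool} (hi : i ∈ x.reps) (hj : j ∈ x.reps)
    (hij : i < j) :
    x.partition.part (i, false) ∪ x.partition.part (j, b) ∈ (x.merge i j b).partition.parts := by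
  rw [Finpartition.mem_parts_iff_exists_part]
  refine ⟨(i, false), ?_⟩
  ext a
  rw [Finset.mem_union, mem_part_iff_code, mem_part_iff_code, mem_part_iff_code,
    code_merge x hi hij, mergeCode_of_inl (mem_reps.1 hi), if_neg hij.ne, code_of_mem_reps hi,
    code_of_mem_reps hj]
  rcases h : x.code a with c | σ
  · rw [mergeCode_of_inl h]
    have hci : c.1 = j → c ≠ (i, false) := fun h1 h2 => hij.ne (by rw [← h1, h2])
    split_ifs with hcj
    · obtain ⟨k, s⟩ := c
      obtain rfl : k = j := hcj
      cases b <;> cases s <;> simp [hij.ne']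
    · have : c ≠ (j, b) := fun h => hcj (h ▸ rfl)
      simp [this]
  · rw [mergeCode_of_inr h]
    simp

theorem coherentAt_merge {i j : Fin n} (hi : i ∈ x.reps) (hj : j ∈ x.reps) (hij : i < j) :
    x.CoherentAt (x.merge i j false) (x.partition.part (i, false))
      (x.partition.part (j, false)) := by
  refine ⟨isUnsigned_part hi, isNormalized_part hi, isUnsigned_part hj, isNormalized_part hj,
    fun h => ?_, union_mem_merge hi hj hij⟩
  rw [← code_eq_code, code_of_mem_reps hi, code_of_mem_reps hj] at h
  exact hij.ne (Prod.mk.inj (Sum.inl.inj h)).1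

theorem nonCoherentAt_merge {i j : Fin n} (hi : i ∈ x.reps) (hj : j ∈ x.reps) (hij : i < j) :
    x.NonCoherentAt (x.merge i j true) (x.partition.part (i, false))
      (x.partition.part (j, false)) := by
  refine ⟨isUnsigned_part hi, isNormalized_part hi, isUnsigned_part hj, isNormalized_part hj,
    fun h => ?_, ?_⟩
  · rw [← code_eq_code, code_of_mem_reps hi, code_of_mem_reps hj] at h
    exact hij.ne (Prod.mk.inj (Sum.inl.inj h)).1
  · rw [barSet_part]
    exact union_mem_merge hi hj hij

theorem code_merge_rep {i j p : Fin n} {b s : Bool} (hi : i ∈ x.reps) (hij : i < j)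
    (hp : p ∈ x.reps) :
    (x.merge i j b).code (p, s) =
      if p = j then Sum.inl (i, b ^^ s) else Sum.inl (p, s) := by
  rw [code_merge x hi hij, mergeCode_of_inl (code_of_mem_reps hp s)]

theorem code_signMove_rep {i p : Fin n} {s : Bool} {σ : S} (hp : p ∈ x.reps) :
    (x.signMove i σ).code (p, s) = if p = i then Sum.inr σ else Sum.inl (p, s) := by
  rw [code_signMove, signCode_of_inl (code_of_mem_reps hp s)]

theorem code_signMove_rep_ne {i p q : Fin n} {s t : Bool} {σ : S} (hp : p ∈ x.reps)
    (hq : q ∈ x.reps) (hpq : p ≠ q) :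
    (x.signMove i σ).code (p, s) ≠ (x.signMove i σ).code (q, t) := by
  rw [code_signMove_rep hp, code_signMove_rep hq]
  split_ifs with h1 h2 h2
  · exact absurd (h1.trans h2.symm) hpq
  · simp
  · simp
  · simp [hpq]

theorem eq_or_eq_of_code_merge {i j p q : Fin n} (hi : i ∈ x.reps)
    (hij : i < j) (hp : p ∈ x.reps) (hq : q ∈ x.reps) (hpq : p ≠ q)
    (h : (x.merge i j true).code (p, false) = (x.merge i j true).code (q, true)) :
    p = i ∧ q = j ∨ p = j ∧ q = i := by
  rw [code_merge_rep hi hij hp, code_merge_rep hi hij hq] at h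
  split_ifs at h with h1 h2 h2
  · exact absurd (h1.trans h2.symm) hpq
  · exact Or.inr ⟨h1, (Prod.mk.inj (Sum.inl.inj h)).1.symm⟩
  · exact Or.inl ⟨(Prod.mk.inj (Sum.inl.inj h)).1, h2⟩
  · exact absurd (Prod.mk.inj (Sum.inl.inj h)).1 hpq

variable [Fintype S] [LinearOrder S]

/-- The second component of the label of an edge of sign `σ`. -/
noncomputable def signLabel (x : LabeledPartition n S) (σ : S) : ℕ :=
  if σ ∈ x.signs then (x.signs.filter fun τ => τ ≤ σ).card
  else ((Finset.univ.filter fun τ => τ ≤ σ) ∪ x.signs).card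

/-- The first component suffices: it already puts the label below (1,2). -/
theorem pairLabel_merge_false {i j : Fin n} (hi : i ∈ x.reps) (hj : j ∈ x.reps) (hij : i < j) :
    (x.pairLabel (x.merge i j false)).1 = 0 := by
  have h : ∃ B : Finset (BarredSet n) × Finset (BarredSet n),
    x.CoherentAt (x.merge i j false) B.1 B.2 := ⟨(_, _), coherentAt_merge hi hj hij⟩
  rw [pairLabel, dif_pos h]

theorem pairLabel_merge_true {i j : Fin n} (hi : i ∈ x.reps) (hj : j ∈ x.reps) (hij : i < j) :
    x.pairLabel (x.merge i j true) = (2, (i : ℕ) + 1) := by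
  have h1 : ¬ ∃ B : Finset (BarredSet n) × Finset (BarredSet n),
      x.CoherentAt (x.merge i j true) B.1 B.2 := by
    rintro ⟨B, hB⟩
    obtain ⟨p, hp, q, hq, hpq, h⟩ := hB.exists_reps
    rw [code_merge_rep hi hij hp, code_merge_rep hi hij hq] at h
    split_ifs at h <;> simp_all
  have h2 : ∃ B : Finset (BarredSet n) × Finset (BarredSet n),
    x.NonCoherentAt (x.merge i j true) B.1 B.2 := ⟨(_, _), nonCoherentAt_merge hi hj hij⟩
  rw [pairLabel, dif_neg h1, dif_pos h2]
  obtain ⟨p, hp, q, hq, hpq, h, hbp, hbq⟩ := h2.choose_spec.exists_reps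
  rw [hbp, hbq]
  have hlt : (i : ℕ) < j := hij
  -- The chosen pair of blocks is determined only up to exchange, which the minimum does not see.
  rcases eq_or_eq_of_code_merge hi hij hp hq hpq h with ⟨rfl, rfl⟩ | ⟨rfl, rfl⟩
  · rw [min_eq_left (by omega)]
  · rw [min_eq_right (by omega)]

theorem pairLabel_signMove {i : Fin n} {σ : S} (hi : i ∈ x.reps) :
    x.pairLabel (x.signMove i σ) = (1, x.signLabel σ) := by
  have h1 : ¬ ∃ B : Finset (BarredSet n) × Finset (BarredSet n),
      x.CoherentAt (x.signMove i σ) B.1 B.2 := by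
    rintro ⟨B, hB⟩
    obtain ⟨p, hp, q, hq, hpq, h⟩ := hB.exists_reps
    exact code_signMove_rep_ne hp hq hpq h
  have h2 : ¬ ∃ B : Finset (BarredSet n) × Finset (BarredSet n),
      x.NonCoherentAt (x.signMove i σ) B.1 B.2 := by
    rintro ⟨B, hB⟩
    obtain ⟨p, hp, q, hq, hpq, h, -⟩ := hB.exists_reps
    exact code_signMove_rep_ne hp hq hpq h
  have hiσ : (i, false) ∈ (x.signMove i σ).signed σ := by
    rw [← code_eq_inr, code_signMove_rep hi, if_pos rfl]
  have h3 : ∃ τ, x.signed τ ⊂ (x.signMove i σ).signed τ := by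
    refine ⟨σ, Finset.ssubset_iff_subset_ne.2 ⟨fun a ha => mem_signed_signMove.2 (Or.inl ha), ?_⟩⟩
    intro h
    rw [← h, ← code_eq_inr, mem_reps.1 hi] at hiσ
    simp at hiσ
  have h4 : h3.choose = σ := by
    obtain ⟨a, ha, hna⟩ := Finset.exists_of_ssubset h3.choose_spec
    rcases mem_signed_signMove.1 ha with ha | ha
    · exact absurd ha hna
    · exact ha.1
  rw [pairLabel, dif_neg h1, dif_neg h2, dif_pos h3, h4, signLabel]
  split_ifs <;> rfl

end LabeledPartition

/-! ### Decreasing chains from a given element -/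

namespace TypeD

open LabeledPartition

variable {n : ℕ} {S : Type*} [Fintype S] [LinearOrder S]

/-- The decreasing maximal chains from `z` to `1̂` with labels at most `l`. -/
def chainsFrom (z : TypeD n S) (l : ℕ ×ₗ ℕ) : Set (List (TypeD n S)) :=
  {c | c.IsChain (· ⋖ ·) ∧ c.head? = some z ∧ c.getLast? = some (oneHat n S) ∧
    (l :: labelWord c).Pairwise (· ≥ ·)}

theorem labelWord_cons_cons (z y : TypeD n S) (c : List (TypeD n S)) :
    labelWord (z :: y :: c) = edgeLabel z.1 y.1 :: labelWord (y :: c) := rfl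

theorem pairwise_ge_cons_cons {α : Type*} [Preorder α] {a b : α} {l : List α} :
    (a :: b :: l).Pairwise (· ≥ ·) ↔ b ≤ a ∧ (b :: l).Pairwise (· ≥ ·) := by
  rw [List.pairwise_cons, List.pairwise_cons]
  constructor
  · rintro ⟨h1, h2⟩
    exact ⟨h1 b List.mem_cons_self, h2⟩
  · rintro ⟨h1, h2, h3⟩
    refine ⟨fun c hc => ?_, h2, h3⟩
    rcases List.mem_cons.1 hc with rfl | hc
    · exact h1
    · exact (h2 c hc).trans h1

theorem chainsFrom_oneHat (l : ℕ ×ₗ ℕ) : chainsFrom (oneHat n S) l = {[oneHat n S]} := by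
  ext c
  simp only [chainsFrom, Set.mem_ofPred_eq, Set.mem_singleton_iff]
  constructor
  · rintro ⟨h1, h2, -, -⟩
    rcases c with _ | ⟨z, _ | ⟨y, c⟩⟩
    · simp at h2
    · obtain rfl : z = oneHat n S := by simpa using h2
      rfl
    · obtain rfl : z = oneHat n S := by simpa using h2
      exact absurd (List.isChain_cons_cons.1 h1).1 (not_oneHat_covBy y)
  · rintro rfl
    simp [labelWord]

theorem mem_chainsFrom_iff {z : TypeD n S} (hz : z ≠ oneHat n S) {l : ℕ ×ₗ ℕ}
    {c : List (TypeD n S)} :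
    c ∈ chainsFrom z l ↔ ∃ c', c = z :: c' ∧ ∃ y, z ⋖ y ∧ edgeLabel z.1 y.1 ≤ l ∧
      c' ∈ chainsFrom y (edgeLabel z.1 y.1) := by
  simp only [chainsFrom, Set.mem_ofPred_eq]
  constructor
  · rintro ⟨h1, h2, h3, h4⟩
    rcases c with _ | ⟨z', _ | ⟨y, c⟩⟩
    · simp at h2
    · obtain rfl : z' = z := by simpa using h2
      exact absurd (by simpa using h3) hz
    · obtain rfl : z' = z := by simpa using h2
      rw [List.isChain_cons_cons] at h1
      rw [labelWord_cons_cons, pairwise_ge_cons_cons] at h4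
      exact ⟨_, rfl, y, h1.1, h4.1, h1.2, rfl, by simpa using h3, h4.2⟩
  · rintro ⟨c', rfl, y, h1, h2, h3, h4, h5, h6⟩
    rcases c' with _ | ⟨y', c'⟩
    · simp at h4
    · obtain rfl : y' = y := by simpa using h4
      refine ⟨List.isChain_cons_cons.2 ⟨h1, h3⟩, rfl, by simpa using h5, ?_⟩
      rw [labelWord_cons_cons, pairwise_ge_cons_cons]
      exact ⟨h2, h6⟩

theorem edgeLabel_ofPartition {x y : LabeledPartition n S} (hx : x.IsD) (hy : y.IsD) :
    edgeLabel (ofPartition x).1 (ofPartition y).1 = toLex (x.pairLabel y) := by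
  rw [val_ofPartition hx, val_ofPartition hy]
  rfl

theorem edgeLabel_oneHat {x : LabeledPartition n S} (hx : x.IsD) :
    edgeLabel (ofPartition x).1 (oneHat n S).1 = toLex (1, 2) := by
  rw [val_ofPartition hx]
  rfl

/-- The last label of a chain to 1̂ is (1,2), and a decreasing word never rises back to it. -/
theorem chainsFrom_eq_empty {z : TypeD n S} (hz : z ≠ oneHat n S) {l : ℕ ×ₗ ℕ}
    (hl : l < toLex (1, 2)) : chainsFrom z l = ∅ := by
  rw [Set.eq_empty_iff_forall_notMem]
  intro c
  induction c generalizing z l with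
  | nil =>
    intro hc
    simpa using hc.2.1
  | cons a c ih =>
    intro hc
    obtain ⟨c', h1, y, -, h2, h3⟩ := (mem_chainsFrom_iff hz).1 hc
    obtain rfl := (List.cons.inj h1).2
    obtain rfl | ⟨x, hx, rfl⟩ := eq_oneHat_or z
    · exact hz rfl
    by_cases hy : y = oneHat n S
    · subst hy
      rw [edgeLabel_oneHat hx] at h2
      exact h2.not_gt hl
    · exact ih hy (h2.trans_lt hl) h3

end TypeD

/-! ### The sign labels for two signs -/

namespace LabeledPartition

variable {n : ℕ} {S : Type*} [Fintype S] {x : LabeledPartition n S}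

theorem mem_signs {σ : S} : σ ∈ x.signs ↔ (x.signed σ).Nonempty := by simp [signs]

theorem signed_eq_empty {σ : S} (h : σ ∉ x.signs) : x.signed σ = ∅ := by
  rwa [mem_signs, Finset.not_nonempty_iff_eq_empty] at h

theorem signs_merge {i j : Fin n} {b : Bool} (hi : i ∈ x.reps) (hij : i < j) :
    (x.merge i j b).signs = x.signs := by
  ext τ
  rw [mem_signs, mem_signs, signed_merge hi hij]

theorem isD_of_signs_empty (hx : x.signs = ∅) : x.IsD := by
  intro σ
  have : σ ∉ x.signs := by simp [hx]
  rw [mem_signs, Finset.not_nonempty_iff_eq_empty] at this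
  simp [this]

variable [LinearOrder S]

theorem signLabel_le (σ : S) : x.signLabel σ ≤ Fintype.card S := by
  unfold signLabel
  split_ifs <;> exact Finset.card_le_univ _

theorem signs_signMove {i : Fin n} (hi : i ∈ x.reps) (σ : S) :
    (x.signMove i σ).signs = insert σ x.signs := by
  ext τ
  rw [Finset.mem_insert, mem_signs, mem_signs]
  constructor
  · rintro ⟨a, ha⟩
    rcases mem_signed_signMove.1 ha with ha | ha
    · exact Or.inr ⟨a, ha⟩
    · exact Or.inl ha.1
  · rintro (rfl | ⟨a, ha⟩)
    · exact ⟨(i, false), mem_signed_signMove.2 (Or.inr ⟨rfl, _, mem_reps.1 hi, rfl⟩)⟩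
    · exact ⟨a, mem_signed_signMove.2 (Or.inl ha)⟩

variable {σ₀ σ₁ : S}

theorem univ_eq_pair (hS : ∀ σ : S, σ = σ₀ ∨ σ = σ₁) : (Finset.univ : Finset S) = {σ₀, σ₁} := by
  ext σ
  simpa using hS σ

theorem signLabel_of_signs_empty (h01 : σ₀ < σ₁) (hS : ∀ σ : S, σ = σ₀ ∨ σ = σ₁)
    (hx : x.signs = ∅) (σ : S) : x.signLabel σ = 2 ↔ σ = σ₁ := by
  rw [signLabel, hx, if_neg (Finset.notMem_empty σ), Finset.union_empty, univ_eq_pair hS]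
  rcases hS σ with rfl | rfl
  · simp [Finset.filter_insert, Finset.filter_singleton, h01.not_ge, h01.ne]
  · simp [Finset.filter_insert, Finset.filter_singleton, h01.le, Finset.card_pair h01.ne]

/-- The larger sign has rank 1 among the signs in use, whereas the unused smaller sign is counted
together with the used one. -/
theorem signLabel_of_signs_singleton (h01 : σ₀ < σ₁) (hS : ∀ σ : S, σ = σ₀ ∨ σ = σ₁)
    (hx : x.signs = {σ₁}) (σ : S) : x.signLabel σ = 2 ↔ σ = σ₀ := by
  rw [signLabel, hx]
  rcases hS σ with rfl | rfl
  · rw [if_neg (by simpa using h01.ne), univ_eq_pair hS]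
    simp [Finset.filter_insert, Finset.filter_singleton, h01.not_ge, Finset.card_pair h01.ne]
  · simp [Finset.filter_singleton, h01.ne']

theorem signLabel_of_signs_univ (h01 : σ₀ < σ₁) (hS : ∀ σ : S, σ = σ₀ ∨ σ = σ₁)
    (hx : x.signs = Finset.univ) (σ : S) : x.signLabel σ = 2 ↔ σ = σ₁ := by
  rw [signLabel, hx, if_pos (Finset.mem_univ σ), univ_eq_pair hS]
  rcases hS σ with rfl | rfl
  · simp [Finset.filter_insert, Finset.filter_singleton, h01.not_ge, h01.ne]
  · simp [Finset.filter_insert, Finset.filter_singleton, h01.le, Finset.card_pair h01.ne]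

end LabeledPartition

namespace TypeD

open LabeledPartition

variable {n : ℕ} {S : Type*} [Fintype S] [LinearOrder S] {x : LabeledPartition n S}

theorem mem_chainsFrom_ofPartition_iff (hn : 2 ≤ n) (hS : Fintype.card S = 2) (hx : x.IsD)
    {l : ℕ ×ₗ ℕ} {c : List (TypeD n S)} :
    c ∈ chainsFrom (ofPartition x) l ↔ ∃ c', c = ofPartition x :: c' ∧
      ((∃ i ∈ x.reps, ∃ j ∈ x.reps, i < j ∧ toLex (2, (i : ℕ) + 1) ≤ l ∧
          c' ∈ chainsFrom (ofPartition (x.merge i j true)) (toLex (2, (i : ℕ) + 1))) ∨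
        (∃ i ∈ x.reps, ∃ σ, x.CanSign i σ ∧ x.signLabel σ = 2 ∧ toLex (1, 2) ≤ l ∧
          c' ∈ chainsFrom (ofPartition (x.signMove i σ)) (toLex (1, 2))) ∨
        x.reps = ∅ ∧ toLex (1, 2) ≤ l ∧ c' = [oneHat n S]) := by
  obtain ⟨σ₀⟩ : Nonempty S := Fintype.card_pos_iff.1 (by omega)
  rw [mem_chainsFrom_iff (ofPartition_ne_oneHat hx)]
  refine exists_congr fun c' => and_congr_right fun _ => ?_
  simp only [ofPartition_covBy_iff hn σ₀ hx]
  constructor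
  · rintro ⟨y, ⟨i, hi, j, hj, hij, b, rfl⟩ | ⟨i, hi, σ, hs, rfl⟩ | ⟨hr, rfl⟩, hl, hc⟩
    · have hm := isD_merge (b := b) hx hi hij
      rw [edgeLabel_ofPartition hx hm] at hl hc
      cases b
      · rw [chainsFrom_eq_empty (ofPartition_ne_oneHat hm)] at hc
        · exact absurd hc (Set.notMem_empty _)
        · rw [Prod.Lex.toLex_lt_toLex, pairLabel_merge_false hi hj hij]
          exact Or.inl Nat.zero_lt_one
      · rw [pairLabel_merge_true hi hj hij] at hl hc
        exact Or.inl ⟨i, hi, j, hj, hij, hl, hc⟩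
    · have hm := isD_signMove hx hi hs
      rw [edgeLabel_ofPartition hx hm, pairLabel_signMove hi] at hl hc
      have hle : x.signLabel σ ≤ 2 := hS ▸ x.signLabel_le σ
      rcases hle.eq_or_lt with h2 | h2
      · rw [h2] at hl hc
        exact Or.inr (Or.inl ⟨i, hi, σ, hs, h2, hl, hc⟩)
      · rw [chainsFrom_eq_empty (ofPartition_ne_oneHat hm)] at hc
        · exact absurd hc (Set.notMem_empty _)
        · rw [Prod.Lex.toLex_lt_toLex]
          exact Or.inr ⟨rfl, h2⟩
    · rw [edgeLabel_oneHat hx] at hl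
      rw [chainsFrom_oneHat] at hc
      exact Or.inr (Or.inr ⟨hr, hl, hc⟩)
  · rintro (⟨i, hi, j, hj, hij, hl, hc⟩ | ⟨i, hi, σ, hs, h2, hl, hc⟩ | ⟨hr, hl, hc⟩)
    · refine ⟨_, Or.inl ⟨i, hi, j, hj, hij, true, rfl⟩, ?_⟩
      rw [edgeLabel_ofPartition hx (isD_merge hx hi hij), pairLabel_merge_true hi hj hij]
      exact ⟨hl, hc⟩
    · refine ⟨_, Or.inr (Or.inl ⟨i, hi, σ, hs, rfl⟩), ?_⟩
      rw [edgeLabel_ofPartition hx (isD_signMove hx hi hs), pairLabel_signMove hi, h2]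
      exact ⟨hl, hc⟩
    · refine ⟨_, Or.inr (Or.inr ⟨hr, rfl⟩), ?_⟩
      rw [edgeLabel_oneHat hx, chainsFrom_oneHat]
      exact ⟨hl, hc⟩

/-! ### The signed part of a chain -/

theorem disjoint_chainsFrom {z y : TypeD n S} (h : z ≠ y) (l l' : ℕ ×ₗ ℕ) :
    Disjoint (chainsFrom z l) (chainsFrom y l') := by
  rw [Set.disjoint_left]
  intro c h1 h2
  exact h (Option.some_inj.1 (h1.2.1.symm.trans h2.2.1))

theorem not_two_le_one (i : ℕ) : ¬ toLex (2, i) ≤ (toLex (1, 2) : ℕ ×ₗ ℕ) := by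
  rw [Prod.Lex.toLex_le_toLex]
  simp

theorem hasCount_chainsFrom_of_reps_empty (hn : 2 ≤ n) (hS : Fintype.card S = 2) (hx : x.IsD)
    (hr : x.reps = ∅) : HasCount (chainsFrom (ofPartition x) (toLex (1, 2))) 1 := by
  refine (HasCount.singleton [ofPartition x, oneHat n S]).congr ?_ rfl
  ext c
  rw [mem_chainsFrom_ofPartition_iff hn hS hx, hr]
  simp

/-- Below (1,2) only the single sign with label 2 can be used, so the next step is just the choice
of a block that may receive it. -/
theorem hasCount_chainsFrom_sign (hn : 2 ≤ n) (hS : Fintype.card S = 2) (hx : x.IsD) {ρ : S}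
    (hρ : ∀ σ, x.signLabel σ = 2 ↔ σ = ρ) (hr : x.reps.Nonempty) {J : Finset (Fin n)}
    (hJ : ∀ i, i ∈ J ↔ i ∈ x.reps ∧ x.CanSign i ρ) {z : ℤ}
    (h : ∀ i ∈ J, HasCount (chainsFrom (ofPartition (x.signMove i ρ)) (toLex (1, 2))) z) :
    HasCount (chainsFrom (ofPartition x) (toLex (1, 2))) (J.card * z) := by
  have hdisj : ∀ i ∈ J, ∀ j ∈ J, i ≠ j →
      Disjoint (chainsFrom (ofPartition (x.signMove i ρ)) (toLex (1, 2)))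
        (chainsFrom (ofPartition (x.signMove j ρ)) (toLex (1, 2))) := by
    intro i hi j hj hij
    rw [hJ] at hi hj
    refine disjoint_chainsFrom (fun heq => ?_) _ _
    rw [ofPartition_inj (isD_signMove hx hi.1 hi.2) (isD_signMove hx hj.1 hj.2)] at heq
    have h1 := reps_signMove (x := x) (i := i) (σ := ρ)
    rw [heq, reps_signMove] at h1
    exact Finset.notMem_erase i _ (h1 ▸ Finset.mem_erase.2 ⟨hij, hi.1⟩)
  refine ((HasCount.biUnion J h hdisj).image
    (List.cons_injective (a := ofPartition x))).congr ?_ (by simp)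
  ext c
  rw [mem_chainsFrom_ofPartition_iff hn hS hx]
  simp only [not_two_le_one, hρ, hr.ne_empty, le_refl, true_and, false_and, and_false, exists_false,
    false_or, or_false, Set.mem_image, Set.mem_iUnion, exists_prop, hJ]
  constructor
  · rintro ⟨c', rfl, i, hi, σ, hs, rfl, hc⟩
    exact ⟨c', ⟨i, ⟨hi, hs⟩, hc⟩, rfl⟩
  · rintro ⟨c', ⟨i, ⟨hi, hs⟩, hc⟩, rfl⟩
    exact ⟨c', rfl, i, hi, ρ, hs, rfl, hc⟩

variable {σ₀ σ₁ : S}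

theorem hasCount_chainsFrom_signs_univ (hn : 2 ≤ n) (hS : Fintype.card S = 2) (h01 : σ₀ < σ₁)
    (hS' : ∀ σ : S, σ = σ₀ ∨ σ = σ₁) (hx : x.IsD) (hs : x.signs = Finset.univ) :
    HasCount (chainsFrom (ofPartition x) (toLex (1, 2))) (x.reps.card ! : ℕ) := by
  induction hk : x.reps.card generalizing x with
  | zero =>
    exact (hasCount_chainsFrom_of_reps_empty hn hS hx (Finset.card_eq_zero.1 hk)).congr rfl
      (by simp)
  | succ k ih =>
    have hcan : ∀ i, x.CanSign i σ₁ := fun i => Or.inl (mem_signs.1 (hs ▸ Finset.mem_univ σ₁))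
    refine (hasCount_chainsFrom_sign hn hS hx (signLabel_of_signs_univ h01 hS' hs)
      (Finset.card_pos.1 (by omega)) (J := x.reps) (fun i => by simp [hcan])
      (z := (k ! : ℕ)) fun i hi => ?_).congr rfl ?_
    · refine ih (isD_signMove hx hi (hcan i)) ?_ ?_
      · rw [signs_signMove hi, hs, Finset.insert_eq_of_mem (Finset.mem_univ _)]
      · rw [reps_signMove, Finset.card_erase_of_mem hi, hk, Nat.add_sub_cancel]
    · rw [hk, Nat.factorial_succ, Nat.cast_mul]

theorem hasCount_chainsFrom_signs_singleton (hn : 2 ≤ n) (hS : Fintype.card S = 2) (h01 : σ₀ < σ₁)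
    (hS' : ∀ σ : S, σ = σ₀ ∨ σ = σ₁) (hx : x.IsD) (hs : x.signs = {σ₁})
    (hr : x.reps.Nonempty) :
    HasCount (chainsFrom (ofPartition x) (toLex (1, 2)))
      ((x.reps.card - x.singles.card : ℕ) * ((x.reps.card - 1)! : ℕ)) := by
  have h0 : x.signed σ₀ = ∅ := signed_eq_empty (by simp [hs, h01.ne])
  have hJ := mem_sdiff_singles_iff h0
  refine (hasCount_chainsFrom_sign hn hS hx (signLabel_of_signs_singleton h01 hS' hs) hr hJ
    (z := ((x.reps.card - 1)! : ℕ)) fun i hi => ?_).congr rfl ?_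
  · obtain ⟨hi, hc⟩ := (hJ i).1 hi
    have := hasCount_chainsFrom_signs_univ hn hS h01 hS' (isD_signMove hx hi hc)
      (by rw [signs_signMove hi, hs, univ_eq_pair hS'])
    rwa [reps_signMove, Finset.card_erase_of_mem hi] at this
  · rw [Finset.card_sdiff_of_subset x.singles_subset]

theorem hasCount_chainsFrom_signs_empty (hn : 2 ≤ n) (hS : Fintype.card S = 2) (h01 : σ₀ < σ₁)
    (hS' : ∀ σ : S, σ = σ₀ ∨ σ = σ₁) (hs : x.signs = ∅) (hr : x.reps.Nonempty)
    (hu : x.reps.card = 1 → x.singles.card = 0) :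
    HasCount (chainsFrom (ofPartition x) (toLex (1, 2)))
      (flourishingCount 0 0 x.reps.card x.singles.card) := by
  have hx := isD_of_signs_empty hs
  have hle : x.singles.card ≤ x.reps.card := Finset.card_le_card x.singles_subset
  have hJ := mem_sdiff_singles_iff (signed_eq_empty (x := x) (σ := σ₁) (by simp [hs]))
  have hpos := hr.card_pos
  -- A lone block takes the larger sign and the chain then ends at 1̂, which gives 1. Otherwise a
  -- second nonsingleton block takes the smaller sign, and the others follow in any order.
  refine (hasCount_chainsFrom_sign hn hS hx (signLabel_of_signs_empty h01 hS' hs) hr hJ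
    (z := if x.reps.card = 1 then 1 else
      ((x.reps.card - 1 - x.singles.card : ℕ) * ((x.reps.card - 2)! : ℕ)))
    fun i hi => ?_).congr rfl ?_
  · have hsing := (Finset.mem_sdiff.1 hi).2
    obtain ⟨hi, hc⟩ := (hJ i).1 hi
    have hm := isD_signMove hx hi hc
    have hcard : (x.signMove i σ₁).reps.card = x.reps.card - 1 := by
      rw [reps_signMove, Finset.card_erase_of_mem hi]
    split_ifs with h1
    · exact hasCount_chainsFrom_of_reps_empty hn hS hm
        (Finset.card_eq_zero.1 (by rw [hcard, h1]))
    · have := hasCount_chainsFrom_signs_singleton hn hS h01 hS' hm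
        (by rw [signs_signMove hi, hs]; rfl) (Finset.card_pos.1 (by omega))
      rwa [hcard, singles_signMove, Finset.erase_eq_of_notMem hsing, Nat.sub_sub _ 1 1] at this
  · rw [Finset.card_sdiff_of_subset x.singles_subset, flourishingCount_zero]
    generalize x.reps.card = k at *
    generalize x.singles.card = u at *
    rcases k with _ | _ | k
    · omega
    · simp [hu rfl]
    · rw [if_neg (by omega)]
      rcases hle.eq_or_lt with rfl | hlt
      · simp only [Nat.sub_self, Nat.add_sub_cancel, Nat.reduceSubDiff, Nat.factorial_succ]
        push_cast
        ring
      · rw [Nat.cast_sub hle, Nat.cast_sub (by omega)]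
        simp only [Nat.add_sub_cancel, Nat.reduceSubDiff, Nat.factorial_succ]
        push_cast
        ring

end TypeD

/-! ### The non-coherent part of a chain -/

namespace LabeledPartition

variable {n : ℕ} {S : Type*} {x : LabeledPartition n S}

/-- The representatives of the unsigned blocks that are at least `m` (zero-based). -/
noncomputable def repsFrom (x : LabeledPartition n S) (m : ℕ) : Finset (Fin n) :=
  x.reps.filter fun i => m ≤ (i : ℕ)

/-- The representatives of the blocks with one element that are at least `m` (zero-based). -/
noncomputable def singlesFrom (x : LabeledPartition n S) (m : ℕ) : Finset (Fin n) :=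
  x.singles.filter fun i => m ≤ (i : ℕ)

theorem mem_repsFrom {m : ℕ} {i : Fin n} : i ∈ x.repsFrom m ↔ i ∈ x.reps ∧ m ≤ (i : ℕ) :=
  Finset.mem_filter

theorem singlesFrom_subset (x : LabeledPartition n S) (m : ℕ) :
    x.singlesFrom m ⊆ x.repsFrom m :=
  Finset.filter_subset_filter _ x.singles_subset

theorem repsFrom_zero : x.repsFrom 0 = x.reps := by simp [repsFrom]

theorem singlesFrom_zero : x.singlesFrom 0 = x.singles := by simp [singlesFrom]

theorem filter_le_insert {A : Finset (Fin n)} {s : ℕ} {t : Fin n} (hts : (t : ℕ) = s)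
    (ht : t ∈ A) :
    (A.filter fun i : Fin n => s ≤ (i : ℕ)).card = (A.filter fun i : Fin n => s + 1 ≤ (i : ℕ)).card + 1 := by
  rw [← Finset.card_insert_of_notMem (a := t) (s := A.filter fun i : Fin n => s + 1 ≤ (i : ℕ))]
  · congr 1
    ext i
    simp only [Finset.mem_filter, Finset.mem_insert, Fin.ext_iff]
    constructor
    · rintro ⟨h1, h2⟩
      by_cases h : (i : ℕ) = t
      · exact Or.inl h
      · exact Or.inr ⟨h1, by omega⟩
    · rintro (h | ⟨h1, h2⟩)
      · rw [Fin.ext h]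
        exact ⟨ht, hts.ge⟩
      · exact ⟨h1, by omega⟩
  · rw [Finset.mem_filter, not_and]
    omega

theorem card_repsFrom_succ {s : ℕ} {t : Fin n} (hts : (t : ℕ) = s) (ht : t ∈ x.reps) :
    (x.repsFrom s).card = (x.repsFrom (s + 1)).card + 1 := filter_le_insert hts ht

open scoped Classical in
theorem card_singlesFrom_succ {s : ℕ} {t : Fin n} (hts : (t : ℕ) = s) :
    (x.singlesFrom s).card = (x.singlesFrom (s + 1)).card + if t ∈ x.singles then 1 else 0 := by
  split_ifs with h
  · exact filter_le_insert hts h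
  · unfold singlesFrom
    rw [add_zero]
    congr 1
    ext i
    simp only [Finset.mem_filter]
    refine and_congr_right fun hi => ?_
    have : i ≠ t := fun h' => h (h' ▸ hi)
    rw [Ne, Fin.ext_iff] at this
    omega

theorem repsFrom_merge {i j : Fin n} {b : Bool} (hi : i ∈ x.reps) (hij : i < j) (m : ℕ) :
    (x.merge i j b).repsFrom m = (x.repsFrom m).erase j := by
  rw [repsFrom, reps_merge hi hij, Finset.filter_erase, ← repsFrom]

theorem singlesFrom_merge {i j : Fin n} {b : Bool} (hi : i ∈ x.reps) (hj : j ∈ x.reps)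
    (hij : i < j) {m : ℕ} (him : (i : ℕ) < m) :
    (x.merge i j b).singlesFrom m = (x.singlesFrom m).erase j := by
  rw [singlesFrom, singles_merge hi hj hij, Finset.filter_erase, Finset.filter_erase, ← singlesFrom]
  refine Finset.erase_eq_of_notMem fun h => ?_
  have := (Finset.mem_filter.1 (Finset.mem_of_mem_erase h)).2
  omega

/-- All blocks that contain an element before the `m`-th one are singletons, with the possible
exception of the block of the element that immediately precedes it. -/
def SingletonsBefore (x : LabeledPartition n S) (m : ℕ) : Prop :=
  ∀ i : Fin n, (i : ℕ) + 1 < m → i ∈ x.singles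

theorem SingletonsBefore.mono {m m' : ℕ} (h : x.SingletonsBefore m) (hm : m' ≤ m) :
    x.SingletonsBefore m' := fun i hi => h i (by omega)

theorem SingletonsBefore.merge {s : ℕ} (h : x.SingletonsBefore (s + 1)) {t j : Fin n} {b : Bool}
    (hts : (t : ℕ) = s) (ht : t ∈ x.reps) (hj : j ∈ x.reps) (htj : t < j) :
    (x.merge t j b).SingletonsBefore (s + 1) := by
  intro i hi
  have hlt : (t : ℕ) < j := htj
  rw [singles_merge ht hj htj, Finset.mem_erase, Finset.mem_erase]
  refine ⟨?_, ?_, h i hi⟩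
  · rintro rfl
    omega
  · rintro rfl
    omega

theorem exists_rep_of_signs_empty [Fintype S] (hs : x.signs = ∅) (a : BarredSet n) :
    ∃ c, x.code a = Sum.inl c ∧ c.1 ∈ x.reps ∧ c.1 ≤ a.1 := by
  rcases h : x.code a with c | σ
  · exact ⟨c, rfl, fst_mem_reps h, x.isCode_code.le _ _ h⟩
  · have : σ ∈ x.signs := mem_signs.2 ⟨a, x.code_eq_inr.1 h⟩
    simp [hs] at this

/-- Otherwise the block of `t` would have an earlier representative, whose block is a singleton by
assumption. -/
theorem SingletonsBefore.mem_reps [Fintype S] (hs : x.signs = ∅) {s : ℕ}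
    (h : x.SingletonsBefore (s + 1)) {t : Fin n} (hts : (t : ℕ) = s) : t ∈ x.reps := by
  obtain ⟨c, hc, hr, hle⟩ := exists_rep_of_signs_empty hs (t, false)
  rcases hle.eq_or_lt with heq | hlt
  · obtain rfl : c.1 = t := heq
    exact hr
  · have hlt' : (c.1 : ℕ) < t := hlt
    have := (mem_singles.1 (h c.1 (by omega))).2 _ _ hc rfl
    exact absurd this hlt.ne'

theorem reps_nonempty_of_signs_empty [Fintype S] (hn : 2 ≤ n) (hs : x.signs = ∅) :
    x.reps.Nonempty := by
  obtain ⟨c, -, hc, -⟩ := exists_rep_of_signs_empty hs (⟨0, by omega⟩, false)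
  exact ⟨_, hc⟩

theorem singles_card_of_reps_card [Fintype S] (hn : 2 ≤ n) (hs : x.signs = ∅)
    (hr : x.reps.card = 1) : x.singles.card = 0 := by
  obtain ⟨r, hr⟩ := Finset.card_eq_one.1 hr
  rw [Finset.card_eq_zero, Finset.eq_empty_iff_forall_notMem]
  intro i hi
  have : Nontrivial (Fin n) := Fin.nontrivial_iff_two_le.2 hn
  obtain ⟨k, hk⟩ := exists_ne i
  obtain ⟨c, hc, hcr, -⟩ := exists_rep_of_signs_empty hs (k, false)
  obtain ⟨hir, hi⟩ := mem_singles.1 hi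
  rw [hr, Finset.mem_singleton] at hcr hir
  exact hk (hi _ _ hc (hcr.trans hir.symm))

end LabeledPartition

namespace TypeD

open LabeledPartition

variable {n : ℕ} {S : Type*} [Fintype S] [LinearOrder S] {x : LabeledPartition n S}

theorem one_two_le (m : ℕ) : (toLex (1, 2) : ℕ ×ₗ ℕ) ≤ toLex (2, m) := by
  rw [Prod.Lex.toLex_le_toLex]
  exact Or.inl Nat.one_lt_two

theorem two_le_two_iff {i m : ℕ} : (toLex (2, i) : ℕ ×ₗ ℕ) ≤ toLex (2, m) ↔ i ≤ m := by
  rw [Prod.Lex.toLex_le_toLex]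
  simp

theorem chainsFrom_two_zero (hn : 2 ≤ n) (hS : Fintype.card S = 2) (hx : x.IsD) :
    chainsFrom (ofPartition x) (toLex (2, 0)) = chainsFrom (ofPartition x) (toLex (1, 2)) := by
  ext c
  rw [mem_chainsFrom_ofPartition_iff hn hS hx, mem_chainsFrom_ofPartition_iff hn hS hx]
  simp only [not_two_le_one, two_le_two_iff, one_two_le, le_refl, Nat.add_one_le_iff,
    Nat.not_lt_zero]

/-- The dichotomy of the trees: either the bound drops, which closes the list of `t`, or the first
label equals it, which appends some j > t to `t`. -/
theorem chainsFrom_two_succ (hn : 2 ≤ n) (hS : Fintype.card S = 2) (hx : x.IsD) {t : Fin n}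
    {s : ℕ} (hts : (t : ℕ) = s) (ht : t ∈ x.reps) :
    chainsFrom (ofPartition x) (toLex (2, s + 1)) =
      chainsFrom (ofPartition x) (toLex (2, s)) ∪
        List.cons (ofPartition x) '' ⋃ j ∈ x.repsFrom (s + 1),
          chainsFrom (ofPartition (x.merge t j true)) (toLex (2, s + 1)) := by
  subst hts
  ext c
  rw [Set.mem_union, mem_chainsFrom_ofPartition_iff hn hS hx,
    mem_chainsFrom_ofPartition_iff hn hS hx]
  simp only [two_le_two_iff, one_two_le, true_and, Set.mem_image, Set.mem_iUnion, exists_prop,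
    mem_repsFrom]
  constructor
  · rintro ⟨c', rfl, ⟨i, hi, j, hj, hij, hle, hc⟩ | h⟩
    · rcases hle.eq_or_lt with heq | hlt
      · obtain rfl : i = t := Fin.ext (by omega)
        exact Or.inr ⟨c', ⟨j, ⟨hj, hij⟩, hc⟩, rfl⟩
      · exact Or.inl ⟨c', rfl, Or.inl ⟨i, hi, j, hj, hij, by omega, hc⟩⟩
    · exact Or.inl ⟨c', rfl, Or.inr h⟩
  · rintro (⟨c', rfl, ⟨i, hi, j, hj, hij, hle, hc⟩ | h⟩ | ⟨c', ⟨j, ⟨hj, hij⟩, hc⟩, rfl⟩)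
    · exact ⟨c', rfl, Or.inl ⟨i, hi, j, hj, hij, by omega, hc⟩⟩
    · exact ⟨c', rfl, Or.inr h⟩
    · exact ⟨c', rfl, Or.inl ⟨t, ht, j, hj, hij, le_rfl, hc⟩⟩

theorem disjoint_chainsFrom_image (hx : x.IsD) {t : Fin n}
    (ht : t ∈ x.reps) {s : ℕ} (hts : (t : ℕ) = s) :
    Disjoint (chainsFrom (ofPartition x) (toLex (2, s)))
      (List.cons (ofPartition x) '' ⋃ j ∈ x.repsFrom (s + 1),
        chainsFrom (ofPartition (x.merge t j true)) (toLex (2, s + 1))) := by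
  subst hts
  rw [Set.disjoint_left]
  rintro c h ⟨c', hc', rfl⟩
  simp only [Set.mem_iUnion, exists_prop, mem_repsFrom] at hc'
  obtain ⟨j, ⟨hj, htj⟩, hc'⟩ := hc'
  have htj' : t < j := htj
  have hm := isD_merge (b := true) hx ht htj'
  obtain ⟨c'', h1, y, -, h2, h3⟩ := (mem_chainsFrom_iff (ofPartition_ne_oneHat hx)).1 h
  obtain rfl := (List.cons.inj h1).2
  obtain rfl : ofPartition (x.merge t j true) = y :=
    Option.some_inj.1 (hc'.2.1.symm.trans h3.2.1)
  rw [edgeLabel_ofPartition hx hm, pairLabel_merge_true ht hj htj', two_le_two_iff] at h2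
  omega

variable {σ₀ σ₁ : S}

open scoped Classical in
-- The counterpart of the count of flourishing completions. The index m - 1 of [n] plays the role of
-- the tree node m, and it has a child as soon as its block is no longer a singleton.
theorem hasCount_chainsFrom_two (hn : 2 ≤ n) (hS : Fintype.card S = 2) (h01 : σ₀ < σ₁)
    (hS' : ∀ σ : S, σ = σ₀ ∨ σ = σ₁) (m : ℕ) :
    ∀ x : LabeledPartition n S, m ≤ n → x.signs = ∅ → x.SingletonsBefore m →
      HasCount (chainsFrom (ofPartition x) (toLex (2, m)))
        (flourishingCount m
          (m - if ∃ t : Fin n, (t : ℕ) + 1 = m ∧ t ∉ x.singles then 1 else 0)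
          (x.repsFrom m).card (x.singlesFrom m).card) := by
  induction m with
  | zero =>
    intro x _ hs _
    rw [chainsFrom_two_zero hn hS (isD_of_signs_empty hs), repsFrom_zero, singlesFrom_zero,
      Nat.zero_sub]
    exact hasCount_chainsFrom_signs_empty hn hS h01 hS' hs (reps_nonempty_of_signs_empty hn hs)
      (singles_card_of_reps_card hn hs)
  | succ s ih =>
    intro x hsn hs hb
    induction hk : (x.repsFrom (s + 1)).card using Nat.strong_induction_on generalizing x with
    | _ k ihk =>
    obtain ⟨t, hts⟩ : ∃ t : Fin n, (t : ℕ) = s := ⟨⟨s, hsn⟩, rfl⟩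
    have hx := isD_of_signs_empty hs
    have ht := hb.mem_reps hs hts
    have hex (y : LabeledPartition n S) :
        (∃ t' : Fin n, (t' : ℕ) + 1 = s + 1 ∧ t' ∉ y.singles) ↔ t ∉ y.singles := by
      constructor
      · rintro ⟨t', h1, h2⟩
        rwa [← Fin.ext (show (t' : ℕ) = t by omega)]
      · exact fun h => ⟨t, by rw [hts], h⟩
    have h1 := ih x (by omega) hs (hb.mono (by omega))
    rw [if_neg, Nat.sub_zero, card_repsFrom_succ hts ht, card_singlesFrom_succ hts, hk] at h1
    swap
    · rintro ⟨t', h1, h2⟩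
      exact h2 (hb t' (by omega))
    have hlt : ∀ j ∈ x.repsFrom (s + 1), j ∈ x.reps ∧ t < j := fun j hj => by
      obtain ⟨h1, h2⟩ := mem_repsFrom.1 hj
      exact ⟨h1, by rw [Fin.lt_def]; omega⟩
    have hchild : ∀ j ∈ x.repsFrom (s + 1), ∀ u,
        ((x.merge t j true).singlesFrom (s + 1)).card = u →
        HasCount (chainsFrom (ofPartition (x.merge t j true)) (toLex (2, s + 1)))
          (flourishingCount (s + 1) s (k - 1) u) := by
      intro j hj u hu
      obtain ⟨hjr, htj⟩ := hlt j hj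
      have hc : ((x.merge t j true).repsFrom (s + 1)).card = k - 1 := by
        rw [repsFrom_merge ht htj, Finset.card_erase_of_mem hj, hk]
      have hpos := Finset.card_pos.2 ⟨j, hj⟩
      have := ihk (k - 1) (by omega) _ (by rw [signs_merge ht htj, hs])
        (hb.merge hts ht hjr htj) hc
      rwa [hu, if_pos, Nat.add_sub_cancel] at this
      -- After the merge `t` is not a singleton, so w drops by one.
      rw [hex, singles_merge ht hjr htj]
      exact Finset.notMem_erase t _
    have h2 := HasCount.biUnion_ite (x.singlesFrom_subset (s + 1))
      (A := fun j => chainsFrom (ofPartition (x.merge t j true)) (toLex (2, s + 1)))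
      (fun j hj => by
        have hj' := x.singlesFrom_subset (s + 1) hj
        exact hchild j hj' _ (by
          rw [singlesFrom_merge ht (hlt j hj').1 (hlt j hj').2 (by omega),
            Finset.card_erase_of_mem hj]))
      (fun j hj hjs => hchild j hj _ (by
        rw [singlesFrom_merge ht (hlt j hj).1 (hlt j hj).2 (by omega),
          Finset.erase_eq_of_notMem hjs]))
      fun i hi j hj hij => disjoint_chainsFrom
        (ofPartition_merge_ne hx ht (hlt i hi).1 (hlt i hi).2 (hlt j hj).2 hij) _ _
    rw [chainsFrom_two_succ hn hS hx hts ht]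
    refine (h1.union (h2.image List.cons_injective)
      (disjoint_chainsFrom_image hx ht hts)).congr rfl ?_
    have hu : (x.singlesFrom (s + 1)).card ≤ k :=
      hk ▸ Finset.card_le_card (x.singlesFrom_subset (s + 1))
    have hrec := flourishingCount_rec s (if t ∈ x.singles then 1 else 0) k
      (x.singlesFrom (s + 1)).card (by split_ifs <;> simp) hu
    have hw : s + 1 - (if ∃ t' : Fin n, (t' : ℕ) + 1 = s + 1 ∧ t' ∉ x.singles then 1 else 0) =
        s + if t ∈ x.singles then 1 else 0 := by
      simp only [hex]
      split_ifs <;> simp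
    rw [hw, hrec, hk, add_assoc]

end TypeD

/-! ### All decreasing maximal chains -/

namespace LabeledPartition

variable {n : ℕ} {S : Type*}

theorem code_finest (a : BarredSet n) : (finest n S).code a = Sum.inl a := by
  have hpart (b : BarredSet n) : (finest n S).partition.part b = {b} :=
    (finest n S).partition.part_eq_of_mem
      (Finpartition.mem_bot_iff.2 ⟨b, Finset.mem_univ b, rfl⟩) (Finset.mem_singleton_self b)
  rcases h : (finest n S).code a with c | σ
  · have := ((finest n S).code_eq_inl h).2.1
    rw [hpart, Finset.mem_singleton] at this
    rw [this]
  · have := (finest n S).code_eq_inr.1 h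
    exact absurd this (Finset.notMem_empty a)

theorem mem_singles_finest (i : Fin n) : i ∈ (finest n S).singles := by
  refine mem_singles.2 ⟨mem_reps.2 (code_finest _), fun a c hc hci => ?_⟩
  rw [code_finest] at hc
  rw [Sum.inl.inj hc, hci]

theorem signs_finest [Fintype S] : (finest n S).signs = ∅ := by
  ext σ
  rw [mem_signs]
  simp [finest]

end LabeledPartition

namespace TypeD

open LabeledPartition

variable {n : ℕ} {S : Type*} [Fintype S]

theorem zeroHat_eq : zeroHat n S = ofPartition (finest n S) :=
  Subtype.ext (val_ofPartition (isD_of_signs_empty signs_finest)).symm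

variable [LinearOrder S]

theorem edgeLabel_le {x : LabeledPartition n S} (hn : 2 ≤ n) (σ₀ : S) (hx : x.IsD)
    {y : TypeD n S} (hy : ofPartition x ⋖ y) :
    edgeLabel (ofPartition x).1 y.1 ≤ toLex (2, n) := by
  rw [ofPartition_covBy_iff hn σ₀ hx] at hy
  rcases hy with ⟨i, hi, j, hj, hij, b, rfl⟩ | ⟨i, hi, σ, hs, rfl⟩ | ⟨hr, rfl⟩
  · rw [edgeLabel_ofPartition hx (isD_merge hx hi hij)]
    cases b
    · rw [Prod.Lex.toLex_le_toLex, pairLabel_merge_false hi hj hij]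
      exact Or.inl Nat.zero_lt_two
    · rw [pairLabel_merge_true hi hj hij, two_le_two_iff]
      exact i.2
  · rw [edgeLabel_ofPartition hx (isD_signMove hx hi hs), pairLabel_signMove hi,
      Prod.Lex.toLex_le_toLex]
    exact Or.inl Nat.one_lt_two
  · rw [edgeLabel_oneHat hx]
    exact one_two_le n

/-- The bound (2,n) is vacuous: representatives are at most n, and every other label starts with 0
or 1. -/
theorem decreasingMaximalChains_eq (hn : 2 ≤ n) (σ₀ : S) :
    decreasingMaximalChains n S = chainsFrom (ofPartition (finest n S)) (toLex (2, n)) := by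
  have hx : (finest n S).IsD := isD_of_signs_empty signs_finest
  ext c
  simp only [decreasingMaximalChains, IsMaximalChain, chainsFrom, Set.mem_ofPred_eq, zeroHat_eq]
  constructor
  · rintro ⟨⟨h1, h2, h3⟩, h4⟩
    refine ⟨h1, h2, h3, ?_⟩
    rcases c with _ | ⟨z, _ | ⟨y, c⟩⟩
    · simp at h2
    · simp [labelWord]
    · obtain rfl : z = ofPartition (finest n S) := by simpa using h2
      rw [labelWord_cons_cons] at h4 ⊢
      exact pairwise_ge_cons_cons.2 ⟨edgeLabel_le hn σ₀ hx (List.isChain_cons_cons.1 h1).1, h4⟩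
  · rintro ⟨h1, h2, h3, h4⟩
    exact ⟨⟨h1, h2, h3⟩, (List.pairwise_cons.1 h4).2⟩

theorem hasCount_decreasingMaximalChains (hn : 2 ≤ n) (hS : Fintype.card S = 2) :
    HasCount (decreasingMaximalChains n S) (flourishingCount n n 0 0) := by
  classical
  obtain ⟨a, b, hab, hS2⟩ := Finset.card_eq_two.1 (Finset.card_univ.trans hS)
  have hmem (σ : S) : σ = a ∨ σ = b := by
    have := Finset.mem_univ σ
    rw [hS2] at this
    simpa using this
  obtain ⟨σ₀, σ₁, h01, hS'⟩ : ∃ σ₀ σ₁ : S, σ₀ < σ₁ ∧ ∀ σ, σ = σ₀ ∨ σ = σ₁ := by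
    rcases hab.lt_or_gt with h | h
    · exact ⟨a, b, h, hmem⟩
    · exact ⟨b, a, h, fun σ => (hmem σ).symm⟩
  rw [decreasingMaximalChains_eq hn σ₀]
  have h := hasCount_chainsFrom_two hn hS h01 hS' n (finest n S) le_rfl signs_finest
    fun i _ => mem_singles_finest i
  have hr : (finest n S).repsFrom n = ∅ := by
    ext i
    simp [mem_repsFrom]
  have hsing : (finest n S).singlesFrom n = ∅ :=
    Finset.subset_empty.1 (hr ▸ (finest n S).singlesFrom_subset n)
  rw [if_neg (fun ⟨t, _, ht⟩ => ht (mem_singles_finest t)), Nat.sub_zero, hr, hsing] at h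
  exact h

end TypeD

/-! ### The second closed form and the main theorem -/

theorem oddDoubleFactorial_identity (n : ℕ) (hn : 2 ≤ n) :
    (2 * n - 5)‼ * ((n - 2) * (n - 3)) + (2 * n - 3)‼ = (2 * n - 5)‼ * (n ^ 2 + 3 - 3 * n) := by
  obtain ⟨n, rfl⟩ := Nat.exists_eq_add_of_le' hn
  rcases n with _ | n
  -- For n = 2 the index 2n - 5 is truncated to 0, and the step (2n-3)!! = (2n-3)(2n-5)!! used below
  -- is not available in that form.
  · rfl
  · have e1 : 2 * (n + 1 + 2) - 3 = 2 * (n + 1 + 2) - 5 + 2 := by omega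
    have e2 : (n + 1 + 2) ^ 2 + 3 - 3 * (n + 1 + 2) = n ^ 2 + 3 * n + 3 := by
      rw [Nat.sub_eq_iff_eq_add (by nlinarith)]
      ring
    rw [e1, Nat.doubleFactorial_add_two, e2, (by omega : 2 * (n + 1 + 2) - 5 + 2 = 2 * n + 3),
      (by omega : n + 1 + 2 - 2 = n + 1), (by omega : n + 1 + 2 - 3 = n)]
    ring

theorem mainTheorem5 :
    (∀ n : ℕ,
      {T : IncreasingOrderedTree n | T.IsFlourishing 2}.encard =
        (partitionSum n flourishingWeight : ℕ∞)) ∧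
    (∀ (n : ℕ) (S : Type*) [Fintype S] [LinearOrder S], 2 ≤ n → Fintype.card S = 2 →
      (TypeD.decreasingMaximalChains n S).encard =
          (((2 * n - 5)‼ * ((n - 2) * (n - 3)) + (2 * n - 3)‼ : ℕ) : ℕ∞) ∧
        (2 * n - 5)‼ * ((n - 2) * (n - 3)) + (2 * n - 3)‼ =
          (2 * n - 5)‼ * (n ^ 2 + 3 - 3 * n)) := by
  refine ⟨IncreasingOrderedTree.encard_flourishing, fun n S _ _ hn hS => ⟨?_, ?_⟩⟩
  · refine HasCount.encard_eq ?_
    rw [← flourishingCount_self n hn]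
    exact TypeD.hasCount_decreasingMaximalChains hn hS
  · exact oddDoubleFactorial_identity n hn
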